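/- \textbf{Game.} Fix $a_1,a_2\in(0,1)$ with $D:=a_1+a_2-1>0$, $z_1,z_2\in(0,1)$, $r_1,r_2>0$, $\gamma_1\ge 0$, $0\le w_1<c_1<1$, $0<k_2<1-w_1$, and consider the following bargaining game $B(\gamma_1)$ over a unit surplus in continuous time $t\in[0,\infty)$. Player $i$ is justified with probability $z_i$, independently; a justified player never concedes. If $i$ concedes to $j$, $i$ gets $1-a_j$ and $j$ gets $a_j$ (simultaneous concessions: each $i$ gets $(a_i+1-a_j)/2$). A justified player 1 challenges at the first arrival of a Poisson process of rate $\gamma_1$; an unjustified player 1 may challenge at any time; challenging costs $c_1D$; a concession takes precedence over a simultaneous challenge. A challenged justified player 2 sees the challenge; an unjustified one either yields (payoffs $a_1$ and $1-a_1$, before player 1's cost) or sees it at cost $k_2D$, and then gets the share $1-a_1$ if player 1 is justified, while if player 1 is unjustified the expected shares are $1-a_2+w_1D$ for player 1 and $1-a_1+(1-w_1)D$ for player 2. An unjustified player 1 who challenges a justified player 2 gets the share $1-a_2$. Payoffs at time $t$ are discounted by $e^{-r_it}$. A strategy of an unjustified player 1 is a pair of nondecreasing right-continuous functions $F_1,G_1\ge0$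 on $[0,\infty)$ with $F_1+G_1\le 1$ (the probabilities of having conceded, respectively challenged, by time $t$); a strategy of an unjustified player 2 is a nondecreasing right-continuous $F_2:[0,\infty)\to[0,1]$ and a measurable $q_2:[0,\infty)\to[0,1]$ (the probability of yielding to a challenge made at $t$). Equilibrium means Bayesian Nash equilibrium. \textbf{Reputations.} Let $$\mu_1(t)=\frac{z_1e^{-\gamma_1t}}{z_1e^{-\gamma_1t}+(1-z_1)[1-F_1(t^-)-G_1(t^-)]},\qquad \mu_2(t)=\frac{z_2}{z_2+(1-z_2)[1-F_2(t^-)]},$$ $\nu_1^*:=1-\frac{k_2}{1-w_1}$ and $\mu_2^*:=1-c_1$. With the other parameters fixed, the reputation coevolution curve for $\gamma_1$ is the set of all pairs $(\mu_1(t),\mu_2(t))$, $t>0$, in equilibria of the game over all initial reputations in $(0,1)^2$. It is the graph of a function of $\mu_1$, written $\widetilde\mu_2(\mu_1|\gamma_1)$ (and set to $0$ at those $\mu_1\in(0,1)$ over which the curve has no point); $\mu_1^N$ is the unique reputation of player 1 at which player 2's reputation on the curve is $\mu_2^*$; and $t_1(\mu_1|\gamma_1)$ is the time it takes in equilibrium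 for player 1's reputation to increase from $\mu_1$ to $1$. \textbf{Proposition.} The curves for $\gamma_1$ and for $0$ are graphs over $\mu_1$, the quantities $\mu_1^N$, $t_1(\nu_1^*|\gamma_1)$ and $t_1(\nu_1^*|0)$ are well defined, and in each of the games $B(\gamma_1)$ and $B(0)$ an equilibrium exists and all equilibria give the unjustified player 1 the same payoff, denoted $u_1(\gamma_1)$ and $u_1(0)$. Consider the condition $$\mu_1^N>\nu_1^*\quad\text{and}\quad t_1(\nu_1^*|\gamma_1)<t_1(\nu_1^*|0).\tag{A}$$ (i) If (A) holds, the equation $\widetilde\mu_2(\mu_1|\gamma_1)=\widetilde\mu_2(\mu_1|0)$ has exactly two solutions $\underline\mu_1<\overline\mu_1$ in $(0,1)$, and an unjustified player 1 strictly benefits from the introduction of the challenge opportunity, i.e. $u_1(\gamma_1)>u_1(0)$, if and only if $$\underline\mu_1<z_1<\overline\mu_1,\qquad \widetilde\mu_2(\underline\mu_1|\gamma_1)<\widetilde\mu_2(z_1|\gamma_1)<\widetilde\mu_2(\overline\mu_1|\gamma_1)\qquad\text{and}\qquad z_2<\widetilde\mu_2(z_1|\gamma_1).$$ (ii) If (A)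 does not hold, an unjustified player 1 does not benefit: $u_1(\gamma_1)\le u_1(0)$. -/

import Mathlib

open MeasureTheory Set

noncomputable section

/-- The data of a bargaining game with ultimatum opportunities for player 1: demands `a₁, a₂`, prior
probabilities `z₁, z₂` of being justified, discount rates `r₁, r₂`, the rate `γ₁` at which a
justified player 1 gets to challenge, challenge cost `c₁`, seeing cost `k₂` (both as proportions of
the disagreement), and the probability `w₁` with which an unjustified player 1 wins in court
against an unjustified player 2. -/
structure BargainingGame where
  (a₁ a₂ z₁ z₂ r₁ r₂ γ₁ c₁ k₂ w₁ : ℝ)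

/-- The standing assumptions on the parameters. -/
structure BargainingGame.Valid (B : BargainingGame) : Prop where
  a₁_mem : B.a₁ ∈ Ioo (0 : ℝ) 1
  a₂_mem : B.a₂ ∈ Ioo (0 : ℝ) 1
  conflict : 1 - B.a₁ < B.a₂
  z₁_mem : B.z₁ ∈ Ioo (0 : ℝ) 1
  z₂_mem : B.z₂ ∈ Ioo (0 : ℝ) 1
  r₁_pos : 0 < B.r₁
  r₂_pos : 0 < B.r₂
  γ₁_nonneg : 0 ≤ B.γ₁
  w₁_nonneg : 0 ≤ B.w₁
  w₁_lt : B.w₁ < B.c₁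
  c₁_lt : B.c₁ < 1
  k₂_pos : 0 < B.k₂
  k₂_lt : B.k₂ < 1 - B.w₁

/-- A strategy of an unjustified player 1: `F t` and `G t` are the probabilities of having conceded,
respectively challenged, by time `t` (inclusive); an atom at time `0` is allowed. -/
structure Strategy₁ where
  F : StieltjesFunction ℝ
  G : StieltjesFunction ℝ
  F_neg : ∀ t < 0, F t = 0
  G_neg : ∀ t < 0, G t = 0
  add_le_one : ∀ t, F t + G t ≤ 1

/-- A strategy of an unjustified player 2: `F t` is the probability of having conceded by time `t`
(inclusive), and `q t` is the probability of yielding to a challenge made at time `t`. -/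
structure Strategy₂ where
  F : StieltjesFunction ℝ
  F_neg : ∀ t < 0, F t = 0
  F_le_one : ∀ t, F t ≤ 1
  q : ℝ → ℝ
  q_measurable : Measurable q
  q_mem : ∀ t, q t ∈ Icc (0 : ℝ) 1

namespace BargainingGame

variable (B : BargainingGame)

/-- The same game with prior probabilities `x₁, x₂`. -/
def withPriors (x₁ x₂ : ℝ) : BargainingGame := { B with z₁ := x₁, z₂ := x₂ }

/-- The same game without challenge opportunities for a justified player 1. -/
def withoutChallenge : BargainingGame := { B with γ₁ := 0 }

/-- The amount of disagreement. -/
def D : ℝ := B.a₁ + B.a₂ - 1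

/-! ### Payoffs -/

/-- Expected utility of an unjustified player 1 from conceding at time `t`
(equal split if player 2 concedes at the same time). -/
def U₁ (t : ℝ) (σ₂ : Strategy₂) : ℝ :=
  (1 - B.z₂) * (∫ s in Ico 0 t, B.a₁ * Real.exp (-B.r₁ * s) ∂σ₂.F.measure)
    + (1 - (1 - B.z₂) * σ₂.F t) * Real.exp (-B.r₁ * t) * (1 - B.a₂)
    + (1 - B.z₂) * (σ₂.F t - Function.leftLim σ₂.F t)
        * Real.exp (-B.r₁ * t) * ((B.a₁ + 1 - B.a₂) / 2)

/-- Expected utility of an unjustified player 1 from challenging at time `t`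
(a simultaneous concession by player 2 takes precedence). -/
def V₁ (t : ℝ) (σ₂ : Strategy₂) : ℝ :=
  (1 - B.z₂) * (∫ s in Icc 0 t, B.a₁ * Real.exp (-B.r₁ * s) ∂σ₂.F.measure)
    + (1 - (1 - B.z₂) * σ₂.F t) * Real.exp (-B.r₁ * t) * (1 - B.a₂ - B.c₁ * B.D)
    + (1 - B.z₂) * (1 - σ₂.F t) * Real.exp (-B.r₁ * t)
        * (((1 - σ₂.q t) * B.w₁ + σ₂.q t) * B.D)

/-- Expected utility of an unjustified player 1 from never conceding and never challenging. -/
def W₁ (σ₂ : Strategy₂) : ℝ :=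
  (1 - B.z₂) * (∫ s in Ici 0, B.a₁ * Real.exp (-B.r₁ * s) ∂σ₂.F.measure)

/-- Expected utility of an unjustified player 1 from the strategy `σ₁`. -/
def u₁ (σ₁ : Strategy₁) (σ₂ : Strategy₂) : ℝ :=
  (∫ t in Ici 0, B.U₁ t σ₂ ∂σ₁.F.measure) + (∫ t in Ici 0, B.V₁ t σ₂ ∂σ₁.G.measure)
    + (1 - σ₁.F.measure.real (Ici 0) - σ₁.G.measure.real (Ici 0)) * B.W₁ σ₂

/-- Payoff that an unjustified player 2 using the yielding rule `q` collects from concessions and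
challenges of player 1 at times in the set `I`. -/
def received₂ (I : Set ℝ) (q : ℝ → ℝ) (σ₁ : Strategy₁) : ℝ :=
  (1 - B.z₁) * (∫ s in I, B.a₂ * Real.exp (-B.r₂ * s) ∂σ₁.F.measure)
    + B.z₁ * (∫ s in I, (1 - B.a₁ - (1 - q s) * B.k₂ * B.D) * Real.exp (-B.r₂ * s)
        * (B.γ₁ * Real.exp (-B.γ₁ * s)))
    + (1 - B.z₁) * (∫ s in I, (1 - B.a₁ + (1 - q s) * (1 - B.w₁ - B.k₂) * B.D)
        * Real.exp (-B.r₂ * s) ∂σ₁.G.measure)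

/-- Expected utility of an unjustified player 2 from conceding at time `t` and yielding to
challenges according to `q` (equal split if player 1 concedes at the same time; a concession takes
precedence over a simultaneous challenge). -/
def U₂ (t : ℝ) (q : ℝ → ℝ) (σ₁ : Strategy₁) : ℝ :=
  B.received₂ (Ico 0 t) q σ₁
    + Real.exp (-B.r₂ * t) * (1 - B.a₁)
        * (1 - (1 - B.z₁) * σ₁.F t - (1 - B.z₁) * Function.leftLim σ₁.G t
            - B.z₁ * (1 - Real.exp (-B.γ₁ * t)))
    + (1 - B.z₁) * (σ₁.F t - Function.leftLim σ₁.F t)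
        * Real.exp (-B.r₂ * t) * ((B.a₂ + 1 - B.a₁) / 2)

/-- Expected utility of an unjustified player 2 from the strategy `σ₂`; the last term is the
contribution of never conceding. -/
def u₂ (σ₁ : Strategy₁) (σ₂ : Strategy₂) : ℝ :=
  (∫ t in Ici 0, B.U₂ t σ₂.q σ₁ ∂σ₂.F.measure)
    + (1 - σ₂.F.measure.real (Ici 0)) * B.received₂ (Ici 0) σ₂.q σ₁

/-! ### Equilibrium -/

/-- Bayesian Nash equilibrium. -/
def IsEquilibrium (σ₁ : Strategy₁) (σ₂ : Strategy₂) : Prop :=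
  (∀ τ₁ : Strategy₁, B.u₁ τ₁ σ₂ ≤ B.u₁ σ₁ σ₂) ∧ (∀ τ₂ : Strategy₂, B.u₂ σ₁ τ₂ ≤ B.u₂ σ₁ σ₂)

/-- The set of payoffs of an unjustified player 1 in equilibria of the game. -/
def equilibriumPayoffs₁ : Set ℝ :=
  {u | ∃ σ₁ σ₂, B.IsEquilibrium σ₁ σ₂ ∧ u = B.u₁ σ₁ σ₂}

/-! ### Reputations -/

/-- Posterior probability that player 1 is justified, given that the game has not ended before
time `t`. -/
def reputation₁ (σ₁ : Strategy₁) (t : ℝ) : ℝ :=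
  B.z₁ * Real.exp (-B.γ₁ * t) /
    (B.z₁ * Real.exp (-B.γ₁ * t)
      + (1 - B.z₁) * (1 - Function.leftLim σ₁.F t - Function.leftLim σ₁.G t))

/-- Posterior probability that player 2 is justified, given that the game has not ended before
time `t`. -/
def reputation₂ (σ₂ : Strategy₂) (t : ℝ) : ℝ :=
  B.z₂ / (B.z₂ + (1 - B.z₂) * (1 - Function.leftLim σ₂.F t))

/-- The reputation of player 1 conditional on challenging that makes an unjustified player 2
indifferent between yielding and seeing the challenge. -/
def νStar : ℝ := 1 - B.k₂ / (1 - B.w₁)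

/-- The reputation of player 2 at which an unjustified player 1 is indifferent between conceding and
challenging an opponent who yields whenever unjustified. -/
def μStar₂ : ℝ := 1 - B.c₁

/-- The reputation coevolution curve: the locus of the reputation pairs at times `t > 0` in
equilibria of the game, over all initial reputations. -/
def coevolutionCurve : Set (ℝ × ℝ) :=
  {p | ∃ x₁ ∈ Ioo (0 : ℝ) 1, ∃ x₂ ∈ Ioo (0 : ℝ) 1, ∃ σ₁ σ₂,
    (B.withPriors x₁ x₂).IsEquilibrium σ₁ σ₂ ∧ ∃ t > 0,
      p = ((B.withPriors x₁ x₂).reputation₁ σ₁ t, (B.withPriors x₁ x₂).reputation₂ σ₂ t)}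

/-- The coevolution curve as a function of player 1's reputation: the ordinate of its point with
abscissa `x`, and `0` if there is none. -/
def μTilde₂ (x : ℝ) : ℝ := sSup {y | (x, y) ∈ B.coevolutionCurve}

/-- The reputations of player 1 at which player 2's reputation is `y` on the coevolution curve. -/
def reputationsAt (y : ℝ) : Set ℝ := {x | (x, y) ∈ B.coevolutionCurve}

/-- The lengths of time that it takes, in equilibria of the game over all initial reputations,
for player 1's reputation to go from `x` (at some time `t > 0`) to `1`. -/
def timesToOne (x : ℝ) : Set ℝ :=
  {d | ∃ x₁ ∈ Ioo (0 : ℝ) 1, ∃ x₂ ∈ Ioo (0 : ℝ) 1, ∃ σ₁ σ₂,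
    (B.withPriors x₁ x₂).IsEquilibrium σ₁ σ₂ ∧ ∃ t > 0,
      (B.withPriors x₁ x₂).reputation₁ σ₁ t = x ∧
      IsLeast {s | 0 ≤ s ∧ (B.withPriors x₁ x₂).reputation₁ σ₁ (t + s) = 1} d}

end BargainingGame

end

/-! Write `λᵢ` for `rateᵢ`. Subtracting the payoff of an immediate concession and dividing by `D`
turns each player's concession payoff into that of an abstract war of attrition: `drift` for
conceding right after `t`, minus half the opponent's atom for a tie at `t` (`U₁_eq`, `U₂_eq`). Being
challenged and yielding gives player 2 the same share as conceding, and the total gain from seeing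
challenges vanishes in equilibrium (`IsOptimalOn.seeGain_eq_zero`), so concession times are mutual
best replies in this war. Hence there are no atoms after time 0, no gaps, a common last time `T`,
and total concession hazard rates `λ₁`, `λ₂`.

Challenges are pinned down separately. Bluffing cannot pay once player 2's reputation exceeds `1 -
c₁`, which happens when less than `quietTime` remains. Earlier, player 2 must see challenges with
positive probability and is therefore indifferent, so unjustified challenges stand in the fixed
ratio `bluffRatio` to justified ones (`IsEqUntil.mul_G_eq_of_lt`). With time `s` to go, the
reputations are thus `1 / invRep s` and `exp (-λ₂ s)`, whatever the priors. The priors determine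
only `T`: the players do not both concede at 0, so the larger of `z₁ * invRep T` and `z₂ * exp (λ₂
T)` is 1. The payoff of player 1 is `1 - a₂ + D (1 - z₂ exp (λ₂ T))`, decreasing in `T`. Conversely
the strategies so described are best replies, which gives existence.

For `γ₁ = 0`, `invRep s` is `exp (λ₁ s)`. Player 1 therefore benefits exactly when `T` is shorter
than without challenges, that is, when `z₁ = 1 / invRep T`, `z₂ < exp (-λ₂ T)` and `repRatio T = exp
(-λ₁ T) * invRep T > 1` (`duration_lt_iff`). For `γ₁ > 0` the derivative of `repRatio` has the sign
of `1 - invRep` in the quiet phase and of `1 + bluffRatio - invRep = 1 / νStar - invRep` beyond it.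
So `repRatio` starts at 1, falls, possibly rises until player 1's reputation is `νStar`, and then
falls to 0. Condition (A) says that this peak exists and exceeds 1. Then `repRatio > 1` holds
exactly between two crossings, which are the two intersections of the curves; otherwise `repRatio ≤
1` throughout. -/

noncomputable section

open Filter Topology Function

/-! ### Distribution functions of sub-probability measures on `[0, ∞)` -/

/-- `K` is the distribution function of a sub-probability measure on `[0, ∞)`. -/
structure StieltjesFunction.IsSubCDF (K : StieltjesFunction ℝ) : Prop where
  neg : ∀ t < 0, K t = 0
  le_one : ∀ t, K t ≤ 1

namespace StieltjesFunction.IsSubCDF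

variable {K : StieltjesFunction ℝ}

lemma nonneg (hK : K.IsSubCDF) (t : ℝ) : 0 ≤ K t := by
  rw [← hK.neg (min t 0 - 1) (by linarith [min_le_right t 0])]
  exact K.mono (by linarith [min_le_left t 0])

lemma isFiniteMeasure (hK : K.IsSubCDF) : IsFiniteMeasure K.measure :=
  K.isFiniteMeasure_of_forall_abs_le (C := 1) fun t => by
    rw [abs_of_nonneg (hK.nonneg t)]; exact hK.le_one t

lemma leftLim_nonneg (hK : K.IsSubCDF) (t : ℝ) : 0 ≤ leftLim K t := by
  rw [← hK.neg (min t 0 - 1) (by linarith [min_le_right t 0])]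
  exact K.mono.le_leftLim (by linarith [min_le_left t 0])

lemma leftLim_zero (hK : K.IsSubCDF) : leftLim K 0 = 0 := by
  refine leftLim_eq_of_tendsto ?_
  refine tendsto_const_nhds.congr' ?_
  filter_upwards [self_mem_nhdsWithin] with t ht
  exact (hK.neg t ht).symm

end StieltjesFunction.IsSubCDF

namespace StieltjesFunction

variable (K : StieltjesFunction ℝ)

lemma real_Ioc {a b : ℝ} (h : a ≤ b) : K.measure.real (Ioc a b) = K b - K a := by
  rw [Measure.real, K.measure_Ioc, ENNReal.toReal_ofReal (sub_nonneg.2 (K.mono h))]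

lemma real_singleton (a : ℝ) : K.measure.real {a} = K a - leftLim K a := by
  rw [Measure.real, K.measure_singleton,
    ENNReal.toReal_ofReal (sub_nonneg.2 (K.mono.leftLim_le le_rfl))]

lemma leftLim_le_self (t : ℝ) : leftLim K t ≤ K t := K.mono.leftLim_le le_rfl

lemma measurable_coe : Measurable K := K.mono.measurable

lemma measurable_leftLim : Measurable (leftLim K) := K.mono.leftLim.measurable

lemma eq_of_measure_Ioc_eq_zero {a b : ℝ} (h : a ≤ b) (h0 : K.measure (Ioc a b) = 0) :
    K a = K b := by
  have := K.real_Ioc h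
  rw [Measure.real, h0] at this
  simp at this; linarith

lemma leftLim_eq_of_measure_singleton {a : ℝ} (h0 : K.measure {a} = 0) :
    leftLim K a = K a := by
  have := K.real_singleton a
  rw [Measure.real, h0] at this
  simp at this; linarith

/-- A Stieltjes function is left continuous where it has no atom. -/
lemma continuousAt_of_leftLim_eq {t : ℝ} (h : leftLim K t = K t) : ContinuousAt K t :=
  continuousAt_iff_continuous_left'_right'.2
    ⟨K.mono.continuousWithinAt_Iio_iff_leftLim_eq.2 h,
      (K.right_continuous t).mono Ioi_subset_Ici_self⟩

end StieltjesFunction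

namespace StieltjesFunction.IsSubCDF

variable {K : StieltjesFunction ℝ}

lemma real_Icc (hK : K.IsSubCDF) (t : ℝ) : K.measure.real (Icc 0 t) = K t := by
  rw [Measure.real, K.measure_Icc, hK.leftLim_zero, sub_zero, ENNReal.toReal_ofReal (hK.nonneg t)]

lemma measure_Iio (hK : K.IsSubCDF) : K.measure (Iio 0) = 0 := by
  have h : Tendsto K atBot (𝓝 0) := tendsto_const_nhds.congr' <| by
    filter_upwards [eventually_lt_atBot 0] with t ht
    exact (hK.neg t ht).symm
  rw [K.measure_Iio h, hK.leftLim_zero]; simp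

lemma ae_nonneg (hK : K.IsSubCDF) : ∀ᵐ t ∂K.measure, 0 ≤ t := by
  rw [ae_iff]
  refine measure_mono_null (fun t ht => ?_) hK.measure_Iio
  simpa using ht

lemma restrict_Ici (hK : K.IsSubCDF) : K.measure.restrict (Ici 0) = K.measure :=
  Measure.restrict_eq_self_of_ae_mem hK.ae_nonneg

lemma tendsto_atTop (hK : K.IsSubCDF) : Tendsto K atTop (𝓝 (K.measure.real (Ici 0))) := by
  have hb : BddAbove (range K) := ⟨1, by rintro _ ⟨t, rfl⟩; exact hK.le_one t⟩
  have h := tendsto_atTop_ciSup K.mono hb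
  have h2 : K.measure.real (Ici 0) = ⨆ i, K i := by
    rw [Measure.real, K.measure_Ici h, hK.leftLim_zero, sub_zero, ENNReal.toReal_ofReal]
    exact le_ciSup_of_le hb 0 (hK.nonneg 0)
  rwa [h2]

lemma integrableOn_of_bound (hK : K.IsSubCDF) {f : ℝ → ℝ} (hf : Measurable f) {C : ℝ}
    (hC : ∀ t, 0 ≤ t → |f t| ≤ C) {I : Set ℝ} (hI : MeasurableSet I) (h0 : I ⊆ Ici 0) :
    IntegrableOn f I K.measure := by
  have := hK.isFiniteMeasure
  refine Measure.integrableOn_of_bounded (M := C) (measure_ne_top _ _) hf.aestronglyMeasurable ?_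
  filter_upwards [ae_restrict_mem hI] with t ht
  exact hC t (h0 ht)

end StieltjesFunction.IsSubCDF

/-! ### Discounting and integration by parts -/

lemma exp_neg_mul_le_one {r t : ℝ} (hr : 0 ≤ r) (ht : 0 ≤ t) : Real.exp (-r * t) ≤ 1 := by
  rw [Real.exp_le_one_iff]; nlinarith [mul_nonneg hr ht]

lemma abs_exp_neg_mul_le_one {r : ℝ} (hr : 0 ≤ r) (t : ℝ) (ht : 0 ≤ t) :
    |Real.exp (-r * t)| ≤ 1 := by
  rw [abs_of_pos (Real.exp_pos _)]; exact exp_neg_mul_le_one hr ht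

lemma measurable_exp_neg_mul (r : ℝ) : Measurable fun t : ℝ => Real.exp (-r * t) := by fun_prop

lemma integral_mul_exp_neg (r s t : ℝ) :
    ∫ v in s..t, r * Real.exp (-r * v) = Real.exp (-r * s) - Real.exp (-r * t) := by
  have h : ∀ x ∈ uIcc s t, HasDerivAt (fun v => -Real.exp (-r * v)) (r * Real.exp (-r * x)) x := by
    intro x _
    have h1 : HasDerivAt (fun v : ℝ => -r * v) (-r) x := by
      simpa using (hasDerivAt_id x).const_mul (-r)
    exact h1.exp.neg.congr_deriv (by ring)
  rw [intervalIntegral.integral_eq_sub_of_hasDerivAt h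
    (Continuous.intervalIntegrable (by fun_prop) _ _)]
  ring

/-- Integration by parts against a distribution function. -/
lemma StieltjesFunction.IsSubCDF.integral_exp {K : StieltjesFunction ℝ} (hK : K.IsSubCDF)
    {r t : ℝ} (ht : 0 ≤ t) :
    ∫ s in Icc 0 t, Real.exp (-r * s) ∂K.measure
      = Real.exp (-r * t) * K t + r * ∫ s in (0)..t, Real.exp (-r * s) * K s := by
  have := hK.isFiniteMeasure
  -- Fubini for `r * exp (-r v)` on `s < v ≤ t`: integrating in `v` first gives `exp (-r s) - exp
  -- (-r t)`, integrating in `s` first gives the left limit of `K` at `v`, which differs from `K v`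
  -- only on a countable set.
  let f : ℝ → ℝ → ℝ := fun s v => {p : ℝ × ℝ | p.1 < p.2}.indicator
    (fun p => r * Real.exp (-r * p.2)) (s, v)
  have hmeas : Measurable (uncurry f) := by
    have h : MeasurableSet {p : ℝ × ℝ | p.1 < p.2} := measurableSet_lt measurable_fst measurable_snd
    have h2 : Measurable fun p : ℝ × ℝ => r * Real.exp (-r * p.2) := by fun_prop
    exact h2.indicator h
  have hint : Integrable (uncurry f)
      ((K.measure.restrict (Icc 0 t)).prod (volume.restrict (Ioc 0 t))) := by
    refine Integrable.of_bound hmeas.aestronglyMeasurable (|r| * Real.exp (|r| * t)) ?_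
    rw [Measure.prod_restrict]
    filter_upwards [ae_restrict_mem (measurableSet_Icc.prod measurableSet_Ioc)] with p hp
    obtain ⟨_, hp⟩ := hp
    simp only [uncurry, f, Set.indicator]
    split_ifs
    · rw [Real.norm_eq_abs, abs_mul, abs_of_pos (Real.exp_pos _)]
      gcongr
      · exact hp.1.le
      · exact (le_abs_self _).trans (abs_neg r).le
      · exact hp.2
    · simp; positivity
  have hswap := integral_integral_swap hint
  have hL : ∀ s ∈ Icc 0 t, ∫ v in Ioc 0 t, f s v = Real.exp (-r * s) - Real.exp (-r * t) := by
    intro s hs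
    rw [← integral_mul_exp_neg, intervalIntegral.integral_of_le hs.2]
    have : f s = (Ioi s).indicator fun v => r * Real.exp (-r * v) := by
      ext v; simp [f, Set.indicator]
    rw [this, setIntegral_indicator _root_.measurableSet_Ioi]
    congr 2
    ext v; simp only [mem_inter_iff, mem_Ioc, mem_Ioi]
    constructor
    · rintro ⟨⟨_, h⟩, h'⟩; exact ⟨h', h⟩
    · rintro ⟨h', h⟩; exact ⟨⟨hs.1.trans_lt h', h⟩, h'⟩
  have hR : ∀ v ∈ Ioc 0 t, ∫ s in Icc 0 t, f s v ∂K.measure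
      = r * Real.exp (-r * v) * leftLim K v := by
    intro v hv
    have : (fun s => f s v) = (Iio v).indicator fun _ => r * Real.exp (-r * v) := by
      ext s; simp [f, Set.indicator]
    rw [this, setIntegral_indicator measurableSet_Iio, setIntegral_const]
    have h2 : Icc 0 t ∩ Iio v = Ico 0 v := by
      ext s; simp only [mem_inter_iff, mem_Icc, mem_Iio, mem_Ico]
      constructor
      · rintro ⟨⟨h, _⟩, h'⟩; exact ⟨h, h'⟩
      · rintro ⟨h, h'⟩; exact ⟨⟨h, h'.le.trans hv.2⟩, h'⟩
    rw [h2, Measure.real, K.measure_Ico, hK.leftLim_zero, sub_zero,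
      ENNReal.toReal_ofReal (hK.leftLim_nonneg v), smul_eq_mul]; ring
  rw [setIntegral_congr_fun measurableSet_Icc hL, setIntegral_congr_fun measurableSet_Ioc hR,
    integral_sub, setIntegral_const, hK.real_Icc t] at hswap
  · have hae : ∫ v in Ioc 0 t, r * Real.exp (-r * v) * leftLim K v
        = r * ∫ s in (0)..t, Real.exp (-r * s) * K s := by
      rw [intervalIntegral.integral_of_le ht, ← integral_const_mul]
      refine integral_congr_ae (ae_restrict_of_ae ?_)
      have hc : ∀ᵐ v : ℝ, v ∉ {x | leftLim K x ≠ K x} :=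
        (K.countable_leftLim_ne).ae_notMem volume
      filter_upwards [hc] with v hv
      simp only [ne_eq, not_not] at hv
      rw [hv]; ring
    rw [hae] at hswap
    simp only [smul_eq_mul] at hswap
    linarith
  · refine Integrable.of_bound (by fun_prop) (Real.exp (|r| * t)) ?_
    filter_upwards [ae_restrict_mem measurableSet_Icc] with s hs
    rw [Real.norm_eq_abs, abs_of_pos (Real.exp_pos _)]
    gcongr
    · exact hs.1
    · exact (le_abs_self _).trans (abs_neg r).le
    · exact hs.2
  · exact integrable_const _

/-! ### Distribution functions of finite measures -/

/-- The distribution function of a finite measure. -/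
def MeasureTheory.Measure.distrib (ν : Measure ℝ) [IsFiniteMeasure ν] : StieltjesFunction ℝ where
  toFun t := ν.real (Iic t)
  mono' _ _ h := measureReal_mono (Iic_subset_Iic.2 h)
  right_continuous' x := by
    have h : Tendsto (fun t => ν (Iic t)) (𝓝[>] x) (𝓝 (ν (⋂ r > x, Iic r))) :=
      tendsto_measure_biInter_gt (fun _ _ => measurableSet_Iic.nullMeasurableSet)
        (fun i j _ h => Iic_subset_Iic.2 h) ⟨x + 1, by simp, measure_ne_top _ _⟩
    have h2 : (⋂ r > x, Iic r) = Iic x := by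
      ext y; simp only [mem_iInter, mem_Iic]
      exact ⟨fun h => le_of_forall_gt_imp_ge_of_dense h, fun h r hr => h.trans hr.le⟩
    rw [h2] at h
    have h3 := (ENNReal.tendsto_toReal (measure_ne_top ν (Iic x))).comp h
    exact continuousWithinAt_Ioi_iff_Ici.1 h3

lemma MeasureTheory.Measure.distrib_apply (ν : Measure ℝ) [IsFiniteMeasure ν] (t : ℝ) :
    ν.distrib t = ν.real (Iic t) := rfl

lemma MeasureTheory.Measure.measure_distrib (ν : Measure ℝ) [IsFiniteMeasure ν] :
    ν.distrib.measure = ν := by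
  refine Measure.ext_of_Ioc _ _ fun a b hab => ?_
  rw [StieltjesFunction.measure_Ioc, ν.distrib_apply, ν.distrib_apply, ← Iic_sdiff_Iic,
    ← measureReal_sdiff (Iic_subset_Iic.2 hab.le) measurableSet_Iic, ofReal_measureReal]

lemma MeasureTheory.Measure.isSubCDF_distrib (ν : Measure ℝ) [IsFiniteMeasure ν]
    (h0 : ν (Iio 0) = 0) (h1 : ν.real univ ≤ 1) : ν.distrib.IsSubCDF where
  neg t ht := by
    have h : ν (Iic t) = 0 :=
      measure_mono_null (fun x hx => lt_of_le_of_lt (mem_Iic.1 hx) ht) h0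
    simp [ν.distrib_apply, Measure.real, h]
  le_one t := (measureReal_mono (subset_univ _)).trans h1

/-! ### Wars of attrition -/

/-- Net discounted gain, up to and including time `t`, of waiting for an opponent who concedes
according to `p • K` and survives with probability `S`, when waiting costs `l` per unit of time. -/
def drift (K : StieltjesFunction ℝ) (p r l : ℝ) (S : ℝ → ℝ) (t : ℝ) : ℝ :=
  p * (∫ s in Icc 0 t, Real.exp (-r * s) ∂K.measure) - l * ∫ s in (0)..t, Real.exp (-r * s) * S s

/-- Net discounted gain of conceding at `t`, when simultaneous concessions halve the gain. -/
def gain (K : StieltjesFunction ℝ) (p r l : ℝ) (S : ℝ → ℝ) (t : ℝ) : ℝ :=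
  drift K p r l S t - p * Real.exp (-r * t) * (K t - leftLim K t) / 2

/-- Admissible data of an opponent in a war of attrition. -/
structure IsOpponent (K : StieltjesFunction ℝ) (p r l : ℝ) (S : ℝ → ℝ) : Prop where
  sub : K.IsSubCDF
  p_pos : 0 < p
  r_pos : 0 < r
  l_pos : 0 < l
  S_meas : Measurable S
  S_pos : ∀ t, 0 ≤ t → 0 < S t
  S_le : ∀ t, 0 ≤ t → S t ≤ 1

/-- The concession times distributed according to `K'` are best replies, with payoff `u`. -/
structure IsReply (K' K : StieltjesFunction ℝ) (p r l : ℝ) (S : ℝ → ℝ) (u : ℝ) : Prop where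
  sub : K'.IsSubCDF
  le : ∀ t, 0 ≤ t → gain K p r l S t ≤ u
  ae_eq : ∀ᵐ t ∂K'.measure, gain K p r l S t = u

section Attrition

variable {K K' : StieltjesFunction ℝ} {p r l p' r' l' : ℝ} {S S' : ℝ → ℝ} {u u' : ℝ}

namespace IsOpponent

lemma intervalIntegrable (h : IsOpponent K p r l S) {s t : ℝ} (hs : 0 ≤ s) (ht : 0 ≤ t) :
    IntervalIntegrable (fun v => Real.exp (-r * v) * S v) volume s t := by
  have hm : Measurable fun v => Real.exp (-r * v) * S v :=
    (measurable_exp_neg_mul r).mul h.S_meas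
  rw [intervalIntegrable_iff]
  refine Measure.integrableOn_of_bounded (M := 1) measure_Ioc_lt_top.ne hm.aestronglyMeasurable ?_
  filter_upwards [ae_restrict_mem measurableSet_uIoc] with v hv
  have hv0 : 0 ≤ v := (le_min hs ht).trans hv.1.le
  rw [Real.norm_eq_abs, abs_of_pos (mul_pos (Real.exp_pos _) (h.S_pos v hv0))]
  exact mul_le_one₀ (exp_neg_mul_le_one h.r_pos.le hv0) (h.S_pos v hv0).le (h.S_le v hv0)

lemma cost_pos (h : IsOpponent K p r l S) {s t : ℝ} (hs : 0 ≤ s) (hst : s < t) :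
    0 < l * ∫ v in s..t, Real.exp (-r * v) * S v := by
  refine mul_pos h.l_pos (intervalIntegral.intervalIntegral_pos_of_pos_on
    (h.intervalIntegrable hs (hs.trans hst.le)) (fun v hv => ?_) hst)
  exact mul_pos (Real.exp_pos _) (h.S_pos v (hs.trans hv.1.le))

lemma cost_le (h : IsOpponent K p r l S) {s t : ℝ} (hs : 0 ≤ s) (hst : s ≤ t) :
    l * ∫ v in s..t, Real.exp (-r * v) * S v ≤ l * (t - s) := by
  refine mul_le_mul_of_nonneg_left ?_ h.l_pos.le
  have h1 := intervalIntegral.integral_mono_on hst (h.intervalIntegrable hs (hs.trans hst))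
    (intervalIntegrable_const (c := (1 : ℝ))) (fun v hv => ?_)
  · simpa using h1
  · have hv0 := hs.trans hv.1
    exact mul_le_one₀ (exp_neg_mul_le_one h.r_pos.le hv0) (h.S_pos v hv0).le (h.S_le v hv0)

lemma drift_sub (h : IsOpponent K p r l S) {s t : ℝ} (hs : 0 ≤ s) (hst : s ≤ t) :
    drift K p r l S t - drift K p r l S s = p * (∫ v in Ioc s t, Real.exp (-r * v) ∂K.measure)
      - l * ∫ v in s..t, Real.exp (-r * v) * S v := by
  have h1 : ∫ v in Icc 0 t, Real.exp (-r * v) ∂K.measure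
      = (∫ v in Icc 0 s, Real.exp (-r * v) ∂K.measure)
        + ∫ v in Ioc s t, Real.exp (-r * v) ∂K.measure := by
    rw [← Icc_union_Ioc_eq_Icc hs hst, setIntegral_union]
    · exact disjoint_left.2 fun v hv hv' => absurd hv.2 (not_le.2 hv'.1)
    · exact measurableSet_Ioc
    · exact h.sub.integrableOn_of_bound (measurable_exp_neg_mul r)
        (abs_exp_neg_mul_le_one h.r_pos.le) measurableSet_Icc (fun v hv => hv.1)
    · exact h.sub.integrableOn_of_bound (measurable_exp_neg_mul r)
        (abs_exp_neg_mul_le_one h.r_pos.le) measurableSet_Ioc (fun v hv => hs.trans hv.1.le)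
  have h2 := intervalIntegral.integral_add_adjacent_intervals (h.intervalIntegrable le_rfl hs)
    (h.intervalIntegrable hs (hs.trans hst))
  rw [drift, drift, h1, ← h2]; ring

lemma integral_Ioc_nonneg (r : ℝ) (s t : ℝ) :
    0 ≤ ∫ v in Ioc s t, Real.exp (-r * v) ∂K.measure :=
  integral_nonneg fun _ => (Real.exp_pos _).le

lemma integral_Ioc_le (h : IsOpponent K p r l S) {s t : ℝ} (hs : 0 ≤ s) (hst : s ≤ t) :
    ∫ v in Ioc s t, Real.exp (-r * v) ∂K.measure ≤ K t - K s := by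
  have := h.sub.isFiniteMeasure
  have h1 := setIntegral_mono_on (μ := K.measure) (s := Ioc s t) (g := fun _ => (1 : ℝ))
    (h.sub.integrableOn_of_bound (measurable_exp_neg_mul r)
      (abs_exp_neg_mul_le_one h.r_pos.le) measurableSet_Ioc (fun v hv => hs.trans hv.1.le))
    (integrable_const _) measurableSet_Ioc
    (fun v hv => exp_neg_mul_le_one h.r_pos.le (hs.trans hv.1.le))
  rwa [setIntegral_const, K.real_Ioc hst, smul_eq_mul, mul_one] at h1

/-- While the opponent does not concede, only the flow cost accumulates, and it is strictly positive
because the survival probability is. -/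
lemma drift_lt_of_eq (h : IsOpponent K p r l S) {s t : ℝ} (hs : 0 ≤ s) (hst : s < t)
    (hK : K s = K t) : drift K p r l S t < drift K p r l S s := by
  have h1 := h.drift_sub hs hst.le
  have h2 := mul_le_mul_of_nonneg_left (h.integral_Ioc_le hs hst.le) h.p_pos.le
  have h3 := h.cost_pos hs hst
  rw [hK, sub_self, mul_zero] at h2
  linarith

lemma drift_le_add (h : IsOpponent K p r l S) {s t : ℝ} (hs : 0 ≤ s) (hst : s ≤ t) :
    drift K p r l S t ≤ drift K p r l S s + p * (K t - K s) := by
  have h1 := h.drift_sub hs hst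
  have h2 := mul_le_mul_of_nonneg_left (h.integral_Ioc_le hs hst) h.p_pos.le
  have h3 : 0 ≤ l * ∫ v in s..t, Real.exp (-r * v) * S v := by
    rcases hst.eq_or_lt with rfl | h4
    · simp
    · exact (h.cost_pos hs h4).le
  linarith

lemma drift_ge_sub (h : IsOpponent K p r l S) {s t : ℝ} (hs : 0 ≤ s) (hst : s ≤ t) :
    drift K p r l S s - l * (t - s) ≤ drift K p r l S t := by
  have h1 := h.drift_sub hs hst
  have h2 := mul_nonneg h.p_pos.le (integral_Ioc_nonneg (K := K) r s t)
  have h3 := h.cost_le hs hst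
  linarith

/-- Squeezed between the two preceding bounds. Continuity from the left would fail at the atoms of
`K`. -/
lemma drift_right_continuous (h : IsOpponent K p r l S) {t : ℝ} (ht : 0 ≤ t) :
    ContinuousWithinAt (drift K p r l S) (Ici t) t := by
  have hK := K.right_continuous t
  have h1 : Tendsto (fun v => drift K p r l S t + p * (K v - K t)) (𝓝[≥] t)
      (𝓝 (drift K p r l S t + p * (K t - K t))) := ((hK.sub_const _).const_mul p).const_add _
  have h2 : Tendsto (fun v => drift K p r l S t - l * (v - t)) (𝓝[≥] t)
      (𝓝 (drift K p r l S t - l * (t - t))) :=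
    (Continuous.tendsto (by fun_prop) t).mono_left nhdsWithin_le_nhds
  simp only [sub_self, mul_zero, add_zero, sub_zero] at h1 h2
  refine tendsto_of_tendsto_of_tendsto_of_le_of_le' h2 h1 ?_ ?_
  · filter_upwards [self_mem_nhdsWithin] with v hv using h.drift_ge_sub ht hv
  · filter_upwards [self_mem_nhdsWithin] with v hv using h.drift_le_add ht hv

lemma gain_le_drift (h : IsOpponent K p r l S) (t : ℝ) :
    gain K p r l S t ≤ drift K p r l S t := by
  have h1 : 0 ≤ p * Real.exp (-r * t) * (K t - leftLim K t) :=
    mul_nonneg (mul_pos h.p_pos (Real.exp_pos _)).le (sub_nonneg.2 (K.leftLim_le_self t))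
  rw [gain]; linarith

end IsOpponent

lemma gain_eq_drift {t : ℝ} (ht : leftLim K t = K t) :
    gain K p r l S t = drift K p r l S t := by
  rw [gain, ht]; ring

namespace IsReply

/-- Conceding right after `t` is not profitable either. -/
lemma drift_le (h : IsOpponent K p r l S) (hr : IsReply K' K p r l S u) {t : ℝ} (ht : 0 ≤ t) :
    drift K p r l S t ≤ u := by
  have h1 : ContinuousWithinAt (drift K p r l S) (Ioi t) t :=
    (h.drift_right_continuous ht).mono Ioi_subset_Ici_self
  have hK : Tendsto K (𝓝[>] t) (𝓝 (K t)) := (K.right_continuous t).mono Ioi_subset_Ici_self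
  have h2 : Tendsto (fun v => u + p * (K v - K t)) (𝓝[>] t) (𝓝 (u + p * (K t - K t))) :=
    ((hK.sub_const _).const_mul p).const_add _
  rw [sub_self, mul_zero, add_zero] at h2
  refine le_of_tendsto_of_tendsto h1 h2 ?_
  filter_upwards [self_mem_nhdsWithin] with v hv
  have hv0 : 0 ≤ v := ht.trans (le_of_lt hv)
  have h3 := hr.le v hv0
  have h4 : K t ≤ leftLim K v := K.mono.le_leftLim hv
  have h5 := exp_neg_mul_le_one h.r_pos.le hv0
  have h6 : Real.exp (-r * v) * (K v - leftLim K v) ≤ 1 * (K v - K t) := by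
    apply mul_le_mul h5 (by linarith) (sub_nonneg.2 (K.leftLim_le_self v)) zero_le_one
  have h7 := mul_le_mul_of_nonneg_left h6 h.p_pos.le
  have h8 : 0 ≤ p * (K v - K t) := mul_nonneg h.p_pos.le (sub_nonneg.2 (K.mono (le_of_lt hv)))
  rw [gain] at h3
  linarith

/-- A set of times at which conceding is suboptimal is null. -/
lemma measure_eq_zero (hr : IsReply K' K p r l S u) {A : Set ℝ}
    (hA : ∀ t ∈ A, gain K p r l S t < u) : K'.measure A = 0 := by
  have := hr.ae_eq
  rw [ae_iff] at this
  exact measure_mono_null (fun t ht => (hA t ht).ne) this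

/-- A tie forfeits half of the opponent's atom, whereas conceding an instant later collects all of
it. Hence the two sides never have a common atom. -/
lemma leftLim_eq_of_atom (h : IsOpponent K p r l S) (hr : IsReply K' K p r l S u) {t : ℝ}
    (ht : 0 ≤ t) (hK : leftLim K t ≠ K t) : leftLim K' t = K' t := by
  refine K'.leftLim_eq_of_measure_singleton (hr.measure_eq_zero fun v hv => ?_)
  rw [mem_singleton_iff.1 hv]
  refine lt_of_lt_of_le ?_ (drift_le h hr ht)
  have h1 : 0 < p * Real.exp (-r * t) * (K t - leftLim K t) :=
    mul_pos (mul_pos h.p_pos (Real.exp_pos _))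
      (sub_pos.2 (lt_of_le_of_ne (K.leftLim_le_self t) hK))
  rw [gain]; linarith

/-- One does not concede while the opponent does not. -/
lemma eq_of_eq (h : IsOpponent K p r l S) (hr : IsReply K' K p r l S u) {s t : ℝ} (hs : 0 ≤ s)
    (hst : s ≤ t) (hK : K s = K t) : K' s = K' t := by
  refine K'.eq_of_measure_Ioc_eq_zero hst (hr.measure_eq_zero fun v hv => ?_)
  refine (h.gain_le_drift v).trans_lt (lt_of_lt_of_le ?_ (drift_le h hr hs))
  exact h.drift_lt_of_eq hs hv.1
    (le_antisymm (K.mono hv.1.le) (by rw [hK]; exact K.mono hv.2))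

/-- Just before an atom of `K` at `t`, and at `t` itself, `K'` prefers to wait for the atom, so `K'`
is flat on an interval ending at `t`. The reply `K` is then flat there too, and cannot jump at `t`.
-/
lemma leftLim_eq (h : IsOpponent K p r l S) (hr : IsReply K' K p r l S u)
    (h' : IsOpponent K' p' r' l' S') (hr' : IsReply K K' p' r' l' S' u') {t : ℝ} (ht : 0 < t) :
    leftLim K t = K t := by
  by_contra hK
  have hK' := leftLim_eq_of_atom h hr ht.le hK
  -- shortly before the atom of `K`, the other side does not concede
  have hgap : ∃ s, 0 ≤ s ∧ s < t ∧ ∀ v ∈ Ioo s t, gain K p r l S v < u := by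
    have hpos : 0 < p * Real.exp (-r * t) * (K t - leftLim K t) :=
      mul_pos (mul_pos h.p_pos (Real.exp_pos _))
        (sub_pos.2 (lt_of_le_of_ne (K.leftLim_le_self t) hK))
    set j := p * Real.exp (-r * t) * (K t - leftLim K t) with hj
    -- Waiting from `v` to `t` costs at most `l * (t - v)`, which is less than the discounted value
    -- `j` of the atom once `t - v < j / l`.
    refine ⟨max 0 (t - j / l), le_max_left _ _, max_lt ht (by have := div_pos hpos h.l_pos; linarith),
      fun v hv => ?_⟩
    have hv0 : 0 ≤ v := (le_max_left _ _).trans hv.1.le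
    have hv1 : t - j / l < v := (le_max_right _ _).trans_lt hv.1
    have h1 := h.drift_sub hv0 hv.2.le
    have h2 := h.cost_le hv0 hv.2.le
    have h3 : l * (t - v) < j := by
      have : t - v < j / l := by linarith
      rwa [lt_div_iff₀ h.l_pos, mul_comm] at this
    have h4 : j ≤ p * ∫ w in Ioc v t, Real.exp (-r * w) ∂K.measure := by
      rw [hj, mul_assoc]
      refine mul_le_mul_of_nonneg_left ?_ h.p_pos.le
      have h5 : ∫ w in {t}, Real.exp (-r * w) ∂K.measure
          ≤ ∫ w in Ioc v t, Real.exp (-r * w) ∂K.measure := by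
        refine setIntegral_mono_set (h.sub.integrableOn_of_bound (measurable_exp_neg_mul r)
          (abs_exp_neg_mul_le_one h.r_pos.le) measurableSet_Ioc (fun w hw => hv0.trans hw.1.le))
          (ae_of_all _ fun w => (Real.exp_pos _).le) (LE.le.eventuallyLE ?_)
        intro w hw
        rw [mem_singleton_iff.1 hw]; exact ⟨hv.2, le_rfl⟩
      rw [integral_singleton, K.real_singleton, smul_eq_mul] at h5
      linarith
    have h5 := h.gain_le_drift v
    have h6 := drift_le h hr ht.le
    linarith
  obtain ⟨s, hs0, hst, hs⟩ := hgap
  have h1 : K' s = K' t := by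
    refine K'.eq_of_measure_Ioc_eq_zero hst.le ?_
    rw [← Ioo_union_right hst]
    refine measure_union_null (hr.measure_eq_zero hs) ?_
    rw [K'.measure_singleton, hK']; simp
  have h2 := eq_of_eq h' hr' hs0 hst.le h1
  have h3 := K.mono.le_leftLim hst
  exact hK (le_antisymm (K.leftLim_le_self t) (by rw [← h2]; exact h3))

/-- Once concessions stop, they never resume. -/
lemma eq_of_eq_of_le (h : IsOpponent K p r l S) (hr : IsReply K' K p r l S u)
    (h' : IsOpponent K' p' r' l' S') (hr' : IsReply K K' p' r' l' S' u') {s t : ℝ} (hs : 0 ≤ s)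
    (hst : s < t) (hK : K s = K t) {v : ℝ} (hv : s ≤ v) : K s = K v := by
  by_contra hne
  -- If `K` moved again, its flat stretch from `s` would have a last point `m`. Over that stretch
  -- `K'` is flat as well, so the drift facing `K` falls strictly below `u'`; by right continuity it
  -- stays below `u'` shortly after `m`, so `K` cannot resume there.
  set E : Set ℝ := {w | s ≤ w ∧ K s = K w} with hE
  have hEb : BddAbove E := ⟨v, fun w hw => by
    by_contra hlt
    have hlt := not_le.1 hlt
    exact hne (le_antisymm (K.mono hv) (by rw [hw.2]; exact K.mono hlt.le))⟩
  have htE : t ∈ E := ⟨hst.le, hK⟩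
  set m := sSup E
  have htm : t ≤ m := le_csSup hEb htE
  have hm0 : 0 < m := hs.trans_lt (hst.trans_le htm)
  have hbelow : ∀ w, s ≤ w → w < m → K w = K s := by
    intro w hw hwm
    obtain ⟨e, he, hwe⟩ := exists_lt_of_lt_csSup ⟨t, htE⟩ hwm
    exact le_antisymm (by rw [he.2]; exact K.mono hwe.le) (K.mono hw)
  have hKm : K s = K m := by
    rw [← leftLim_eq h hr h' hr' hm0]
    refine le_antisymm (K.mono.le_leftLim (hst.trans_le htm)) ?_
    refine le_of_tendsto (K.mono.tendsto_leftLim m) ?_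
    filter_upwards [Ioo_mem_nhdsLT (hst.trans_le htm)] with w hw
    exact (hbelow w hw.1.le hw.2).le
  have hK'm := eq_of_eq h hr hs (hst.le.trans htm) hKm
  have hlt : drift K' p' r' l' S' m < u' :=
    (h'.drift_lt_of_eq hs (hst.trans_le htm) hK'm).trans_le (drift_le h' hr' hs)
  have hev : ∀ᶠ w in 𝓝[≥] m, drift K' p' r' l' S' w < u' :=
    (h'.drift_right_continuous hm0.le).eventually (gt_mem_nhds hlt)
  obtain ⟨b, hb, hbs⟩ := (mem_nhdsGE_iff_exists_Ico_subset).1 hev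
  have hb : m < b := hb
  have h1 : K.measure (Ioc m ((m + b) / 2)) = 0 := hr'.measure_eq_zero fun w hw =>
    (h'.gain_le_drift w).trans_lt (hbs ⟨hw.1.le, by linarith [hw.2]⟩)
  have h2 := K.eq_of_measure_Ioc_eq_zero (by linarith) h1
  have h3 : (m + b) / 2 ∈ E := ⟨by linarith, hKm.trans h2⟩
  have := le_csSup hEb h3
  linarith

/-- While one keeps conceding, waiting neither gains nor loses. -/
lemma drift_eq (h : IsOpponent K p r l S) (hr : IsReply K' K p r l S u) {T : ℝ}
    (hK' : ∀ s t, 0 ≤ s → s < t → t ≤ T → K' s < K' t) {t : ℝ} (ht : 0 ≤ t) (htT : t < T) :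
    drift K p r l S t = u := by
  refine le_antisymm (drift_le h hr ht) ?_
  have h1 : ContinuousWithinAt (drift K p r l S) (Ioi t) t :=
    (h.drift_right_continuous ht).mono Ioi_subset_Ici_self
  by_contra hlt
  have hlt := not_le.1 hlt
  -- A drift below `u` at `t` would persist to the right of `t`, making `K'` flat there.
  obtain ⟨b, hb, hbs⟩ := (mem_nhdsGT_iff_exists_Ioc_subset).1 (h1.eventually (gt_mem_nhds hlt))
  have hb : t < b := hb
  have h2 : K'.measure (Ioc t (min b T)) = 0 := hr.measure_eq_zero fun w hw =>
    (h.gain_le_drift w).trans_lt (hbs ⟨hw.1, hw.2.trans (min_le_left _ _)⟩)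
  have h3 := K'.eq_of_measure_Ioc_eq_zero (le_min hb.le htT.le) h2
  exact (hK' t (min b T) ht (lt_min hb htT) (min_le_right _ _)).ne h3

/-- In a war of attrition with mutual best replies, both sides concede until a common time. -/
lemma exists_last_time (h : IsOpponent K p r l S) (hr : IsReply K' K p r l S u)
    (h' : IsOpponent K' p' r' l' S') (hr' : IsReply K K' p' r' l' S' u') {z : ℝ} (hz : 0 < z)
    (hS : ∀ t, 0 ≤ t → z ≤ S t) :
    ∃ T, 0 ≤ T ∧ (∀ t, T ≤ t → K t = K T) ∧ (∀ t, T ≤ t → K' t = K' T) ∧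
      (∀ s t, 0 ≤ s → s < t → t ≤ T → K s < K t) ∧
      (∀ s t, 0 ≤ s → s < t → t ≤ T → K' s < K' t) := by
  set E : Set ℝ := {s | 0 ≤ s ∧ ∀ t, s ≤ t → K t = K s} with hE
  -- Outside `E` both distributions increase strictly: a flat stretch of `K` never ends, and a flat
  -- stretch of `K'` entails one of `K`.
  have hstrict : ∀ s t, 0 ≤ s → s < t → s ∉ E → K s < K t := by
    intro s t hs hst hsE
    refine lt_of_le_of_ne (K.mono hst.le) fun heq => hsE ⟨hs, fun v hv => ?_⟩
    exact (eq_of_eq_of_le h hr h' hr' hs hst heq hv).symm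
  have hstrict' : ∀ s t, 0 ≤ s → s < t → s ∉ E → K' s < K' t := by
    intro s t hs hst hsE
    exact lt_of_le_of_ne (K'.mono hst.le) fun heq =>
      (hstrict s t hs hst hsE).ne (eq_of_eq h' hr' hs hst.le heq)
  -- If concessions went on forever, the drift would be constant, so the concessions in each unit of
  -- time would have to repay its waiting cost. After cancelling the discount factor this cost is at
  -- least `l * z * exp (-r)`, so `K` would grow linearly, against `K ≤ 1`.
  have hne : E.Nonempty := by
    by_contra hem
    rw [not_nonempty_iff_eq_empty] at hem
    have hnot : ∀ s, s ∉ E := fun s => by rw [hem]; exact notMem_empty s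
    have hd : ∀ t, 0 ≤ t → drift K p r l S t = u := fun t ht =>
      drift_eq h hr (T := t + 1) (fun s v hs hsv _ => hstrict' s v hs hsv (hnot s)) ht (by linarith)
    set e := l * (z * Real.exp (-r)) with he
    have he0 : 0 < e := mul_pos h.l_pos (mul_pos hz (Real.exp_pos _))
    have hstep : ∀ s, 0 ≤ s → e ≤ p * (K (s + 1) - K s) := by
      intro s hs
      have h1 := h.drift_sub hs (by linarith : s ≤ s + 1)
      rw [hd s hs, hd (s + 1) (by linarith), sub_self] at h1
      have h2 : ∫ v in Ioc s (s + 1), Real.exp (-r * v) ∂K.measure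
          ≤ Real.exp (-r * s) * (K (s + 1) - K s) := by
        have := h.sub.isFiniteMeasure
        have h3 := setIntegral_mono_on (μ := K.measure) (s := Ioc s (s + 1))
          (f := fun v => Real.exp (-r * v)) (g := fun _ => Real.exp (-r * s))
          (h.sub.integrableOn_of_bound (measurable_exp_neg_mul r)
            (abs_exp_neg_mul_le_one h.r_pos.le) measurableSet_Ioc (fun v hv => hs.trans hv.1.le))
          (integrable_const _) measurableSet_Ioc (fun v hv => by
            rw [Real.exp_le_exp]; nlinarith [hv.1, h.r_pos])
        rwa [setIntegral_const, K.real_Ioc (by linarith), smul_eq_mul, mul_comm] at h3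
      have h4 : Real.exp (-r * s) * (z * Real.exp (-r))
          ≤ ∫ v in s..(s + 1), Real.exp (-r * v) * S v := by
        have h5 := intervalIntegral.integral_mono_on (by linarith : s ≤ s + 1)
          (intervalIntegrable_const (c := Real.exp (-r * s) * (z * Real.exp (-r))))
          (h.intervalIntegrable hs (by linarith : 0 ≤ s + 1)) (fun v hv => ?_)
        · simpa using h5
        · have h6 : Real.exp (-r * s) * Real.exp (-r) ≤ Real.exp (-r * v) := by
            rw [← Real.exp_add, Real.exp_le_exp]; nlinarith [hv.2, h.r_pos]
          calc Real.exp (-r * s) * (z * Real.exp (-r))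
              = (Real.exp (-r * s) * Real.exp (-r)) * z := by ring
            _ ≤ Real.exp (-r * v) * S v :=
              mul_le_mul h6 (hS v (hs.trans hv.1)) hz.le (Real.exp_pos _).le
      have h7 := mul_le_mul_of_nonneg_left h2 h.p_pos.le
      have h8 := mul_le_mul_of_nonneg_left h4 h.l_pos.le
      refine le_of_mul_le_mul_left ?_ (Real.exp_pos (-r * s))
      rw [he]; linarith
    have hind : ∀ n : ℕ, n * e ≤ p * (K n - K 0) := by
      intro n
      induction n with
      | zero => simp
      | succ n ih =>
        have := hstep n n.cast_nonneg
        push_cast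
        linarith
    obtain ⟨n, hn⟩ := exists_nat_gt (p / e)
    rw [div_lt_iff₀ he0] at hn
    have h1 := h.sub.le_one n
    have h2 := h.sub.nonneg 0
    have h3 : p * (K n - K 0) ≤ p * 1 := mul_le_mul_of_nonneg_left (by linarith) h.p_pos.le
    linarith [hind n]
  have hbdd : BddBelow E := ⟨0, fun s hs => hs.1⟩
  set T := sInf E
  have hT : 0 ≤ T := le_csInf hne fun s hs => hs.1
  have hconst : ∀ t, T ≤ t → K t = K T := by
    have hgt : ∀ t, T < t → ∀ v, t ≤ v → K v = K t := by
      intro t ht v hv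
      obtain ⟨s, hs, hst⟩ := exists_lt_of_csInf_lt hne ht
      rw [hs.2 v (hst.le.trans hv), hs.2 t hst.le]
    intro t ht
    rcases ht.eq_or_lt with rfl | ht
    · rfl
    refine tendsto_nhds_unique (tendsto_const_nhds.congr' ?_)
      ((K.right_continuous T).mono Ioi_subset_Ici_self)
    filter_upwards [Ioo_mem_nhdsGT ht] with v hv using hgt v hv.1 t hv.2.le
  have hnotE : ∀ s t, s < t → t ≤ T → s ∉ E := fun s t hst htT hsE =>
    absurd (csInf_le hbdd hsE) (not_le.2 (hst.trans_le htT))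
  refine ⟨T, hT, hconst, fun t ht => ?_, fun s t hs hst htT => hstrict s t hs hst (hnotE s t hst htT),
    fun s t hs hst htT => hstrict' s t hs hst (hnotE s t hst htT)⟩
  exact (eq_of_eq h hr hT ht (hconst t ht).symm).symm

end IsReply

/-- Where waiting neither gains nor loses, the opponent concedes at the hazard rate `l`. -/
lemma IsOpponent.hasDerivAt (h : IsOpponent K p r l S) {T : ℝ}
    (hd : ∀ t, 0 ≤ t → t < T → drift K p r l S t = u) (hK : ∀ t, 0 < t → leftLim K t = K t)
    {t : ℝ} (ht : 0 < t) (htT : t < T) (hS : ContinuousAt S t) : HasDerivAt K (l * S t / p) t := by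
  have hKt : ContinuousAt K t := K.continuousAt_of_leftLim_eq (hK t ht)
  have hp := h.p_pos.ne'
  have hd1 : HasDerivAt (fun v => ∫ s in (0)..v, Real.exp (-r * s) * S s)
      (Real.exp (-r * t) * S t) t := by
    refine intervalIntegral.integral_hasDerivAt_right (h.intervalIntegrable le_rfl ht.le) ?_
      (ContinuousAt.mul (by fun_prop) hS)
    exact ((measurable_exp_neg_mul r).mul h.S_meas).stronglyMeasurable.stronglyMeasurableAtFilter
  have hd2 : HasDerivAt (fun v => ∫ s in (0)..v, Real.exp (-r * s) * K s)
      (Real.exp (-r * t) * K t) t := by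
    refine intervalIntegral.integral_hasDerivAt_right ?_ ?_ (ContinuousAt.mul (by fun_prop) hKt)
    · exact (K.mono.intervalIntegrable).continuousOn_mul (by fun_prop)
    · exact ((measurable_exp_neg_mul r).mul
        K.measurable_coe).stronglyMeasurable.stronglyMeasurableAtFilter
  have hd3 : HasDerivAt (fun v : ℝ => Real.exp (r * v)) (Real.exp (r * t) * r) t := by
    have : HasDerivAt (fun v : ℝ => r * v) r t := by simpa using (hasDerivAt_id t).const_mul r
    exact this.exp
  have hmain := hd3.mul ((((hd1.const_mul l).const_add u).div_const p).sub (hd2.const_mul r))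
  have hexp : ∀ v : ℝ, Real.exp (r * v) * Real.exp (-r * v) = 1 := fun v => by
    rw [← Real.exp_add]; simp
  -- Integration by parts rewrites `drift = u` as a formula for `K` in terms of two integrals with
  -- integrands continuous at `t`. This yields differentiability, and the terms `r * K t` cancel in
  -- the derivative.
  have heq : ∀ v, 0 ≤ v → v < T → K v = Real.exp (r * v) *
      ((u + l * ∫ s in (0)..v, Real.exp (-r * s) * S s) / p
        - r * ∫ s in (0)..v, Real.exp (-r * s) * K s) := by
    intro v hv hvT
    have h1 := hd v hv hvT
    rw [drift, h.sub.integral_exp hv] at h1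
    have h2 : (u + l * ∫ s in (0)..v, Real.exp (-r * s) * S s) / p
        = Real.exp (-r * v) * K v + r * ∫ s in (0)..v, Real.exp (-r * s) * K s := by
      rw [div_eq_iff hp]; linarith
    rw [h2, add_sub_cancel_right, ← mul_assoc, hexp, one_mul]
  refine (hmain.congr_of_eventuallyEq ?_).congr_deriv ?_
  · filter_upwards [Ioo_mem_nhds ht htT] with v hv using heq v hv.1.le hv.2
  · have h1 := heq t ht.le htT
    have h2 := hexp t
    have h3 : Real.exp (r * t) * r * ((u + l * ∫ s in (0)..t, Real.exp (-r * s) * S s) / p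
        - r * ∫ s in (0)..t, Real.exp (-r * s) * K s) = r * K t := by
      rw [h1]; ring
    refine (congrArg (· + _) h3).trans ?_
    have h4 : Real.exp (r * t) * (l * (Real.exp (-r * t) * S t) / p - r * (Real.exp (-r * t) * K t))
        = (Real.exp (r * t) * Real.exp (-r * t)) * (l * S t / p - r * K t) := by ring
    rw [h4, h2]; ring

end Attrition

/-! ### Bounded measurable functions on `[0, ∞)` -/

/-- Measurable functions that are bounded on `[0, ∞)`. -/
structure IsBddMeas (f : ℝ → ℝ) : Prop where
  meas : Measurable f
  bdd : ∃ C, ∀ t, 0 ≤ t → |f t| ≤ C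

namespace IsBddMeas

variable {f g : ℝ → ℝ}

lemma const (c : ℝ) : IsBddMeas fun _ => c := ⟨measurable_const, |c|, fun _ _ => le_rfl⟩

lemma add (hf : IsBddMeas f) (hg : IsBddMeas g) : IsBddMeas fun t => f t + g t := by
  obtain ⟨C, hC⟩ := hf.bdd
  obtain ⟨C', hC'⟩ := hg.bdd
  exact ⟨hf.meas.add hg.meas, C + C', fun t ht =>
    (abs_add_le _ _).trans (add_le_add (hC t ht) (hC' t ht))⟩

lemma mul (hf : IsBddMeas f) (hg : IsBddMeas g) : IsBddMeas fun t => f t * g t := by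
  obtain ⟨C, hC⟩ := hf.bdd
  obtain ⟨C', hC'⟩ := hg.bdd
  refine ⟨hf.meas.mul hg.meas, C * C', fun t ht => ?_⟩
  rw [abs_mul]
  exact mul_le_mul (hC t ht) (hC' t ht) (abs_nonneg _) ((abs_nonneg _).trans (hC t ht))

lemma sub (hf : IsBddMeas f) (hg : IsBddMeas g) : IsBddMeas fun t => f t - g t := by
  have := hf.add ((const (-1)).mul hg)
  simpa [sub_eq_add_neg] using this

lemma exp {r : ℝ} (hr : 0 ≤ r) : IsBddMeas fun t => Real.exp (-r * t) :=
  ⟨measurable_exp_neg_mul r, 1, abs_exp_neg_mul_le_one hr⟩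

/-- As `f` has no sign, the integral need not be monotone in the endpoint. Measurability comes
instead from viewing it as a parametrised integral of a jointly measurable function. -/
lemma integral_Ico {μ : Measure ℝ} [SFinite μ] (hf : Measurable f)
    (hi : IntegrableOn f (Ici 0) μ) : IsBddMeas fun t => ∫ s in Ico 0 t, f s ∂μ := by
  constructor
  · have h1 : Measurable (fun p : ℝ × ℝ => {p : ℝ × ℝ | 0 ≤ p.2 ∧ p.2 < p.1}.indicator
        (fun p => f p.2) p) := by
      refine (hf.comp measurable_snd).indicator ?_
      exact (measurableSet_le measurable_const measurable_snd).inter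
        (measurableSet_lt measurable_snd measurable_fst)
    have h2 := h1.stronglyMeasurable.integral_prod_right' (ν := μ)
    convert h2.measurable using 2 with t
    rw [← integral_indicator measurableSet_Ico]
    rfl
  · refine ⟨∫ s in Ici 0, |f s| ∂μ, fun t _ => ?_⟩
    refine (abs_integral_le_integral_abs).trans ?_
    exact setIntegral_mono_set hi.abs (ae_of_all _ fun _ => abs_nonneg _)
      (LE.le.eventuallyLE Ico_subset_Ici_self)

lemma coe {K : StieltjesFunction ℝ} (hK : K.IsSubCDF) : IsBddMeas K :=
  ⟨K.measurable_coe, 1, fun t _ => by rw [abs_of_nonneg (hK.nonneg t)]; exact hK.le_one t⟩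

lemma leftLim {K : StieltjesFunction ℝ} (hK : K.IsSubCDF) : IsBddMeas (leftLim K) :=
  ⟨K.measurable_leftLim, 1, fun t _ => by
    rw [abs_of_nonneg (hK.leftLim_nonneg t)]; exact (K.leftLim_le_self t).trans (hK.le_one t)⟩

lemma integrableOn {K : StieltjesFunction ℝ} (hf : IsBddMeas f) (hK : K.IsSubCDF) {I : Set ℝ}
    (hI : MeasurableSet I) (h0 : I ⊆ Ici 0) : IntegrableOn f I K.measure :=
  let ⟨_, hC⟩ := hf.bdd
  hK.integrableOn_of_bound hf.meas hC hI h0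

lemma integrableOn_exp (hf : IsBddMeas f) {r : ℝ} (hr : 0 < r) {I : Set ℝ}
    (hI : MeasurableSet I) (h0 : I ⊆ Ici 0) :
    IntegrableOn (fun s => f s * Real.exp (-r * s)) I := by
  obtain ⟨C, hC⟩ := hf.bdd
  have h1 : IntegrableOn (fun s => Real.exp (-r * s)) I :=
    ((integrableOn_Ici_iff_integrableOn_Ioi (by simp)).2 (exp_neg_integrableOn_Ioi 0 hr)).mono_set h0
  refine Integrable.bdd_mul (c := C) h1 hf.meas.aestronglyMeasurable ?_
  filter_upwards [ae_restrict_mem hI] with t ht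
  exact hC t (h0 ht)

end IsBddMeas

lemma tendsto_integral_Icc_nat {μ : Measure ℝ} {f : ℝ → ℝ} (hf : IntegrableOn f (Ici 0) μ) :
    Tendsto (fun n : ℕ => ∫ s in Icc 0 (n : ℝ), f s ∂μ) atTop (𝓝 (∫ s in Ici 0, f s ∂μ)) := by
  have h : ⋃ n : ℕ, Icc 0 (n : ℝ) = Ici 0 := by
    ext x; simp only [mem_iUnion, mem_Icc, mem_Ici]
    exact ⟨fun ⟨_, h, _⟩ => h, fun h => (exists_nat_ge x).imp fun n hn => ⟨h, hn⟩⟩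
  rw [← h] at hf ⊢
  exact tendsto_setIntegral_of_monotone (fun _ => measurableSet_Icc)
    (fun m n hmn => Icc_subset_Icc_right (by exact_mod_cast hmn)) hf

/-- Strategies as distribution functions. -/
lemma Strategy₁.isSubCDF_F (σ : Strategy₁) : σ.F.IsSubCDF where
  neg := σ.F_neg
  le_one t := by
    have h1 := σ.G.mono (show min t 0 - 1 ≤ t by linarith [min_le_left t 0])
    rw [σ.G_neg _ (by linarith [min_le_right t 0])] at h1
    linarith [σ.add_le_one t]

lemma Strategy₁.isSubCDF_G (σ : Strategy₁) : σ.G.IsSubCDF where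
  neg := σ.G_neg
  le_one t := by linarith [σ.add_le_one t, σ.isSubCDF_F.nonneg t]

lemma Strategy₂.isSubCDF (σ : Strategy₂) : σ.F.IsSubCDF := ⟨σ.F_neg, σ.F_le_one⟩

lemma Strategy₂.isBddMeas_q (σ : Strategy₂) : IsBddMeas σ.q :=
  ⟨σ.q_measurable, 1, fun t _ => by
    rw [abs_of_nonneg (σ.q_mem t).1]; exact (σ.q_mem t).2⟩

/-! ### Reduction of the payoffs to wars of attrition -/

namespace BargainingGame

variable {B : BargainingGame}

namespace Valid

lemma D_pos (hB : B.Valid) : 0 < B.D := by have := hB.conflict; rw [D]; linarith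

lemma w₁_lt_one (hB : B.Valid) : B.w₁ < 1 := hB.w₁_lt.trans hB.c₁_lt

lemma c₁_pos (hB : B.Valid) : 0 < B.c₁ := hB.w₁_nonneg.trans_lt hB.w₁_lt

end Valid

variable (B) in
/-- Total hazard rate at which player 1 concedes. -/
def rate₁ : ℝ := B.r₂ * (1 - B.a₁) / B.D

variable (B) in
/-- Total hazard rate at which player 2 concedes. -/
def rate₂ : ℝ := B.r₁ * (1 - B.a₂) / B.D

lemma rate₁_pos (hB : B.Valid) : 0 < B.rate₁ :=
  div_pos (mul_pos hB.r₂_pos (by linarith [hB.a₁_mem.2])) hB.D_pos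

lemma rate₂_pos (hB : B.Valid) : 0 < B.rate₂ :=
  div_pos (mul_pos hB.r₁_pos (by linarith [hB.a₂_mem.2])) hB.D_pos

variable (B) in
/-- Probability that player 1 has neither conceded nor challenged by time `t`. -/
def surv₁ (σ₁ : Strategy₁) (t : ℝ) : ℝ :=
  B.z₁ * Real.exp (-B.γ₁ * t) + (1 - B.z₁) * (1 - σ₁.F t - σ₁.G t)

variable (B) in
/-- Probability that player 2 has not conceded by time `t`. -/
def surv₂ (σ₂ : Strategy₂) (t : ℝ) : ℝ := 1 - (1 - B.z₂) * σ₂.F t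

lemma le_surv₂ (hB : B.Valid) (σ₂ : Strategy₂) (t : ℝ) : B.z₂ ≤ B.surv₂ σ₂ t := by
  have h1 := σ₂.F_le_one t
  have h2 := hB.z₂_mem.2
  rw [surv₂]; nlinarith

lemma isOpponent₂ (hB : B.Valid) (σ₂ : Strategy₂) :
    IsOpponent σ₂.F (1 - B.z₂) B.r₁ B.rate₂ (B.surv₂ σ₂) where
  sub := σ₂.isSubCDF
  p_pos := by linarith [hB.z₂_mem.2]
  r_pos := hB.r₁_pos
  l_pos := rate₂_pos hB
  S_meas := (σ₂.F.measurable_coe.const_mul _).const_sub _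
  S_pos t _ := hB.z₂_mem.1.trans_le (le_surv₂ hB σ₂ t)
  S_le t _ := by
    have := mul_nonneg (by linarith [hB.z₂_mem.2] : 0 ≤ 1 - B.z₂) (σ₂.isSubCDF.nonneg t)
    rw [surv₂]; linarith

lemma isOpponent₁ (hB : B.Valid) (σ₁ : Strategy₁) :
    IsOpponent σ₁.F (1 - B.z₁) B.r₂ B.rate₁ (B.surv₁ σ₁) where
  sub := σ₁.isSubCDF_F
  p_pos := by linarith [hB.z₁_mem.2]
  r_pos := hB.r₂_pos
  l_pos := rate₁_pos hB
  S_meas := ((measurable_exp_neg_mul _).const_mul _).add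
    (((σ₁.F.measurable_coe.const_sub _).sub σ₁.G.measurable_coe).const_mul _)
  S_pos t _ := by
    have h1 := mul_nonneg (by linarith [hB.z₁_mem.2] : 0 ≤ 1 - B.z₁)
      (by linarith [σ₁.add_le_one t] : 0 ≤ 1 - σ₁.F t - σ₁.G t)
    have h2 := mul_pos hB.z₁_mem.1 (Real.exp_pos (-B.γ₁ * t))
    rw [surv₁]; linarith
  S_le t ht := by
    have h0 := hB.z₁_mem.2
    have h1 := mul_le_mul_of_nonneg_left (exp_neg_mul_le_one hB.γ₁_nonneg ht) hB.z₁_mem.1.le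
    have h2 : (1 - B.z₁) * (1 - σ₁.F t - σ₁.G t) ≤ (1 - B.z₁) * 1 :=
      mul_le_mul_of_nonneg_left
        (by linarith [σ₁.isSubCDF_F.nonneg t, σ₁.isSubCDF_G.nonneg t]) (by linarith)
    rw [surv₁]; linarith

variable (B) in
/-- Player 1's net gain of waiting up to time `t`. -/
def drift₂ (σ₂ : Strategy₂) (t : ℝ) : ℝ := drift σ₂.F (1 - B.z₂) B.r₁ B.rate₂ (B.surv₂ σ₂) t

variable (B) in
/-- Player 2's net gain of waiting up to time `t`. -/
def drift₁ (σ₁ : Strategy₁) (t : ℝ) : ℝ := drift σ₁.F (1 - B.z₁) B.r₂ B.rate₁ (B.surv₁ σ₁) t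

lemma integral_Icc_eq_Ico_add {K : StieltjesFunction ℝ} (hK : K.IsSubCDF) {r t : ℝ}
    (hr : 0 ≤ r) (ht : 0 ≤ t) :
    ∫ s in Icc 0 t, Real.exp (-r * s) ∂K.measure = (∫ s in Ico 0 t, Real.exp (-r * s) ∂K.measure)
      + Real.exp (-r * t) * (K t - Function.leftLim K t) := by
  rw [← Ico_union_right ht, setIntegral_union (by simp) (measurableSet_singleton t)
    ((IsBddMeas.exp hr).integrableOn hK measurableSet_Ico Ico_subset_Ici_self)
    ((IsBddMeas.exp hr).integrableOn hK (measurableSet_singleton t) (by simpa using ht)),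
    integral_singleton, K.real_singleton, smul_eq_mul]
  ring

/-- Player 1's payoff from conceding right after `t`. -/
lemma after₁_eq (hB : B.Valid) (σ₂ : Strategy₂) {t : ℝ} (ht : 0 ≤ t) :
    (1 - B.z₂) * (∫ s in Icc 0 t, B.a₁ * Real.exp (-B.r₁ * s) ∂σ₂.F.measure)
      + B.surv₂ σ₂ t * Real.exp (-B.r₁ * t) * (1 - B.a₂)
      = (1 - B.a₂) + B.D * B.drift₂ σ₂ t := by
  have hD := hB.D_pos.ne'
  have hr := hB.r₁_pos.ne'
  have h1 : ∫ s in (0)..t, Real.exp (-B.r₁ * s) * B.surv₂ σ₂ s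
      = (1 - Real.exp (-B.r₁ * t)) / B.r₁
        - (1 - B.z₂) * ∫ s in (0)..t, Real.exp (-B.r₁ * s) * σ₂.F s := by
    have h2 := integral_mul_exp_neg B.r₁ 0 t
    rw [intervalIntegral.integral_const_mul] at h2
    simp only [mul_zero, Real.exp_zero] at h2
    rw [← h2, mul_div_cancel_left₀ _ hr, ← intervalIntegral.integral_const_mul,
      ← intervalIntegral.integral_sub]
    · congr 1; ext s; rw [surv₂]; ring
    · exact Continuous.intervalIntegrable (by fun_prop) _ _
    · exact ((σ₂.F.mono.intervalIntegrable).continuousOn_mul (by fun_prop)).const_mul _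
  -- `D * rate₂ = r₁ * (1 - a₂)` is the flow cost of postponing the share `1 - a₂`. After
  -- integration by parts both sides contain the same integral of `F`.
  rw [integral_const_mul, drift₂, drift, h1, σ₂.isSubCDF.integral_exp ht, rate₂, surv₂]
  have hDe : B.D = B.a₁ + B.a₂ - 1 := rfl
  field_simp
  rw [hDe]; ring

/-- An equal split lies halfway between `1 - a₂` and `a₁`, which differ by `D`; hence the halved
atom in `gain`. -/
lemma U₁_eq (hB : B.Valid) (σ₂ : Strategy₂) {t : ℝ} (ht : 0 ≤ t) :
    B.U₁ t σ₂ = (1 - B.a₂) + B.D * gain σ₂.F (1 - B.z₂) B.r₁ B.rate₂ (B.surv₂ σ₂) t := by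
  have h1 := after₁_eq hB σ₂ ht
  rw [integral_const_mul, integral_Icc_eq_Ico_add σ₂.isSubCDF hB.r₁_pos.le ht] at h1
  have hDe : B.D = B.a₁ + B.a₂ - 1 := rfl
  rw [surv₂] at h1
  rw [gain, U₁, integral_const_mul]
  change _ = 1 - B.a₂ + B.D * (B.drift₂ σ₂ t - _)
  linear_combination h1
    + (1 - B.z₂) * Real.exp (-B.r₁ * t) * (σ₂.F t - Function.leftLim σ₂.F t) / 2 * hDe

/-- The term beside the drift is the net gain, per unit of `D`, from challenging at `t` rather than
conceding right after `t`: the expected prize minus the cost `c₁`. Its sign decides whether to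
challenge. -/
lemma V₁_eq (hB : B.Valid) (σ₂ : Strategy₂) {t : ℝ} (ht : 0 ≤ t) :
    B.V₁ t σ₂ = (1 - B.a₂) + B.D * (B.drift₂ σ₂ t + Real.exp (-B.r₁ * t) *
      ((1 - B.z₂) * (1 - σ₂.F t) * ((1 - σ₂.q t) * B.w₁ + σ₂.q t) - B.c₁ * B.surv₂ σ₂ t)) := by
  have h1 := after₁_eq hB σ₂ ht
  rw [mul_add, ← add_assoc, ← h1, V₁, surv₂]; ring

/-- Never stopping is the limit of conceding ever later, since discounting removes the terminal
share. -/
lemma tendsto_W₁ (hB : B.Valid) (σ₂ : Strategy₂) :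
    Tendsto (fun n : ℕ => (1 - B.a₂) + B.D * B.drift₂ σ₂ n) atTop (𝓝 (B.W₁ σ₂)) := by
  have h1 : Tendsto (fun n : ℕ => Real.exp (-B.r₁ * n)) atTop (𝓝 0) := by
    refine Real.tendsto_exp_atBot.comp ?_
    exact (tendsto_natCast_atTop_atTop).const_mul_atTop_of_neg (by linarith [hB.r₁_pos])
  have h2 : Tendsto (fun n : ℕ => B.surv₂ σ₂ n) atTop
      (𝓝 (1 - (1 - B.z₂) * σ₂.F.measure.real (Ici 0))) :=
    ((σ₂.isSubCDF.tendsto_atTop.comp tendsto_natCast_atTop_atTop).const_mul _).const_sub _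
  have h3 := tendsto_integral_Icc_nat (((IsBddMeas.const B.a₁).mul
    (IsBddMeas.exp hB.r₁_pos.le)).integrableOn σ₂.isSubCDF measurableSet_Ici subset_rfl)
  have h4 := (h3.const_mul (1 - B.z₂)).add ((h2.mul h1).mul_const (1 - B.a₂))
  simp only [mul_zero, zero_mul, add_zero] at h4
  exact h4.congr fun n => after₁_eq hB σ₂ n.cast_nonneg

/-! #### Player 2 -/

variable (B) in
/-- Player 2's net gain, per unit of disagreement, from seeing the challenges made in `I` with
probability `p` instead of yielding to them. -/
def seeGain (σ₁ : Strategy₁) (I : Set ℝ) (p : ℝ → ℝ) : ℝ :=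
  (1 - B.z₁) * (1 - B.w₁ - B.k₂) * (∫ s in I, p s * Real.exp (-B.r₂ * s) ∂σ₁.G.measure)
    - B.k₂ * B.z₁ * ∫ s in I, p s * Real.exp (-B.r₂ * s) * (B.γ₁ * Real.exp (-B.γ₁ * s))

lemma integrableOn_justified (hB : B.Valid) {p : ℝ → ℝ} (hp : IsBddMeas p) {I : Set ℝ}
    (hI : MeasurableSet I) (h0 : I ⊆ Ici 0) :
    IntegrableOn (fun s => p s * Real.exp (-B.r₂ * s) * (B.γ₁ * Real.exp (-B.γ₁ * s))) I := by
  have h1 := IsBddMeas.integrableOn_exp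
    ((hp.mul (IsBddMeas.const B.γ₁)).mul (IsBddMeas.exp hB.γ₁_nonneg)) hB.r₂_pos hI h0
  exact h1.congr_fun (fun s _ => by ring) hI

lemma integrableOn_exp_G (hB : B.Valid) (σ₁ : Strategy₁) {p : ℝ → ℝ} (hp : IsBddMeas p) {I : Set ℝ}
    (hI : MeasurableSet I) (h0 : I ⊆ Ici 0) :
    IntegrableOn (fun s => p s * Real.exp (-B.r₂ * s)) I σ₁.G.measure :=
  (hp.mul (IsBddMeas.exp hB.r₂_pos.le)).integrableOn σ₁.isSubCDF_G hI h0

variable (B) in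
/-- Player 2's payoff from yielding to all challenges in `I`. -/
def base₂ (σ₁ : Strategy₁) (I : Set ℝ) : ℝ :=
  (1 - B.z₁) * B.a₂ * (∫ s in I, Real.exp (-B.r₂ * s) ∂σ₁.F.measure)
    + B.z₁ * (1 - B.a₁) * (∫ s in I, Real.exp (-B.r₂ * s) * (B.γ₁ * Real.exp (-B.γ₁ * s)))
    + (1 - B.z₁) * (1 - B.a₁) * (∫ s in I, Real.exp (-B.r₂ * s) ∂σ₁.G.measure)

lemma received₂_eq (hB : B.Valid) (σ₁ : Strategy₁) {q : ℝ → ℝ} (hq : IsBddMeas q) {I : Set ℝ}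
    (hI : MeasurableSet I) (h0 : I ⊆ Ici 0) :
    B.received₂ I q σ₁ = B.base₂ σ₁ I + B.D * B.seeGain σ₁ I fun s => 1 - q s := by
  have hp : IsBddMeas fun s => 1 - q s := (IsBddMeas.const 1).sub hq
  have h1 : ∫ s in I, (1 - B.a₁ - (1 - q s) * B.k₂ * B.D) * Real.exp (-B.r₂ * s)
        * (B.γ₁ * Real.exp (-B.γ₁ * s))
      = (1 - B.a₁) * (∫ s in I, Real.exp (-B.r₂ * s) * (B.γ₁ * Real.exp (-B.γ₁ * s)))
        - B.k₂ * B.D * ∫ s in I, (1 - q s) * Real.exp (-B.r₂ * s)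
            * (B.γ₁ * Real.exp (-B.γ₁ * s)) := by
    rw [← integral_const_mul, ← integral_const_mul, ← integral_sub]
    · congr 1; ext s; ring
    · have := integrableOn_justified hB (IsBddMeas.const 1) hI h0
      simp only [one_mul] at this
      exact this.const_mul _
    · exact (integrableOn_justified hB hp hI h0).const_mul _
  have h2 : ∫ s in I, (1 - B.a₁ + (1 - q s) * (1 - B.w₁ - B.k₂) * B.D)
        * Real.exp (-B.r₂ * s) ∂σ₁.G.measure
      = (1 - B.a₁) * (∫ s in I, Real.exp (-B.r₂ * s) ∂σ₁.G.measure)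
        + (1 - B.w₁ - B.k₂) * B.D
          * ∫ s in I, (1 - q s) * Real.exp (-B.r₂ * s) ∂σ₁.G.measure := by
    rw [← integral_const_mul, ← integral_const_mul, ← integral_add]
    · congr 1; ext s; ring
    · have := integrableOn_exp_G hB σ₁ (IsBddMeas.const 1) hI h0
      simp only [one_mul] at this
      exact this.const_mul _
    · exact (integrableOn_exp_G hB σ₁ hp hI h0).const_mul _
  rw [received₂, h1, h2, integral_const_mul, base₂, seeGain]; ring

/-- Player 2's payoff from conceding right after `t`, when yielding to all challenges. -/
lemma after₂_eq (hB : B.Valid) (σ₁ : Strategy₁) {t : ℝ} (ht : 0 ≤ t) :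
    B.base₂ σ₁ (Icc 0 t) + Real.exp (-B.r₂ * t) * (1 - B.a₁) * B.surv₁ σ₁ t
      = (1 - B.a₁) + B.D * B.drift₁ σ₁ t := by
  have hD := hB.D_pos.ne'
  have hr := hB.r₂_pos.ne'
  have hrg : B.r₂ + B.γ₁ ≠ 0 := (add_pos_of_pos_of_nonneg hB.r₂_pos hB.γ₁_nonneg).ne'
  have hee : ∀ s, Real.exp (-(B.r₂ + B.γ₁) * s) = Real.exp (-B.r₂ * s) * Real.exp (-B.γ₁ * s) := by
    intro s; rw [← Real.exp_add]; ring_nf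
  have h0 : ∫ s in (0)..t, Real.exp (-B.r₂ * s) * Real.exp (-B.γ₁ * s)
      = (1 - Real.exp (-B.r₂ * t) * Real.exp (-B.γ₁ * t)) / (B.r₂ + B.γ₁) := by
    have h2 := integral_mul_exp_neg (B.r₂ + B.γ₁) 0 t
    rw [intervalIntegral.integral_const_mul] at h2
    simp only [hee, mul_zero, Real.exp_zero] at h2
    rw [← h2, mul_div_cancel_left₀ _ hrg]
  have hi : ∀ K : StieltjesFunction ℝ,
      IntervalIntegrable (fun s => Real.exp (-B.r₂ * s) * K s) volume 0 t := fun K =>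
    (K.mono.intervalIntegrable).continuousOn_mul (by fun_prop)
  have h1 : ∫ s in (0)..t, Real.exp (-B.r₂ * s) * B.surv₁ σ₁ s
      = B.z₁ * ((1 - Real.exp (-B.r₂ * t) * Real.exp (-B.γ₁ * t)) / (B.r₂ + B.γ₁))
        + (1 - B.z₁) * ((1 - Real.exp (-B.r₂ * t)) / B.r₂
          - (∫ s in (0)..t, Real.exp (-B.r₂ * s) * σ₁.F s)
          - ∫ s in (0)..t, Real.exp (-B.r₂ * s) * σ₁.G s) := by
    have h2 := integral_mul_exp_neg B.r₂ 0 t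
    rw [intervalIntegral.integral_const_mul] at h2
    simp only [mul_zero, Real.exp_zero] at h2
    have hc : IntervalIntegrable (fun s => Real.exp (-B.r₂ * s)) volume 0 t :=
      Continuous.intervalIntegrable (by fun_prop) _ _
    rw [← h0, ← h2, mul_div_cancel_left₀ _ hr, ← intervalIntegral.integral_sub hc (hi _),
      ← intervalIntegral.integral_sub (hc.sub (hi _)) (hi _),
      ← intervalIntegral.integral_const_mul, ← intervalIntegral.integral_const_mul,
      ← intervalIntegral.integral_add]
    · congr 1; ext s; rw [surv₁]; ring
    · exact Continuous.intervalIntegrable (by fun_prop) _ _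
    · exact ((hc.sub (hi _)).sub (hi _)).const_mul _
  have h3 : ∫ s in Icc 0 t, Real.exp (-B.r₂ * s) * (B.γ₁ * Real.exp (-B.γ₁ * s))
      = B.γ₁ * ((1 - Real.exp (-B.r₂ * t) * Real.exp (-B.γ₁ * t)) / (B.r₂ + B.γ₁)) := by
    rw [← h0, integral_Icc_eq_integral_Ioc, ← intervalIntegral.integral_of_le ht,
      ← intervalIntegral.integral_const_mul]
    congr 1; ext s; ring
  rw [base₂, h3, drift₁, drift, h1, σ₁.isSubCDF_F.integral_exp ht, σ₁.isSubCDF_G.integral_exp ht,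
    rate₁, surv₁]
  have hDe : B.D = B.a₁ + B.a₂ - 1 := rfl
  field_simp
  rw [hDe]; ring

/-- Yielding to a challenge pays the same `1 - a₁` as conceding, so the yielding rule separates from
the war of attrition and enters only through `seeGain`. -/
lemma U₂_eq (hB : B.Valid) (σ₁ : Strategy₁) {q : ℝ → ℝ} (hq : IsBddMeas q) {t : ℝ} (ht : 0 ≤ t) :
    B.U₂ t q σ₁ = (1 - B.a₁) + B.D * (gain σ₁.F (1 - B.z₁) B.r₂ B.rate₁ (B.surv₁ σ₁) t
      + B.seeGain σ₁ (Ico 0 t) fun s => 1 - q s) := by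
  have h1 := after₂_eq hB σ₁ ht
  rw [base₂, integral_Icc_eq_Ico_add σ₁.isSubCDF_F hB.r₂_pos.le ht,
    integral_Icc_eq_Ico_add σ₁.isSubCDF_G hB.r₂_pos.le ht, integral_Icc_eq_integral_Ico, surv₁] at h1
  rw [U₂, received₂_eq hB σ₁ hq measurableSet_Ico Ico_subset_Ici_self, base₂, gain]
  change _ = 1 - B.a₁ + B.D * (B.drift₁ σ₁ t - _ + _)
  have hDe : B.D = B.a₁ + B.a₂ - 1 := rfl
  linear_combination h1
    + (1 - B.z₁) * Real.exp (-B.r₂ * t) * (σ₁.F t - Function.leftLim σ₁.F t) / 2 * hDe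

lemma tendsto_received₂ (hB : B.Valid) (σ₁ : Strategy₁) {q : ℝ → ℝ} (hq : IsBddMeas q) :
    Tendsto (fun n : ℕ => (1 - B.a₁) + B.D * (B.drift₁ σ₁ n
      + B.seeGain σ₁ (Ici 0) fun s => 1 - q s)) atTop (𝓝 (B.received₂ (Ici 0) q σ₁)) := by
  have h1 : Tendsto (fun n : ℕ => Real.exp (-B.r₂ * n)) atTop (𝓝 0) := by
    refine Real.tendsto_exp_atBot.comp ?_
    exact (tendsto_natCast_atTop_atTop).const_mul_atTop_of_neg (by linarith [hB.r₂_pos])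
  have h2 : Tendsto (fun n : ℕ => Real.exp (-B.r₂ * n) * (1 - B.a₁) * B.surv₁ σ₁ n) atTop
      (𝓝 0) := by
    have ho := isOpponent₁ hB σ₁
    have h3 : Tendsto (fun n : ℕ => Real.exp (-B.r₂ * n) * (1 - B.a₁)) atTop (𝓝 0) := by
      simpa using h1.mul_const (1 - B.a₁)
    refine squeeze_zero (fun n => ?_) (fun n => ?_) h3
    · exact mul_nonneg (mul_nonneg (Real.exp_pos _).le (by linarith [hB.a₁_mem.2]))
        (ho.S_pos n n.cast_nonneg).le
    · exact mul_le_of_le_one_right (mul_nonneg (Real.exp_pos _).le (by linarith [hB.a₁_mem.2]))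
        (ho.S_le n n.cast_nonneg)
  have hj := integrableOn_justified hB (IsBddMeas.const 1) measurableSet_Ici subset_rfl
  simp only [one_mul] at hj
  have h3 : Tendsto (fun n : ℕ => B.base₂ σ₁ (Icc 0 n)) atTop (𝓝 (B.base₂ σ₁ (Ici 0))) :=
    (((tendsto_integral_Icc_nat ((IsBddMeas.exp hB.r₂_pos.le).integrableOn σ₁.isSubCDF_F
      measurableSet_Ici subset_rfl)).const_mul _).add ((tendsto_integral_Icc_nat hj).const_mul _)).add
      ((tendsto_integral_Icc_nat ((IsBddMeas.exp hB.r₂_pos.le).integrableOn σ₁.isSubCDF_G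
      measurableSet_Ici subset_rfl)).const_mul _)
  have h4 := (h3.add h2).add_const (B.D * B.seeGain σ₁ (Ici 0) fun s => 1 - q s)
  rw [add_zero, ← received₂_eq hB σ₁ hq measurableSet_Ici subset_rfl] at h4
  refine h4.congr fun n => ?_
  rw [after₂_eq hB σ₁ n.cast_nonneg]; ring

end BargainingGame

/-! ### Averages over pure plans and pure deviations -/

namespace StieltjesFunction.IsSubCDF

variable {K : StieltjesFunction ℝ}

lemma integral_const_sub (hK : K.IsSubCDF) {f : ℝ → ℝ} (hf : IsBddMeas f) (u : ℝ) :
    ∫ t in Ici 0, (u - f t) ∂K.measure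
      = u * K.measure.real (Ici 0) - ∫ t in Ici 0, f t ∂K.measure := by
  have := hK.isFiniteMeasure
  rw [integral_sub (integrable_const _) (hf.integrableOn hK measurableSet_Ici subset_rfl),
    setIntegral_const, smul_eq_mul, mul_comm]

lemma integral_sub_nonneg {f : ℝ → ℝ} {u : ℝ}
    (h : ∀ t, 0 ≤ t → f t ≤ u) : 0 ≤ ∫ t in Ici 0, (u - f t) ∂K.measure :=
  setIntegral_nonneg measurableSet_Ici fun t ht => sub_nonneg.2 (h t ht)

lemma ae_eq_of_integral_sub_eq_zero (hK : K.IsSubCDF) {f : ℝ → ℝ} (hf : IsBddMeas f) {u : ℝ}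
    (h : ∀ t, 0 ≤ t → f t ≤ u) (h0 : ∫ t in Ici 0, (u - f t) ∂K.measure = 0) :
    ∀ᵐ t ∂K.measure, f t = u := by
  have h1 := (setIntegral_eq_zero_iff_of_nonneg_ae
    ((ae_restrict_mem measurableSet_Ici).mono fun t ht => sub_nonneg.2 (h t ht))
    (((IsBddMeas.const u).sub hf).integrableOn hK measurableSet_Ici subset_rfl)).1 h0
  rw [hK.restrict_Ici] at h1
  filter_upwards [h1] with t ht
  simp only [Pi.zero_apply] at ht
  linarith

lemma integral_sub_eq_zero (hK : K.IsSubCDF) {f : ℝ → ℝ} {u : ℝ}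
    (h : ∀ᵐ t ∂K.measure, f t = u) : ∫ t in Ici 0, (u - f t) ∂K.measure = 0 := by
  rw [hK.restrict_Ici]
  refine integral_eq_zero_of_ae ?_
  filter_upwards [h] with t ht
  simp [ht]

lemma real_Ici_le_one (hK : K.IsSubCDF) : K.measure.real (Ici 0) ≤ 1 :=
  le_of_tendsto hK.tendsto_atTop (Eventually.of_forall hK.le_one)

lemma zero : (0 : StieltjesFunction ℝ).IsSubCDF := ⟨fun _ _ => rfl, fun _ => zero_le_one⟩

lemma dirac {t : ℝ} (ht : 0 ≤ t) : (Measure.dirac t).distrib.IsSubCDF :=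
  Measure.isSubCDF_distrib _ (by simp [ht]) (by simp)

end StieltjesFunction.IsSubCDF

lemma Strategy₁.mass_le_one (σ : Strategy₁) :
    σ.F.measure.real (Ici 0) + σ.G.measure.real (Ici 0) ≤ 1 :=
  le_of_tendsto (σ.isSubCDF_F.tendsto_atTop.add σ.isSubCDF_G.tendsto_atTop)
    (Eventually.of_forall σ.add_le_one)

/-- Conceding at time `t`. -/
def Strategy₁.concede (t : ℝ) (ht : 0 ≤ t) : Strategy₁ where
  F := (Measure.dirac t).distrib
  G := 0
  F_neg := (StieltjesFunction.IsSubCDF.dirac ht).neg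
  G_neg := StieltjesFunction.IsSubCDF.zero.neg
  add_le_one v := by simpa using (StieltjesFunction.IsSubCDF.dirac ht).le_one v

/-- Challenging at time `t`. -/
def Strategy₁.challenge (t : ℝ) (ht : 0 ≤ t) : Strategy₁ where
  F := 0
  G := (Measure.dirac t).distrib
  F_neg := StieltjesFunction.IsSubCDF.zero.neg
  G_neg := (StieltjesFunction.IsSubCDF.dirac ht).neg
  add_le_one v := by simpa using (StieltjesFunction.IsSubCDF.dirac ht).le_one v

/-- Neither conceding nor challenging. -/
def Strategy₁.wait : Strategy₁ where
  F := 0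
  G := 0
  F_neg := StieltjesFunction.IsSubCDF.zero.neg
  G_neg := StieltjesFunction.IsSubCDF.zero.neg
  add_le_one v := by simp

/-- Conceding at time `t`, and yielding according to `q`. -/
def Strategy₂.concede (t : ℝ) (ht : 0 ≤ t) (q : ℝ → ℝ) (hq : Measurable q)
    (hq' : ∀ t, q t ∈ Icc (0 : ℝ) 1) : Strategy₂ where
  F := (Measure.dirac t).distrib
  F_neg := (StieltjesFunction.IsSubCDF.dirac ht).neg
  F_le_one := (StieltjesFunction.IsSubCDF.dirac ht).le_one
  q := q
  q_measurable := hq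
  q_mem := hq'

/-- Never conceding, and yielding according to `q`. -/
def Strategy₂.wait (q : ℝ → ℝ) (hq : Measurable q) (hq' : ∀ t, q t ∈ Icc (0 : ℝ) 1) :
    Strategy₂ where
  F := 0
  F_neg := StieltjesFunction.IsSubCDF.zero.neg
  F_le_one := StieltjesFunction.IsSubCDF.zero.le_one
  q := q
  q_measurable := hq
  q_mem := hq'

lemma isBddMeas_of_mem {q : ℝ → ℝ} (hq : Measurable q) (hq' : ∀ t, q t ∈ Icc (0 : ℝ) 1) :
    IsBddMeas q :=
  ⟨hq, 1, fun t _ => by rw [abs_of_nonneg (hq' t).1]; exact (hq' t).2⟩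

namespace BargainingGame

variable {B : BargainingGame}

/-! ### Best replies -/

lemma isBddMeas_U₁ (hB : B.Valid) (σ₂ : Strategy₂) : IsBddMeas fun t => B.U₁ t σ₂ := by
  have hH := IsBddMeas.coe σ₂.isSubCDF
  have he := IsBddMeas.exp hB.r₁_pos.le
  have hI : IsBddMeas fun t => ∫ s in Ico 0 t, B.a₁ * Real.exp (-B.r₁ * s) ∂σ₂.F.measure :=
    have := σ₂.isSubCDF.isFiniteMeasure
    IsBddMeas.integral_Ico (by fun_prop) (((IsBddMeas.const B.a₁).mul he).integrableOn
      σ₂.isSubCDF measurableSet_Ici subset_rfl)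
  exact (((IsBddMeas.const _).mul hI).add ((((IsBddMeas.const 1).sub
    ((IsBddMeas.const _).mul hH)).mul he).mul (IsBddMeas.const _))).add
    ((((IsBddMeas.const _).mul (hH.sub (IsBddMeas.leftLim σ₂.isSubCDF))).mul he).mul
      (IsBddMeas.const _))

lemma isBddMeas_V₁ (hB : B.Valid) (σ₂ : Strategy₂) : IsBddMeas fun t => B.V₁ t σ₂ := by
  have hH := IsBddMeas.coe σ₂.isSubCDF
  have hq := σ₂.isBddMeas_q
  have he := IsBddMeas.exp hB.r₁_pos.le
  have h1 : IsBddMeas fun t => ∫ s in Icc 0 t, B.a₁ * Real.exp (-B.r₁ * s) ∂σ₂.F.measure := by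
    constructor
    · refine Monotone.measurable fun s t hst => ?_
      refine setIntegral_mono_set (((IsBddMeas.const B.a₁).mul he).integrableOn
        σ₂.isSubCDF measurableSet_Icc Icc_subset_Ici_self)
        (ae_of_all _ fun v => mul_nonneg hB.a₁_mem.1.le (Real.exp_pos _).le)
        (LE.le.eventuallyLE (Icc_subset_Icc_right hst))
    · refine ⟨∫ s in Ici 0, |B.a₁ * Real.exp (-B.r₁ * s)| ∂σ₂.F.measure, fun t _ =>
        abs_integral_le_integral_abs.trans (setIntegral_mono_set (((IsBddMeas.const B.a₁).mul
        he).integrableOn σ₂.isSubCDF measurableSet_Ici subset_rfl).abs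
        (ae_of_all _ fun v => abs_nonneg _) (LE.le.eventuallyLE Icc_subset_Ici_self))⟩
  exact (((IsBddMeas.const _).mul h1).add ((((IsBddMeas.const 1).sub
    ((IsBddMeas.const _).mul hH)).mul he).mul (IsBddMeas.const _))).add
    ((((IsBddMeas.const _).mul ((IsBddMeas.const 1).sub hH)).mul he).mul
      (((((IsBddMeas.const 1).sub hq).mul (IsBddMeas.const _)).add hq).mul (IsBddMeas.const _)))

lemma isBddMeas_U₂ (hB : B.Valid) (σ₁ : Strategy₁) {q : ℝ → ℝ} (hq : IsBddMeas q) :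
    IsBddMeas fun t => B.U₂ t q σ₁ := by
  have hF := IsBddMeas.coe σ₁.isSubCDF_F
  have he := IsBddMeas.exp hB.r₂_pos.le
  have hp := (IsBddMeas.const 1).sub hq
  have h1 : IsBddMeas fun t => ∫ s in Ico 0 t, B.a₂ * Real.exp (-B.r₂ * s) ∂σ₁.F.measure :=
    have := σ₁.isSubCDF_F.isFiniteMeasure
    IsBddMeas.integral_Ico (by fun_prop) (((IsBddMeas.const B.a₂).mul he).integrableOn
      σ₁.isSubCDF_F measurableSet_Ici subset_rfl)
  have hw1 : IsBddMeas fun s => 1 - B.a₁ - (1 - q s) * B.k₂ * B.D :=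
    (IsBddMeas.const _).sub ((hp.mul (IsBddMeas.const _)).mul (IsBddMeas.const _))
  have hw2 : IsBddMeas fun s => 1 - B.a₁ + (1 - q s) * (1 - B.w₁ - B.k₂) * B.D :=
    (IsBddMeas.const _).add ((hp.mul (IsBddMeas.const _)).mul (IsBddMeas.const _))
  have h2 : IsBddMeas fun t => ∫ s in Ico 0 t, (1 - B.a₁ - (1 - q s) * B.k₂ * B.D)
      * Real.exp (-B.r₂ * s) * (B.γ₁ * Real.exp (-B.γ₁ * s)) :=
    IsBddMeas.integral_Ico ((hw1.mul he).mul ((IsBddMeas.const B.γ₁).mul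
      (IsBddMeas.exp hB.γ₁_nonneg))).meas
      (integrableOn_justified hB hw1 measurableSet_Ici subset_rfl)
  have h3 : IsBddMeas fun t => ∫ s in Ico 0 t, (1 - B.a₁ + (1 - q s) * (1 - B.w₁ - B.k₂) * B.D)
      * Real.exp (-B.r₂ * s) ∂σ₁.G.measure :=
    have := σ₁.isSubCDF_G.isFiniteMeasure
    IsBddMeas.integral_Ico (hw2.mul he).meas
      (integrableOn_exp_G hB σ₁ hw2 measurableSet_Ici subset_rfl)
  have hr : IsBddMeas fun t => B.received₂ (Ico 0 t) q σ₁ :=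
    (((IsBddMeas.const _).mul h1).add ((IsBddMeas.const _).mul h2)).add
      ((IsBddMeas.const _).mul h3)
  have hs : IsBddMeas fun t => 1 - (1 - B.z₁) * σ₁.F t - (1 - B.z₁) * leftLim σ₁.G t
      - B.z₁ * (1 - Real.exp (-B.γ₁ * t)) :=
    (((IsBddMeas.const 1).sub ((IsBddMeas.const _).mul hF)).sub
      ((IsBddMeas.const _).mul (IsBddMeas.leftLim σ₁.isSubCDF_G))).sub
      ((IsBddMeas.const _).mul ((IsBddMeas.const 1).sub (IsBddMeas.exp hB.γ₁_nonneg)))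
  exact (hr.add ((he.mul (IsBddMeas.const _)).mul hs)).add
    ((((IsBddMeas.const _).mul (hF.sub (IsBddMeas.leftLim σ₁.isSubCDF_F))).mul he).mul
      (IsBddMeas.const _))

/-- The shortfall from `u` is an average of the shortfalls of the pure plans. If `u` bounds all pure
payoffs, every term is nonnegative; this shows both that a strategy supported on optimal plans is
optimal and that an optimal strategy is so supported. -/
lemma sub_u₁ (hB : B.Valid) (σ₁ : Strategy₁) (σ₂ : Strategy₂) (u : ℝ) :
    u - B.u₁ σ₁ σ₂ = (∫ t in Ici 0, (u - B.U₁ t σ₂) ∂σ₁.F.measure)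
      + (∫ t in Ici 0, (u - B.V₁ t σ₂) ∂σ₁.G.measure)
      + (1 - σ₁.F.measure.real (Ici 0) - σ₁.G.measure.real (Ici 0)) * (u - B.W₁ σ₂) := by
  rw [σ₁.isSubCDF_F.integral_const_sub (isBddMeas_U₁ hB σ₂),
    σ₁.isSubCDF_G.integral_const_sub (isBddMeas_V₁ hB σ₂), u₁]
  ring

lemma sub_u₂ (hB : B.Valid) (σ₁ : Strategy₁) (σ₂ : Strategy₂) (u : ℝ) :
    u - B.u₂ σ₁ σ₂ = (∫ t in Ici 0, (u - B.U₂ t σ₂.q σ₁) ∂σ₂.F.measure)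
      + (1 - σ₂.F.measure.real (Ici 0)) * (u - B.received₂ (Ici 0) σ₂.q σ₁) := by
  rw [σ₂.isSubCDF.integral_const_sub (isBddMeas_U₂ hB σ₁ σ₂.isBddMeas_q), u₂]
  ring

variable (B) in
/-- `σ₁` is a best reply of player 1 to `σ₂`, with payoff `u`. -/
structure IsBest₁ (σ₁ : Strategy₁) (σ₂ : Strategy₂) (u : ℝ) : Prop where
  U_le : ∀ t, 0 ≤ t → B.U₁ t σ₂ ≤ u
  V_le : ∀ t, 0 ≤ t → B.V₁ t σ₂ ≤ u
  W_le : B.W₁ σ₂ ≤ u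
  U_eq : ∀ᵐ t ∂σ₁.F.measure, B.U₁ t σ₂ = u
  V_eq : ∀ᵐ t ∂σ₁.G.measure, B.V₁ t σ₂ = u
  W_eq : σ₁.F.measure.real (Ici 0) + σ₁.G.measure.real (Ici 0) < 1 → B.W₁ σ₂ = u

variable (B) in
/-- `σ₂` is a best reply of player 2 to `σ₁`, with payoff `u`. -/
structure IsBest₂ (σ₁ : Strategy₁) (σ₂ : Strategy₂) (u : ℝ) : Prop where
  U_le : ∀ q, Measurable q → (∀ t, q t ∈ Icc (0 : ℝ) 1) → ∀ t, 0 ≤ t → B.U₂ t q σ₁ ≤ u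
  W_le : ∀ q, Measurable q → (∀ t, q t ∈ Icc (0 : ℝ) 1) → B.received₂ (Ici 0) q σ₁ ≤ u
  U_eq : ∀ᵐ t ∂σ₂.F.measure, B.U₂ t σ₂.q σ₁ = u
  W_eq : σ₂.F.measure.real (Ici 0) < 1 → B.received₂ (Ici 0) σ₂.q σ₁ = u

lemma IsBest₁.u₁_eq (hB : B.Valid) {σ₁ : Strategy₁} {σ₂ : Strategy₂} {u : ℝ}
    (h : B.IsBest₁ σ₁ σ₂ u) : B.u₁ σ₁ σ₂ = u := by
  have h1 := sub_u₁ hB σ₁ σ₂ u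
  rw [σ₁.isSubCDF_F.integral_sub_eq_zero h.U_eq, σ₁.isSubCDF_G.integral_sub_eq_zero h.V_eq] at h1
  rcases σ₁.mass_le_one.eq_or_lt with h2 | h2
  · rw [show 1 - σ₁.F.measure.real (Ici 0) - σ₁.G.measure.real (Ici 0) = 0 by linarith] at h1
    linarith
  · rw [h.W_eq h2] at h1; linarith

lemma IsBest₂.u₂_eq (hB : B.Valid) {σ₁ : Strategy₁} {σ₂ : Strategy₂} {u : ℝ}
    (h : B.IsBest₂ σ₁ σ₂ u) : B.u₂ σ₁ σ₂ = u := by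
  have h1 := sub_u₂ hB σ₁ σ₂ u
  rw [σ₂.isSubCDF.integral_sub_eq_zero h.U_eq] at h1
  rcases σ₂.isSubCDF.real_Ici_le_one.eq_or_lt with h2 | h2
  · rw [h2] at h1; linarith
  · rw [h.W_eq h2] at h1; linarith

lemma isEquilibrium_of_isBest (hB : B.Valid) {σ₁ : Strategy₁} {σ₂ : Strategy₂} {u v : ℝ}
    (h1 : B.IsBest₁ σ₁ σ₂ u) (h2 : B.IsBest₂ σ₁ σ₂ v) : B.IsEquilibrium σ₁ σ₂ := by
  constructor
  · intro τ
    rw [h1.u₁_eq hB, ← sub_nonneg, sub_u₁ hB]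
    refine add_nonneg (add_nonneg (StieltjesFunction.IsSubCDF.integral_sub_nonneg h1.U_le)
      (StieltjesFunction.IsSubCDF.integral_sub_nonneg h1.V_le)) (mul_nonneg ?_ (sub_nonneg.2 h1.W_le))
    linarith [τ.mass_le_one]
  · intro τ
    rw [h2.u₂_eq hB, ← sub_nonneg, sub_u₂ hB]
    exact add_nonneg (StieltjesFunction.IsSubCDF.integral_sub_nonneg
      (h2.U_le _ τ.q_measurable τ.q_mem)) (mul_nonneg (by linarith [τ.isSubCDF.real_Ici_le_one])
      (sub_nonneg.2 (h2.W_le _ τ.q_measurable τ.q_mem)))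

/-- Point-mass deviations bound every pure payoff. The nonnegative shortfalls of the strategy itself
then sum to zero, so each of them vanishes. -/
lemma IsEquilibrium.isBest₁ (hB : B.Valid) {σ₁ : Strategy₁} {σ₂ : Strategy₂}
    (h : B.IsEquilibrium σ₁ σ₂) : B.IsBest₁ σ₁ σ₂ (B.u₁ σ₁ σ₂) := by
  have hU : ∀ t, 0 ≤ t → B.U₁ t σ₂ ≤ B.u₁ σ₁ σ₂ := fun t ht => by
    have := h.1 (Strategy₁.concede t ht)
    rw [u₁, Strategy₁.concede, Measure.measure_distrib] at this
    simpa [StieltjesFunction.measure_zero, setIntegral_dirac, ht, Measure.real] using this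
  have hV : ∀ t, 0 ≤ t → B.V₁ t σ₂ ≤ B.u₁ σ₁ σ₂ := fun t ht => by
    have := h.1 (Strategy₁.challenge t ht)
    rw [u₁, Strategy₁.challenge, Measure.measure_distrib] at this
    simpa [StieltjesFunction.measure_zero, setIntegral_dirac, ht, Measure.real] using this
  have hW : B.W₁ σ₂ ≤ B.u₁ σ₁ σ₂ := by
    have := h.1 Strategy₁.wait
    rw [u₁, Strategy₁.wait] at this
    simpa [StieltjesFunction.measure_zero] using this
  have h0 := sub_u₁ hB σ₁ σ₂ (B.u₁ σ₁ σ₂)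
  have h1 := StieltjesFunction.IsSubCDF.integral_sub_nonneg (K := σ₁.F) hU
  have h2 := StieltjesFunction.IsSubCDF.integral_sub_nonneg (K := σ₁.G) hV
  have h3 : 0 ≤ 1 - σ₁.F.measure.real (Ici 0) - σ₁.G.measure.real (Ici 0) := by
    linarith [σ₁.mass_le_one]
  have h4 := mul_nonneg h3 (sub_nonneg.2 hW)
  refine ⟨hU, hV, hW, σ₁.isSubCDF_F.ae_eq_of_integral_sub_eq_zero (isBddMeas_U₁ hB σ₂) hU
    (by linarith), σ₁.isSubCDF_G.ae_eq_of_integral_sub_eq_zero (isBddMeas_V₁ hB σ₂) hV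
    (by linarith), fun h5 => ?_⟩
  have h6 : (1 - σ₁.F.measure.real (Ici 0) - σ₁.G.measure.real (Ici 0))
      * (B.u₁ σ₁ σ₂ - B.W₁ σ₂) = 0 := by linarith
  rcases mul_eq_zero.1 h6 with h7 | h7 <;> linarith

lemma IsEquilibrium.isBest₂ (hB : B.Valid) {σ₁ : Strategy₁} {σ₂ : Strategy₂}
    (h : B.IsEquilibrium σ₁ σ₂) : B.IsBest₂ σ₁ σ₂ (B.u₂ σ₁ σ₂) := by
  have hU : ∀ q, Measurable q → (∀ t, q t ∈ Icc (0 : ℝ) 1) → ∀ t, 0 ≤ t →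
      B.U₂ t q σ₁ ≤ B.u₂ σ₁ σ₂ := fun q hq hq' t ht => by
    have := h.2 (Strategy₂.concede t ht q hq hq')
    rw [u₂, Strategy₂.concede, Measure.measure_distrib] at this
    simpa [setIntegral_dirac, ht, Measure.real] using this
  have hW : ∀ q, Measurable q → (∀ t, q t ∈ Icc (0 : ℝ) 1) →
      B.received₂ (Ici 0) q σ₁ ≤ B.u₂ σ₁ σ₂ := fun q hq hq' => by
    have := h.2 (Strategy₂.wait q hq hq')
    rw [u₂, Strategy₂.wait] at this
    simpa [StieltjesFunction.measure_zero] using this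
  have h0 := sub_u₂ hB σ₁ σ₂ (B.u₂ σ₁ σ₂)
  have hU' := hU _ σ₂.q_measurable σ₂.q_mem
  have hW' := hW _ σ₂.q_measurable σ₂.q_mem
  have h1 := StieltjesFunction.IsSubCDF.integral_sub_nonneg (K := σ₂.F) hU'
  have h3 : 0 ≤ 1 - σ₂.F.measure.real (Ici 0) := by linarith [σ₂.isSubCDF.real_Ici_le_one]
  have h4 := mul_nonneg h3 (sub_nonneg.2 hW')
  refine ⟨hU, hW, σ₂.isSubCDF.ae_eq_of_integral_sub_eq_zero
    (isBddMeas_U₂ hB σ₁ σ₂.isBddMeas_q) hU' (by linarith), fun h5 => ?_⟩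
  have h6 : (1 - σ₂.F.measure.real (Ici 0))
      * (B.u₂ σ₁ σ₂ - B.received₂ (Ici 0) σ₂.q σ₁) = 0 := by linarith
  rcases mul_eq_zero.1 h6 with h7 | h7 <;> linarith

end BargainingGame

namespace BargainingGame

variable {B : BargainingGame} {σ₁ : Strategy₁} {σ₂ : Strategy₂} {u v : ℝ}

lemma IsBest₁.isReply (hB : B.Valid) (h : B.IsBest₁ σ₁ σ₂ u) :
    IsReply σ₁.F σ₂.F (1 - B.z₂) B.r₁ B.rate₂ (B.surv₂ σ₂) ((u - (1 - B.a₂)) / B.D) where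
  sub := σ₁.isSubCDF_F
  le t ht := by
    rw [le_div_iff₀ hB.D_pos, mul_comm]
    linarith [h.U_le t ht, U₁_eq hB σ₂ ht]
  ae_eq := by
    filter_upwards [h.U_eq, σ₁.isSubCDF_F.ae_nonneg] with t ht ht0
    rw [eq_div_iff hB.D_pos.ne', mul_comm]
    linarith [U₁_eq hB σ₂ ht0]

lemma IsBest₁.drift₂_le (hB : B.Valid) (h : B.IsBest₁ σ₁ σ₂ u) {t : ℝ} (ht : 0 ≤ t) :
    (1 - B.a₂) + B.D * B.drift₂ σ₂ t ≤ u := by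
  have h1 : B.drift₂ σ₂ t ≤ _ := IsReply.drift_le (isOpponent₂ hB σ₂) (h.isReply hB) ht
  rw [le_div_iff₀ hB.D_pos, mul_comm] at h1
  linarith

/-- An unjustified player 1 challenges only if player 2 is sufficiently likely to yield. -/
lemma IsBest₁.ae_le_q (hB : B.Valid) (h : B.IsBest₁ σ₁ σ₂ u) :
    ∀ᵐ t ∂σ₁.G.measure, (B.c₁ - B.w₁) / (1 - B.w₁) ≤ σ₂.q t := by
  have hw := hB.w₁_lt_one
  filter_upwards [h.V_eq, σ₁.isSubCDF_G.ae_nonneg] with t ht ht0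
  have h1 := V₁_eq hB σ₂ ht0
  have h2 := h.drift₂_le hB ht0
  -- A challenge in the support pays `u`, and conceding right after pays at most `u`, so the net
  -- gain from challenging is nonnegative. With too small a `q` the expected prize would stay below
  -- `c₁`.
  have h3 : 0 ≤ B.D * (Real.exp (-B.r₁ * t) * ((1 - B.z₂) * (1 - σ₂.F t) *
      ((1 - σ₂.q t) * B.w₁ + σ₂.q t) - B.c₁ * B.surv₂ σ₂ t)) := by
    rw [mul_add] at h1; linarith
  have h4 := nonneg_of_mul_nonneg_right (nonneg_of_mul_nonneg_right h3 hB.D_pos) (Real.exp_pos _)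
  set X := (1 - B.z₂) * (1 - σ₂.F t) with hX
  have hX0 : 0 ≤ X := mul_nonneg (by linarith [hB.z₂_mem.2]) (by linarith [σ₂.F_le_one t])
  have hS : B.surv₂ σ₂ t = B.z₂ + X := by rw [surv₂, hX]; ring
  rw [hS] at h4
  rw [div_le_iff₀ (by linarith)]
  have h5 : 0 < B.c₁ * B.z₂ := mul_pos hB.c₁_pos hB.z₂_mem.1
  by_contra hlt
  have hlt := not_le.1 hlt
  have h6 : X * ((1 - σ₂.q t) * B.w₁ + σ₂.q t) ≤ X * B.c₁ :=
    mul_le_mul_of_nonneg_left (by linarith) hX0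
  linarith

/-! ### Optimal responses to challenges -/

lemma seeGain_add (hB : B.Valid) {I : Set ℝ} (hI : MeasurableSet I) (h0 : I ⊆ Ici 0)
    {p p' : ℝ → ℝ} (hp : IsBddMeas p) (hp' : IsBddMeas p') :
    B.seeGain σ₁ I (fun s => p s + p' s) = B.seeGain σ₁ I p + B.seeGain σ₁ I p' := by
  simp only [seeGain, add_mul]
  rw [integral_add (integrableOn_exp_G hB σ₁ hp hI h0) (integrableOn_exp_G hB σ₁ hp' hI h0),
    integral_add (integrableOn_justified hB hp hI h0) (integrableOn_justified hB hp' hI h0)]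
  ring

lemma seeGain_zero (I : Set ℝ) : B.seeGain σ₁ I (fun _ => 0) = 0 := by simp [seeGain]

variable (B) in
/-- Net weight of the unjustified challenges in `A` against the justified ones. -/
def challengeWeight (σ₁ : Strategy₁) (A : Set ℝ) : ℝ :=
  (1 - B.z₁) * (1 - B.w₁ - B.k₂) * σ₁.G.measure.real A
    - B.k₂ * B.z₁ * ∫ s in A, B.γ₁ * Real.exp (-B.γ₁ * s)

/-- The weight `exp (r₂ (s - t))` undoes the discounting, so such a perturbation tests the
undiscounted weight of `A`. It is at most 1 on `A` when `A` lies below `t`, which keeps the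
perturbation feasible. -/
lemma seeGain_indicator {I A : Set ℝ} (hA : MeasurableSet A) (hAI : A ⊆ I) (c t : ℝ) :
    B.seeGain σ₁ I (A.indicator fun s => c * Real.exp (B.r₂ * (s - t)))
      = c * Real.exp (-B.r₂ * t) * B.challengeWeight σ₁ A := by
  have hexp : ∀ s, Real.exp (B.r₂ * (s - t)) * Real.exp (-B.r₂ * s) = Real.exp (-B.r₂ * t) := by
    intro s; rw [← Real.exp_add]; ring_nf
  have h1 : (fun s => A.indicator (fun s => c * Real.exp (B.r₂ * (s - t))) s * Real.exp (-B.r₂ * s))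
      = A.indicator fun _ => c * Real.exp (-B.r₂ * t) := by
    ext s
    by_cases hs : s ∈ A
    · simp only [hs, indicator_of_mem]; rw [mul_assoc, hexp]
    · simp [hs]
  have h2 : (fun s => A.indicator (fun _ => c * Real.exp (-B.r₂ * t)) s
      * (B.γ₁ * Real.exp (-B.γ₁ * s)))
      = A.indicator fun s => c * Real.exp (-B.r₂ * t) * (B.γ₁ * Real.exp (-B.γ₁ * s)) := by
    ext s
    by_cases hs : s ∈ A <;> simp [hs]
  have h3 : (fun s => A.indicator (fun s => c * Real.exp (B.r₂ * (s - t))) s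
      * Real.exp (-B.r₂ * s) * (B.γ₁ * Real.exp (-B.γ₁ * s)))
      = A.indicator fun s => c * Real.exp (-B.r₂ * t) * (B.γ₁ * Real.exp (-B.γ₁ * s)) := by
    rw [← h2]; ext s; rw [← congrFun h1 s]
  rw [seeGain, h1, h3, setIntegral_indicator hA, setIntegral_indicator hA,
    inter_eq_self_of_subset_right hAI, setIntegral_const, integral_const_mul, challengeWeight,
    smul_eq_mul]
  ring

/-- On the set `I`, seeing challenges with probability `p` is optimal. -/
def IsOptimalOn (B : BargainingGame) (σ₁ : Strategy₁) (I : Set ℝ) (p : ℝ → ℝ) : Prop :=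
  ∀ p', Measurable p' → (∀ t, p' t ∈ Icc (0 : ℝ) 1) → B.seeGain σ₁ I p' ≤ B.seeGain σ₁ I p

lemma one_sub_mem {p : ℝ → ℝ} (hp : ∀ t, p t ∈ Icc (0 : ℝ) 1) (t : ℝ) :
    1 - p t ∈ Icc (0 : ℝ) 1 := ⟨by linarith [(hp t).2], by linarith [(hp t).1]⟩

lemma IsBest₂.isOptimalOn_Ico (hB : B.Valid) (h : B.IsBest₂ σ₁ σ₂ v) {t : ℝ} (ht : 0 ≤ t)
    (hv : B.U₂ t σ₂.q σ₁ = v) : B.IsOptimalOn σ₁ (Ico 0 t) fun s => 1 - σ₂.q s := by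
  intro p' hp' hp''
  have hm : Measurable fun s => 1 - p' s := hp'.const_sub 1
  have h1 := h.U_le _ hm (one_sub_mem hp'') t ht
  rw [← hv, U₂_eq hB σ₁ (isBddMeas_of_mem hm (one_sub_mem hp'')) ht,
    U₂_eq hB σ₁ σ₂.isBddMeas_q ht] at h1
  simp only [sub_sub_cancel] at h1
  have h2 := le_of_mul_le_mul_left (le_of_add_le_add_left h1) hB.D_pos
  linarith

lemma IsBest₂.isOptimalOn_Ici (hB : B.Valid) (h : B.IsBest₂ σ₁ σ₂ v)
    (hv : B.received₂ (Ici 0) σ₂.q σ₁ = v) :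
    B.IsOptimalOn σ₁ (Ici 0) fun s => 1 - σ₂.q s := by
  intro p' hp' hp''
  have hm : Measurable fun s => 1 - p' s := hp'.const_sub 1
  have h1 := h.W_le _ hm (one_sub_mem hp'')
  rw [← hv, received₂_eq hB σ₁ (isBddMeas_of_mem hm (one_sub_mem hp'')) measurableSet_Ici subset_rfl,
    received₂_eq hB σ₁ σ₂.isBddMeas_q measurableSet_Ici subset_rfl] at h1
  simp only [sub_sub_cancel] at h1
  exact le_of_mul_le_mul_left (le_of_add_le_add_left h1) hB.D_pos

/-- The yielding rule matters only until player 2 concedes. If player 2 may still be present after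
`t₀`, either some optimal concession time lies beyond `t₀` or never conceding is optimal, and either
one forces optimal responses on all of `[0, t₀]`. -/
lemma IsBest₂.exists_isOptimalOn (hB : B.Valid) (h : B.IsBest₂ σ₁ σ₂ v) {t₀ : ℝ}
    (ht₀ : σ₂.F t₀ < 1) : ∃ I, MeasurableSet I ∧ I ⊆ Ici 0 ∧ Icc 0 t₀ ⊆ I ∧
      B.IsOptimalOn σ₁ I fun s => 1 - σ₂.q s := by
  rcases σ₂.isSubCDF.real_Ici_le_one.eq_or_lt with h1 | h1
  · have h2 : ∃ t, t₀ < t ∧ 0 ≤ t ∧ B.U₂ t σ₂.q σ₁ = v := by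
      by_contra hcon
      push Not at hcon
      have h3 : σ₂.F.measure (Ioi t₀) = 0 := by
        have hae := h.U_eq.and σ₂.isSubCDF.ae_nonneg
        rw [ae_iff] at hae
        refine measure_mono_null (fun t ht => ?_) hae
        exact fun hc => hcon t ht hc.2 hc.1
      have h4 := σ₂.F.measure_Ioi σ₂.isSubCDF.tendsto_atTop t₀
      rw [h3, h1, eq_comm, ENNReal.ofReal_eq_zero] at h4
      linarith
    obtain ⟨t, ht, ht0, htv⟩ := h2
    exact ⟨Ico 0 t, measurableSet_Ico, Ico_subset_Ici_self,
      fun s hs => ⟨hs.1, hs.2.trans_lt ht⟩, h.isOptimalOn_Ico hB ht0 htv⟩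
  · exact ⟨Ici 0, measurableSet_Ici, subset_rfl, Icc_subset_Ici_self,
      h.isOptimalOn_Ici hB (h.W_eq h1)⟩

section Optimal

variable {I : Set ℝ} {p : ℝ → ℝ}

/-- A perturbation of an optimal response on `A` is not profitable. -/
lemma IsOptimalOn.mul_challengeWeight_le (hB : B.Valid) (hI : MeasurableSet I) (h0 : I ⊆ Ici 0)
    (hp : Measurable p) (hp' : ∀ t, p t ∈ Icc (0 : ℝ) 1) (hopt : B.IsOptimalOn σ₁ I p)
    {A : Set ℝ} (hA : MeasurableSet A) (hAI : A ⊆ I) {t : ℝ} (hAt : A ⊆ Iic t) {c : ℝ}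
    (hc : ∀ s ∈ A, ∀ x ∈ Icc (0 : ℝ) 1, p s + c * x ∈ Icc (0 : ℝ) 1) :
    c * B.challengeWeight σ₁ A ≤ 0 := by
  have hr := hB.r₂_pos
  have hx : ∀ s ∈ A, Real.exp (B.r₂ * (s - t)) ∈ Icc (0 : ℝ) 1 := fun s hs =>
    ⟨(Real.exp_pos _).le, by
      rw [Real.exp_le_one_iff]; nlinarith [mem_Iic.1 (hAt hs)]⟩
  have hm : Measurable (A.indicator fun s => c * Real.exp (B.r₂ * (s - t))) :=
    Measurable.indicator (by fun_prop) hA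
  have hb : IsBddMeas (A.indicator fun s => c * Real.exp (B.r₂ * (s - t))) := by
    refine ⟨hm, |c|, fun s _ => ?_⟩
    by_cases hs : s ∈ A
    · rw [indicator_of_mem hs, abs_mul, abs_of_nonneg (hx s hs).1]
      exact mul_le_of_le_one_right (abs_nonneg c) (hx s hs).2
    · rw [indicator_of_notMem hs]; simp
  have h1 := hopt (fun s => p s + A.indicator (fun s => c * Real.exp (B.r₂ * (s - t))) s)
    (hp.add hm) (fun s => by
      by_cases hs : s ∈ A
      · rw [indicator_of_mem hs]; exact hc s hs _ (hx s hs)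
      · rw [indicator_of_notMem hs, add_zero]; exact hp' s)
  rw [seeGain_add hB hI h0 (isBddMeas_of_mem hp hp') hb, seeGain_indicator hA hAI] at h1
  have h2 : Real.exp (-B.r₂ * t) * (c * B.challengeWeight σ₁ A) ≤ 0 := by linarith
  exact nonpos_of_mul_nonpos_right h2 (Real.exp_pos _)

/-- Where `p ≤ 1 - δ` there is room to see more often, so the weight of that part is nonpositive.
That part carries all unjustified challenges; the rest of `A` adds only justified ones, which lower
the weight. -/
lemma IsOptimalOn.challengeWeight_le (hB : B.Valid) (hI : MeasurableSet I) (h0 : I ⊆ Ici 0)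
    (hp : Measurable p) (hp' : ∀ t, p t ∈ Icc (0 : ℝ) 1) (hopt : B.IsOptimalOn σ₁ I p)
    {δ : ℝ} (hδ : 0 < δ) (hG : ∀ᵐ t ∂σ₁.G.measure, p t ≤ 1 - δ)
    {A : Set ℝ} (hA : MeasurableSet A) (hAI : A ⊆ I) {t : ℝ} (hAt : A ⊆ Iic t) :
    B.challengeWeight σ₁ A ≤ 0 := by
  set A' := A ∩ {s | p s ≤ 1 - δ} with hA'
  have hA'm : MeasurableSet A' := hA.inter (measurableSet_le hp measurable_const)
  have h1 := hopt.mul_challengeWeight_le hB hI h0 hp hp' (A := A') (c := δ) hA'm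
    (inter_subset_left.trans hAI) (inter_subset_left.trans hAt) (fun s hs x hx =>
      ⟨add_nonneg (hp' s).1 (mul_nonneg hδ.le hx.1), by
        have h2 : p s ≤ 1 - δ := hs.2
        nlinarith [hx.2]⟩)
  have h2 : B.challengeWeight σ₁ A' ≤ 0 := nonpos_of_mul_nonpos_right h1 hδ
  refine le_trans ?_ h2
  have h3 : σ₁.G.measure.real A' = σ₁.G.measure.real A := by
    refine measureReal_congr ?_
    filter_upwards [hG] with s hs
    refine propext ⟨fun h => h.1, fun h => ⟨h, hs⟩⟩
  have h4 : ∫ s in A', B.γ₁ * Real.exp (-B.γ₁ * s) ≤ ∫ s in A, B.γ₁ * Real.exp (-B.γ₁ * s) := by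
    refine setIntegral_mono_set ?_ (ae_of_all _ fun s =>
      mul_nonneg hB.γ₁_nonneg (Real.exp_pos _).le) (LE.le.eventuallyLE inter_subset_left)
    have hbd : IntegrableOn (fun s => B.γ₁ * Real.exp (-B.γ₁ * s)) (Icc 0 t) :=
      (Continuous.integrableOn_Icc (by fun_prop))
    exact hbd.mono_set fun s hs => ⟨h0 (hAI hs), hAt hs⟩
  rw [challengeWeight, challengeWeight, h3]
  have h5 := mul_le_mul_of_nonneg_left h4 (mul_pos hB.k₂_pos hB.z₁_mem.1).le
  linarith

/-- In equilibrium player 2 gains nothing from seeing challenges. -/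
lemma IsOptimalOn.seeGain_eq_zero (hB : B.Valid) (hI : MeasurableSet I) (h0 : I ⊆ Ici 0)
    (hp : Measurable p) (hp' : ∀ t, p t ∈ Icc (0 : ℝ) 1) (hopt : B.IsOptimalOn σ₁ I p)
    {δ : ℝ} (hδ : 0 < δ) (hδ1 : δ < 1) (hG : ∀ᵐ t ∂σ₁.G.measure, p t ≤ 1 - δ) :
    B.seeGain σ₁ I p = 0 := by
  refine le_antisymm ?_ ?_
  swap
  · rw [← seeGain_zero (B := B) (σ₁ := σ₁) I]
    exact hopt _ measurable_const fun _ => ⟨le_rfl, zero_le_one⟩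
  set E := {s | p s ≤ 1 - δ}
  have hE : MeasurableSet E := measurableSet_le hp measurable_const
  have h1δ : 0 < 1 - δ := by linarith
  -- Scaling `p` up on `E` is feasible. It multiplies the gain from unjustified challenges, all of
  -- which lie in `E`, by `(1 - δ)⁻¹`, and the loss from justified ones by at most that factor; a
  -- positive total could therefore be improved.
  set p' : ℝ → ℝ := E.indicator fun s => (1 - δ)⁻¹ * p s with hp'def
  have hm : Measurable p' := (hp.const_mul _).indicator hE
  have hmem : ∀ s, p' s ∈ Icc (0 : ℝ) 1 := by
    intro s
    by_cases hs : s ∈ E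
    · simp only [hp'def, indicator_of_mem hs]
      refine ⟨mul_nonneg (inv_nonneg.2 h1δ.le) (hp' s).1, ?_⟩
      rw [inv_mul_le_iff₀ h1δ, mul_one]; exact hs
    · simp [hp'def, indicator_of_notMem hs]
  have h1 := hopt p' hm hmem
  have hbp := isBddMeas_of_mem hp hp'
  have hbp' := isBddMeas_of_mem hm hmem
  have h2 : ∫ s in I, p' s * Real.exp (-B.r₂ * s) ∂σ₁.G.measure
      = (1 - δ)⁻¹ * ∫ s in I, p s * Real.exp (-B.r₂ * s) ∂σ₁.G.measure := by
    rw [← integral_const_mul]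
    refine integral_congr_ae (ae_restrict_of_ae ?_)
    filter_upwards [hG] with s hs
    have hs : s ∈ E := hs
    simp only [hp'def, indicator_of_mem hs]; ring
  have h3 : ∫ s in I, p' s * Real.exp (-B.r₂ * s) * (B.γ₁ * Real.exp (-B.γ₁ * s))
      ≤ (1 - δ)⁻¹ * ∫ s in I, p s * Real.exp (-B.r₂ * s) * (B.γ₁ * Real.exp (-B.γ₁ * s)) := by
    rw [← integral_const_mul]
    refine setIntegral_mono_on (integrableOn_justified hB hbp' hI h0)
      ((integrableOn_justified hB hbp hI h0).const_mul _) hI fun s _ => ?_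
    have h4 : p' s ≤ (1 - δ)⁻¹ * p s := by
      by_cases hs : s ∈ E
      · simp only [hp'def, indicator_of_mem hs, le_refl]
      · simp only [hp'def, indicator_of_notMem hs]
        exact mul_nonneg (inv_nonneg.2 h1δ.le) (hp' s).1
    have h5 : 0 ≤ Real.exp (-B.r₂ * s) * (B.γ₁ * Real.exp (-B.γ₁ * s)) :=
      mul_nonneg (Real.exp_pos _).le (mul_nonneg hB.γ₁_nonneg (Real.exp_pos _).le)
    nlinarith [mul_le_mul_of_nonneg_right h4 h5]
  have h4 : (1 - δ)⁻¹ * B.seeGain σ₁ I p ≤ B.seeGain σ₁ I p' := by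
    rw [seeGain, seeGain, h2]
    have := mul_le_mul_of_nonneg_left h3 (mul_pos hB.k₂_pos hB.z₁_mem.1).le
    linarith
  have h5 : 1 < (1 - δ)⁻¹ := (one_lt_inv₀ h1δ).2 (by linarith)
  by_contra hpos
  have hpos := not_le.1 hpos
  nlinarith

end Optimal

/-! ### Consequences of equilibrium -/

lemma measurable_see (σ₂ : Strategy₂) : Measurable fun s => 1 - σ₂.q s := σ₂.q_measurable.const_sub 1

variable (B) in
/-- A pair of mutual best replies. -/
structure IsEq (σ₁ : Strategy₁) (σ₂ : Strategy₂) (u v : ℝ) : Prop where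
  valid : B.Valid
  best₁ : B.IsBest₁ σ₁ σ₂ u
  best₂ : B.IsBest₂ σ₁ σ₂ v

namespace IsEq

variable (h : B.IsEq σ₁ σ₂ u v)
include h

lemma delta_pos : 0 < (B.c₁ - B.w₁) / (1 - B.w₁) :=
  div_pos (by linarith [h.valid.w₁_lt]) (by linarith [h.valid.w₁_lt_one])

lemma delta_lt_one : (B.c₁ - B.w₁) / (1 - B.w₁) < 1 := by
  rw [div_lt_one (by linarith [h.valid.w₁_lt_one])]; linarith [h.valid.c₁_lt]

lemma ae_see_le : ∀ᵐ t ∂σ₁.G.measure, 1 - σ₂.q t ≤ 1 - (B.c₁ - B.w₁) / (1 - B.w₁) := by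
  filter_upwards [h.best₁.ae_le_q h.valid] with t ht
  linarith

lemma challengeWeight_le {A : Set ℝ} (hA : MeasurableSet A) {t : ℝ} (hAt : A ⊆ Icc 0 t)
    (ht : σ₂.F t < 1) : B.challengeWeight σ₁ A ≤ 0 := by
  obtain ⟨I, hI, h0, htI, hopt⟩ := h.best₂.exists_isOptimalOn h.valid ht
  exact hopt.challengeWeight_le h.valid hI h0 (measurable_see σ₂) (one_sub_mem σ₂.q_mem) h.delta_pos
    h.ae_see_le hA (hAt.trans htI) (fun s hs => (hAt hs).2)

/-- Where challenges are seen with probability at least `η` there is room to see less often, which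
gives the reverse inequality. -/
lemma challengeWeight_eq {A : Set ℝ} (hA : MeasurableSet A) {t : ℝ} (hAt : A ⊆ Icc 0 t)
    (ht : σ₂.F t < 1) {η : ℝ} (hη : 0 < η) (hq : ∀ s ∈ A, σ₂.q s ≤ 1 - η) :
    B.challengeWeight σ₁ A = 0 := by
  refine le_antisymm (h.challengeWeight_le hA hAt ht) ?_
  obtain ⟨I, hI, h0, htI, hopt⟩ := h.best₂.exists_isOptimalOn h.valid ht
  have h1 := hopt.mul_challengeWeight_le h.valid hI h0 (measurable_see σ₂) (one_sub_mem σ₂.q_mem) hA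
    (hAt.trans htI) (fun s hs => (hAt hs).2) (c := -η) (fun s hs x hx => by
      have h2 := hq s hs
      have h3 := (σ₂.q_mem s).1
      constructor <;> nlinarith [hx.1, hx.2])
  by_contra hneg
  nlinarith [not_le.1 hneg]

lemma seeGain_eq_zero {I : Set ℝ} (hI : MeasurableSet I) (h0 : I ⊆ Ici 0)
    (hopt : B.IsOptimalOn σ₁ I fun s => 1 - σ₂.q s) :
    B.seeGain σ₁ I (fun s => 1 - σ₂.q s) = 0 :=
  hopt.seeGain_eq_zero h.valid hI h0 (measurable_see σ₂) (one_sub_mem σ₂.q_mem) h.delta_pos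
    h.delta_lt_one h.ae_see_le

/-- Always yielding gives the upper bound, and on the support the gain from seeing is zero. Player 2
therefore concedes as if challenges could not be seen. -/
lemma isReply₂ :
    IsReply σ₂.F σ₁.F (1 - B.z₁) B.r₂ B.rate₁ (B.surv₁ σ₁) ((v - (1 - B.a₁)) / B.D) where
  sub := σ₂.isSubCDF
  le t ht := by
    rw [le_div_iff₀ h.valid.D_pos, mul_comm]
    have h1 := h.best₂.U_le (fun _ => 1) measurable_const (fun _ => ⟨zero_le_one, le_rfl⟩) t ht
    rw [U₂_eq h.valid σ₁ (IsBddMeas.const 1) ht] at h1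
    simp only [sub_self, seeGain_zero, add_zero] at h1
    linarith
  ae_eq := by
    filter_upwards [h.best₂.U_eq, σ₂.isSubCDF.ae_nonneg] with t ht ht0
    rw [eq_div_iff h.valid.D_pos.ne', mul_comm]
    have h1 := U₂_eq h.valid σ₁ σ₂.isBddMeas_q ht0
    rw [h.seeGain_eq_zero measurableSet_Ico Ico_subset_Ici_self
      (h.best₂.isOptimalOn_Ico h.valid ht0 ht), add_zero] at h1
    linarith

end IsEq

end BargainingGame

/-! ### Exponential growth and linear differential equations -/

/-- `(exp (c * s) - 1) / c`, extended continuously to `c = 0`. -/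
def expGrowth (c s : ℝ) : ℝ := ∫ v in (0)..s, Real.exp (c * v)

lemma hasDerivAt_expGrowth (c s : ℝ) : HasDerivAt (expGrowth c) (Real.exp (c * s)) s := by
  have h : Continuous fun v : ℝ => Real.exp (c * v) := by fun_prop
  exact intervalIntegral.integral_hasDerivAt_right (h.intervalIntegrable _ _)
    h.aestronglyMeasurable.stronglyMeasurableAtFilter h.continuousAt

lemma expGrowth_zero (c : ℝ) : expGrowth c 0 = 0 := by simp [expGrowth]

lemma exp_eq_expGrowth (c s : ℝ) : Real.exp (c * s) = 1 + c * expGrowth c s := by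
  have h := integral_mul_exp_neg (-c) 0 s
  simp only [neg_neg, mul_zero, Real.exp_zero] at h
  rw [intervalIntegral.integral_const_mul] at h
  rw [expGrowth]; linarith

lemma continuous_expGrowth (c : ℝ) : Continuous (expGrowth c) :=
  continuous_iff_continuousAt.2 fun s => (hasDerivAt_expGrowth c s).continuousAt

lemma strictMono_expGrowth (c : ℝ) : StrictMono (expGrowth c) :=
  strictMono_of_deriv_pos fun s => by
    rw [(hasDerivAt_expGrowth c s).deriv]; exact Real.exp_pos _

/-- A function that grows at the rate `-l` off one point is an exponential. -/
lemma eq_mul_exp_of_hasDerivAt {y : ℝ → ℝ} {l T x₀ : ℝ}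
    (hc : ContinuousOn y (Icc 0 T))
    (hd : ∀ t, 0 < t → t < T → t ≠ x₀ → HasDerivAt y (-l * y t) t) {t : ℝ} (ht : 0 ≤ t)
    (htT : t ≤ T) : y t = y T * Real.exp (l * (T - t)) := by
  -- With the integrating factor the derivative is 0 except possibly at `x₀`; the fundamental
  -- theorem of calculus tolerates this one kink.
  have hcont : ContinuousOn (fun t => y t * Real.exp (l * t)) (Icc t T) :=
    (hc.mono (Icc_subset_Icc_left ht)).mul (by fun_prop)
  have hder : ∀ x ∈ Ioo t T \ {x₀}, HasDerivAt (fun t => y t * Real.exp (l * t)) 0 x := by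
    intro x hx
    have h1 : HasDerivAt (fun t : ℝ => l * t) l x := by simpa using (hasDerivAt_id x).const_mul l
    have h2 := (hd x (ht.trans_lt hx.1.1) hx.1.2 hx.2).mul h1.exp
    exact h2.congr_deriv (by ring)
  have h3 := integral_eq_of_hasDerivAt_off_countable_of_le _ (fun _ => 0) htT
    (countable_singleton x₀) hcont hder (by simp)
  simp only [intervalIntegral.integral_zero] at h3
  rw [mul_sub, Real.exp_sub, mul_div_assoc', eq_div_iff (Real.exp_pos _).ne']
  linarith

/-! ### Reputation as a function of the time to go, and the duration -/

namespace BargainingGame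

variable {B : BargainingGame}

variable (B) in
/-- Ratio of unjustified to justified challenges that makes player 2 indifferent. -/
def bluffRatio : ℝ := B.k₂ / (1 - B.w₁ - B.k₂)

variable (B) in
/-- Length of the final phase, in which an unjustified player 1 does not challenge. -/
def quietTime : ℝ := -Real.log (1 - B.c₁) / B.rate₂

variable (B) in
/-- Inverse of player 1's reputation when there is time `s` to go. -/
def invRep (s : ℝ) : ℝ :=
  1 + B.rate₁ * expGrowth (B.rate₁ - B.γ₁) s
    + B.γ₁ * B.bluffRatio * expGrowth (B.rate₁ - B.γ₁) (max (s - B.quietTime) 0)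

lemma bluffRatio_pos (hB : B.Valid) : 0 < B.bluffRatio :=
  div_pos hB.k₂_pos (by linarith [hB.k₂_lt])

lemma quietTime_pos (hB : B.Valid) : 0 < B.quietTime :=
  div_pos (neg_pos.2 (Real.log_neg (by linarith [hB.c₁_lt]) (by linarith [hB.c₁_pos])))
    (rate₂_pos hB)

lemma exp_quietTime (hB : B.Valid) : Real.exp (-B.rate₂ * B.quietTime) = 1 - B.c₁ := by
  rw [quietTime, neg_mul, mul_div_cancel₀ _ (rate₂_pos hB).ne', neg_neg, Real.exp_log]
  linarith [hB.c₁_lt]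

lemma invRep_zero (hB : B.Valid) : B.invRep 0 = 1 := by
  have := quietTime_pos hB
  rw [invRep, expGrowth_zero, max_eq_right (by linarith), expGrowth_zero]; ring

lemma continuous_invRep : Continuous B.invRep := by
  have := continuous_expGrowth (B.rate₁ - B.γ₁)
  unfold invRep
  fun_prop

lemma strictMono_invRep (hB : B.Valid) : StrictMono B.invRep := by
  intro s t hst
  have h1 := mul_lt_mul_of_pos_left (strictMono_expGrowth (B.rate₁ - B.γ₁) hst) (rate₁_pos hB)
  have h2 : max (s - B.quietTime) 0 ≤ max (t - B.quietTime) 0 := max_le_max (by linarith) le_rfl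
  have h3 := mul_le_mul_of_nonneg_left ((strictMono_expGrowth (B.rate₁ - B.γ₁)).monotone h2)
    (mul_nonneg hB.γ₁_nonneg (bluffRatio_pos hB).le)
  rw [invRep, invRep]; linarith

lemma one_le_invRep (hB : B.Valid) {s : ℝ} (hs : 0 ≤ s) : 1 ≤ B.invRep s := by
  rw [← invRep_zero hB]; exact (strictMono_invRep hB).monotone hs

/-- `invRep` solves a linear equation on each side of `quietTime`. Concessions contribute `rate₁ *
invRep`; justified challenges contribute `γ₁ * (1 - invRep)`; further from the end, bluffs add `γ₁ *
bluffRatio`. The forcing term jumps at `quietTime`, where `invRep` has a kink when `γ₁ > 0`. -/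
lemma hasDerivAt_invRep_of_lt {s : ℝ} (hs : s < B.quietTime) :
    HasDerivAt B.invRep ((B.rate₁ - B.γ₁) * B.invRep s + B.γ₁) s := by
  set c := B.rate₁ - B.γ₁ with hc
  have h1 := ((hasDerivAt_expGrowth c s).const_mul B.rate₁).const_add 1
  have h2 := h1.add_const (B.γ₁ * B.bluffRatio * expGrowth c 0)
  refine (h2.congr_of_eventuallyEq ?_).congr_deriv ?_
  · filter_upwards [Iio_mem_nhds hs] with t ht
    rw [invRep, max_eq_right (by linarith [mem_Iio.1 ht])]
  · rw [invRep, max_eq_right (by linarith), ← hc, exp_eq_expGrowth, expGrowth_zero]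
    linear_combination (-1 : ℝ) * hc

lemma hasDerivAt_invRep_of_gt {s : ℝ} (hs : B.quietTime < s) :
    HasDerivAt B.invRep ((B.rate₁ - B.γ₁) * B.invRep s + B.γ₁ * (1 + B.bluffRatio)) s := by
  set c := B.rate₁ - B.γ₁ with hc
  have h1 := ((hasDerivAt_expGrowth c s).const_mul B.rate₁).const_add 1
  have h0 : HasDerivAt (fun s => expGrowth c (s - B.quietTime))
      (Real.exp (c * (s - B.quietTime))) s := (hasDerivAt_expGrowth c _).comp_sub_const s _
  have h2 := h1.add (h0.const_mul (B.γ₁ * B.bluffRatio))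
  refine (h2.congr_of_eventuallyEq ?_).congr_deriv ?_
  · filter_upwards [Ioi_mem_nhds hs] with t ht
    rw [invRep, max_eq_left (by linarith [mem_Ioi.1 ht])]; rfl
  · rw [invRep, max_eq_left (by linarith), ← hc, exp_eq_expGrowth, exp_eq_expGrowth]
    linear_combination (-1 : ℝ) * hc

variable (B) in
/-- The equation for the equilibrium duration `T`. -/
def IsDuration (T : ℝ) : Prop :=
  0 < T ∧ max (B.z₁ * B.invRep T) (B.z₂ * Real.exp (B.rate₂ * T)) = 1

lemma strictMono_durationFun (hB : B.Valid) :
    StrictMono fun T => max (B.z₁ * B.invRep T) (B.z₂ * Real.exp (B.rate₂ * T)) := by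
  intro s t hst
  refine max_lt_max (mul_lt_mul_of_pos_left (strictMono_invRep hB hst) hB.z₁_mem.1)
    (mul_lt_mul_of_pos_left (Real.exp_lt_exp.2 ?_) hB.z₂_mem.1)
  exact mul_lt_mul_of_pos_left hst (rate₂_pos hB)

lemma IsDuration.unique (hB : B.Valid) {T T' : ℝ} (h : B.IsDuration T) (h' : B.IsDuration T') :
    T = T' := (strictMono_durationFun hB).injective (h.2.trans h'.2.symm)

/-- At `T = 0` the maximum is `max z₁ z₂ < 1`, and the term of player 2 alone reaches 1 at `-log z₂
/ rate₂`. -/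
lemma exists_isDuration (hB : B.Valid) : ∃ T, B.IsDuration T := by
  have h2 := rate₂_pos hB
  set T₂ := -Real.log B.z₂ / B.rate₂
  have hT₂ : 0 ≤ T₂ := div_nonneg (neg_nonneg.2 (Real.log_nonpos hB.z₂_mem.1.le hB.z₂_mem.2.le)) h2.le
  have hlt : max (B.z₁ * B.invRep 0) (B.z₂ * Real.exp (B.rate₂ * 0)) < 1 := by
    rw [invRep_zero hB]; simp [hB.z₁_mem.2, hB.z₂_mem.2]
  have hge : 1 ≤ max (B.z₁ * B.invRep T₂) (B.z₂ * Real.exp (B.rate₂ * T₂)) := by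
    refine le_max_of_le_right ?_
    rw [mul_div_cancel₀ _ h2.ne', Real.exp_neg, Real.exp_log hB.z₂_mem.1,
      mul_inv_cancel₀ hB.z₂_mem.1.ne']
  have hcont : Continuous fun T => max (B.z₁ * B.invRep T) (B.z₂ * Real.exp (B.rate₂ * T)) := by
    have := continuous_invRep (B := B)
    fun_prop
  obtain ⟨T, hT, hT1⟩ := intermediate_value_Icc hT₂ hcont.continuousOn ⟨hlt.le, hge⟩
  refine ⟨T, lt_of_le_of_ne hT.1 ?_, hT1⟩
  rintro rfl
  exact hlt.ne hT1

end BargainingGame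

/-! ### Necessary conditions: equilibrium behaviour is determined -/

namespace BargainingGame

variable {B : BargainingGame} {σ₁ : Strategy₁} {σ₂ : Strategy₂} {u v T : ℝ}

/-- An unjustified player 1 does not challenge a player 2 who is likely to be justified. -/
lemma IsBest₁.V₁_lt (hB : B.Valid) (h : B.IsBest₁ σ₁ σ₂ u) {t : ℝ} (ht : 0 ≤ t)
    (hS : (1 - B.c₁) * B.surv₂ σ₂ t < B.z₂) : B.V₁ t σ₂ < u := by
  have h1 := V₁_eq hB σ₂ ht
  have h2 := h.drift₂_le hB ht
  have h3 : (1 - B.z₂) * (1 - σ₂.F t) = B.surv₂ σ₂ t - B.z₂ := by rw [surv₂]; ring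
  rw [h3] at h1
  have h4 : 0 ≤ B.surv₂ σ₂ t - B.z₂ := sub_nonneg.2 (le_surv₂ hB σ₂ t)
  have h5 : (1 - σ₂.q t) * B.w₁ + σ₂.q t ≤ 1 := by
    nlinarith [(σ₂.q_mem t).2, hB.w₁_lt_one]
  have h6 : (B.surv₂ σ₂ t - B.z₂) * ((1 - σ₂.q t) * B.w₁ + σ₂.q t) - B.c₁ * B.surv₂ σ₂ t < 0 := by
    nlinarith [mul_le_mul_of_nonneg_left h5 h4]
  have h7 := mul_neg_of_pos_of_neg hB.D_pos (mul_neg_of_pos_of_neg (Real.exp_pos (-B.r₁ * t)) h6)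
  rw [h1, mul_add]
  linarith

lemma IsBest₁.G_measure_eq_zero (h : B.IsBest₁ σ₁ σ₂ u) {A : Set ℝ}
    (hA : ∀ t ∈ A, B.V₁ t σ₂ < u) : σ₁.G.measure A = 0 := by
  have h1 := h.V_eq
  rw [ae_iff] at h1
  exact measure_mono_null (fun t ht => (hA t ht).ne) h1

/-- After a time from which the opponent never concedes, waiting forever is suboptimal. -/
lemma drift_limit_lt {K : StieltjesFunction ℝ} {p r l : ℝ} {S : ℝ → ℝ}
    (ho : IsOpponent K p r l S) (hT : 0 ≤ T) (hK : ∀ t, T ≤ t → K t = K T) {a b w x : ℝ} (hb : 0 < b)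
    (hlim : Tendsto (fun n : ℕ => a + b * drift K p r l S n) atTop (𝓝 w))
    (hx : a + b * drift K p r l S T ≤ x) : w < x := by
  have h1 := ho.drift_lt_of_eq hT (lt_add_one T) (hK _ (by linarith)).symm
  have h2 : w ≤ a + b * drift K p r l S (T + 1) := by
    refine le_of_tendsto hlim ?_
    obtain ⟨N, hN⟩ := exists_nat_gt (T + 1)
    filter_upwards [eventually_ge_atTop N] with n hn
    have h3 : T + 1 < (n : ℝ) := hN.trans_le (by exact_mod_cast hn)
    have h4 := ho.drift_lt_of_eq (by linarith : 0 ≤ T + 1) h3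
      (by rw [hK _ (by linarith : T ≤ T + 1), hK _ (by linarith : T ≤ (n : ℝ))])
    linarith [mul_lt_mul_of_pos_left h4 hb]
  linarith [mul_lt_mul_of_pos_left h1 hb]

lemma real_Ici_of_const {K : StieltjesFunction ℝ} (hK : K.IsSubCDF)
    (hc : ∀ t, T ≤ t → K t = K T) : K.measure.real (Ici 0) = K T := by
  refine tendsto_nhds_unique hK.tendsto_atTop (tendsto_const_nhds.congr' ?_)
  filter_upwards [eventually_ge_atTop T] with t ht using (hc t ht).symm

variable (B) in
/-- A pair of mutual best replies in which both players stop conceding at time `T`. -/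
structure IsEqUntil (σ₁ : Strategy₁) (σ₂ : Strategy₂) (u v T : ℝ) : Prop
    extends B.IsEq σ₁ σ₂ u v where
  nonneg : 0 ≤ T
  F₂_const : ∀ t, T ≤ t → σ₂.F t = σ₂.F T
  F₁_const : ∀ t, T ≤ t → σ₁.F t = σ₁.F T
  F₂_lt : ∀ s t, 0 ≤ s → s < t → t ≤ T → σ₂.F s < σ₂.F t
  F₁_lt : ∀ s t, 0 ≤ s → s < t → t ≤ T → σ₁.F s < σ₁.F t

lemma IsEq.exists_isEqUntil (h : B.IsEq σ₁ σ₂ u v) : ∃ T, B.IsEqUntil σ₁ σ₂ u v T := by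
  obtain ⟨T, hT, h1, h2, h3, h4⟩ := IsReply.exists_last_time (isOpponent₂ h.valid σ₂)
    (h.best₁.isReply h.valid) (isOpponent₁ h.valid σ₁) h.isReply₂ h.valid.z₂_mem.1
    (fun t _ => le_surv₂ h.valid σ₂ t)
  exact ⟨T, h, hT, h1, h2, h3, h4⟩

namespace IsEqUntil

variable (h : B.IsEqUntil σ₁ σ₂ u v T)
include h

/-- Otherwise player 2 holds out forever with positive probability, so holding out is optimal. But
player 1 never concedes after `T` and seeing challenges gains nothing in total, so conceding just
after `T` is strictly better. -/
lemma F₂_last : σ₂.F T = 1 := by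
  by_contra hne
  have hm : σ₂.F.measure.real (Ici 0) < 1 := by
    rw [real_Ici_of_const σ₂.isSubCDF h.F₂_const]
    exact lt_of_le_of_ne (σ₂.F_le_one T) hne
  have h1 := h.best₂.W_eq hm
  have h2 := tendsto_received₂ h.valid σ₁ σ₂.isBddMeas_q
  rw [h.seeGain_eq_zero measurableSet_Ici subset_rfl (h.best₂.isOptimalOn_Ici h.valid h1), h1] at h2
  simp only [add_zero] at h2
  have h3 := IsReply.drift_le (isOpponent₁ h.valid σ₁) h.isReply₂ h.nonneg
  rw [le_div_iff₀ h.valid.D_pos] at h3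
  exact lt_irrefl v (drift_limit_lt (isOpponent₁ h.valid σ₁) h.nonneg h.F₁_const h.valid.D_pos h2
    (by linarith))

lemma F₂_of_le {t : ℝ} (ht : T ≤ t) : σ₂.F t = 1 := (h.F₂_const t ht).trans h.F₂_last

lemma V₁_lt_of_le {t : ℝ} (ht : T ≤ t) : B.V₁ t σ₂ < u := by
  refine h.best₁.V₁_lt h.valid (h.nonneg.trans ht) ?_
  have h1 : B.surv₂ σ₂ t = B.z₂ := by rw [surv₂, h.F₂_of_le ht]; ring
  rw [h1]
  nlinarith [h.valid.z₂_mem.1, h.valid.c₁_pos]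

lemma G_const {t : ℝ} (ht : T ≤ t) : σ₁.G t = σ₁.G T :=
  (σ₁.G.eq_of_measure_Ioc_eq_zero ht (h.best₁.G_measure_eq_zero fun _ hs =>
    h.V₁_lt_of_le hs.1.le)).symm

lemma F₁_add_G_last : σ₁.F T + σ₁.G T = 1 := by
  by_contra hne
  have hm : σ₁.F.measure.real (Ici 0) + σ₁.G.measure.real (Ici 0) < 1 := by
    rw [real_Ici_of_const σ₁.isSubCDF_F h.F₁_const,
      real_Ici_of_const σ₁.isSubCDF_G fun t ht => h.G_const ht]
    exact lt_of_le_of_ne (σ₁.add_le_one T) hne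
  have h2 := tendsto_W₁ h.valid σ₂
  rw [h.best₁.W_eq hm] at h2
  exact lt_irrefl u (drift_limit_lt (isOpponent₂ h.valid σ₂) h.nonneg h.F₂_const h.valid.D_pos h2
    (h.best₁.drift₂_le h.valid h.nonneg))

lemma leftLim_F₂ {t : ℝ} (ht : 0 < t) : leftLim σ₂.F t = σ₂.F t :=
  IsReply.leftLim_eq (isOpponent₂ h.valid σ₂) (h.best₁.isReply h.valid) (isOpponent₁ h.valid σ₁)
    h.isReply₂ ht

lemma leftLim_F₁ {t : ℝ} (ht : 0 < t) : leftLim σ₁.F t = σ₁.F t :=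
  IsReply.leftLim_eq (isOpponent₁ h.valid σ₁) h.isReply₂ (isOpponent₂ h.valid σ₂)
    (h.best₁.isReply h.valid) ht

lemma F₂_lt_one {t : ℝ} (htT : t < T) : σ₂.F t < 1 := by
  rw [← h.F₂_last]
  exact (σ₂.F.mono (le_max_left t 0)).trans_lt (h.F₂_lt (max t 0) T (le_max_right _ _)
    (max_lt htT (lt_of_le_of_ne h.nonneg fun hT => by
      -- If `T = 0`, player 2 concedes at 0 with certainty. Player 1 then has neither a concession
      -- atom at 0, by the tie argument, nor a challenge atom, against a total mass of 1.
      subst hT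
      have h1 : σ₁.G.measure {0} = 0 := h.best₁.G_measure_eq_zero fun s hs => by
        rw [mem_singleton_iff.1 hs]; exact h.V₁_lt_of_le le_rfl
      have h2 := σ₁.G.leftLim_eq_of_measure_singleton h1
      rw [σ₁.isSubCDF_G.leftLim_zero] at h2
      have h3 := h.F₁_add_G_last
      have h4 := IsReply.leftLim_eq_of_atom (isOpponent₂ h.valid σ₂) (h.best₁.isReply h.valid)
        le_rfl (by rw [σ₂.isSubCDF.leftLim_zero, h.F₂_last]; norm_num)
      rw [σ₁.isSubCDF_F.leftLim_zero] at h4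
      linarith)) le_rfl)

/-- Justified challenges have a density, so an atom of unjustified ones would have positive net
weight and player 2 would gain by seeing it more often. -/
lemma G_singleton (t : ℝ) : σ₁.G.measure {t} = 0 := by
  rcases lt_or_ge t 0 with ht | ht
  · exact measure_mono_null (by simpa using ht) σ₁.isSubCDF_G.measure_Iio
  rcases lt_or_ge t T with htT | htT
  · have h1 := h.challengeWeight_le (measurableSet_singleton t)
      (singleton_subset_iff.2 ⟨ht, le_rfl⟩) (h.F₂_lt_one htT)
    rw [challengeWeight] at h1
    have h2 : ∫ s in ({t} : Set ℝ), B.γ₁ * Real.exp (-B.γ₁ * s) = 0 := by simp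
    rw [h2, mul_zero, sub_zero] at h1
    have h3 : 0 < (1 - B.z₁) * (1 - B.w₁ - B.k₂) :=
      mul_pos (by linarith [h.valid.z₁_mem.2]) (by linarith [h.valid.k₂_lt])
    have := σ₁.isSubCDF_G.isFiniteMeasure
    have h4 := nonpos_of_mul_nonpos_right h1 h3
    exact (measureReal_eq_zero_iff).1 (le_antisymm h4 measureReal_nonneg)
  · exact h.best₁.G_measure_eq_zero fun s hs => by
      rw [mem_singleton_iff.1 hs]; exact h.V₁_lt_of_le htT

lemma leftLim_G (t : ℝ) : leftLim σ₁.G t = σ₁.G t :=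
  σ₁.G.leftLim_eq_of_measure_singleton (h.G_singleton t)

lemma continuous_G : Continuous σ₁.G :=
  continuous_iff_continuousAt.2 fun t => σ₁.G.continuousAt_of_leftLim_eq (h.leftLim_G t)

lemma G_zero : σ₁.G 0 = 0 := by
  rw [← h.leftLim_G 0]; exact σ₁.isSubCDF_G.leftLim_zero

lemma pos : 0 < T := by
  refine lt_of_le_of_ne h.nonneg fun hT => ?_
  subst hT
  have h3 := h.F₁_add_G_last
  rw [h.G_zero] at h3
  have h4 := IsReply.leftLim_eq_of_atom (isOpponent₂ h.valid σ₂) (h.best₁.isReply h.valid)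
    le_rfl (by rw [σ₂.isSubCDF.leftLim_zero, h.F₂_last]; norm_num)
  rw [σ₁.isSubCDF_F.leftLim_zero] at h4
  linarith

lemma continuousOn_F₁ : ContinuousOn σ₁.F (Ici 0) := by
  intro t ht
  rcases (mem_Ici.1 ht).eq_or_lt with rfl | ht
  · exact σ₁.F.right_continuous 0
  · exact (σ₁.F.continuousAt_of_leftLim_eq (h.leftLim_F₁ ht)).continuousWithinAt

lemma continuousOn_F₂ : ContinuousOn σ₂.F (Ici 0) := by
  intro t ht
  rcases (mem_Ici.1 ht).eq_or_lt with rfl | ht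
  · exact σ₂.F.right_continuous 0
  · exact (σ₂.F.continuousAt_of_leftLim_eq (h.leftLim_F₂ ht)).continuousWithinAt

lemma drift₂_eq {t : ℝ} (ht : 0 ≤ t) (htT : t < T) :
    B.drift₂ σ₂ t = (u - (1 - B.a₂)) / B.D :=
  IsReply.drift_eq (isOpponent₂ h.valid σ₂) (h.best₁.isReply h.valid) h.F₁_lt ht htT

lemma surv₂_of_le {t : ℝ} (ht : T ≤ t) : B.surv₂ σ₂ t = B.z₂ := by
  rw [surv₂, h.F₂_of_le ht]; ring

/-- The survival probability decays at the rate `rate₂` and ends at `z₂`; the exponential is read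
backwards from `T`. -/
lemma surv₂_eq {t : ℝ} (ht : 0 ≤ t) :
    B.surv₂ σ₂ t = B.z₂ * Real.exp (B.rate₂ * max (T - t) 0) := by
  rcases le_total T t with htT | htT
  · rw [h.surv₂_of_le htT, max_eq_right (by linarith)]; simp
  have hz : 1 - B.z₂ ≠ 0 := by linarith [h.valid.z₂_mem.2]
  rw [max_eq_left (by linarith), ← h.surv₂_of_le le_rfl]
  refine eq_mul_exp_of_hasDerivAt (y := B.surv₂ σ₂) (x₀ := T)
    ((continuousOn_const.sub (h.continuousOn_F₂.const_mul (1 - B.z₂))).mono Icc_subset_Ici_self) ?_ ht htT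
  intro s hs hsT _
  have hF : ContinuousAt σ₂.F s := σ₂.F.continuousAt_of_leftLim_eq (h.leftLim_F₂ hs)
  have h1 := (isOpponent₂ h.valid σ₂).hasDerivAt (fun t ht htT => h.drift₂_eq ht htT)
    (fun t ht => h.leftLim_F₂ ht) hs hsT ((hF.const_mul _).const_sub 1)
  refine ((h1.const_mul (1 - B.z₂)).const_sub 1).congr_deriv ?_
  field_simp

/-! #### Challenges -/

lemma one_sub_mul_surv₂_lt {t : ℝ} (ht : 0 ≤ t) (htN : T - B.quietTime < t) :
    (1 - B.c₁) * B.surv₂ σ₂ t < B.z₂ := by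
  rw [h.surv₂_eq ht, ← exp_quietTime h.valid, mul_left_comm, ← Real.exp_add]
  have h1 : Real.exp (-B.rate₂ * B.quietTime + B.rate₂ * max (T - t) 0) < 1 := by
    rw [Real.exp_lt_one_iff]
    have h2 : max (T - t) 0 < B.quietTime := max_lt (by linarith) (quietTime_pos h.valid)
    nlinarith [rate₂_pos h.valid]
  nlinarith [h.valid.z₂_mem.1]

lemma G_const_of_quiet {t : ℝ} (ht : max (T - B.quietTime) 0 ≤ t) :
    σ₁.G t = σ₁.G (max (T - B.quietTime) 0) := by
  refine (σ₁.G.eq_of_measure_Ioc_eq_zero ht (h.best₁.G_measure_eq_zero fun s hs => ?_)).symm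
  have hs0 : 0 ≤ s := (le_max_right _ _).trans hs.1.le
  exact h.best₁.V₁_lt h.valid hs0
    (h.one_sub_mul_surv₂_lt hs0 ((le_max_left _ _).trans_lt hs.1))

/-- Conceding right after `s` already pays `u`, so the expected prize of a challenge at `s` is at
most its cost `c₁`. The resulting bound on `q s` increases with `s`, so its value at `t` serves on
all of `[0, t]`. -/
lemma q_le {s t : ℝ} (hs : s ∈ Icc 0 t) (ht : t < T - B.quietTime) :
    σ₂.q s ≤ (B.c₁ / (1 - Real.exp (-B.rate₂ * (T - t))) - B.w₁) / (1 - B.w₁) := by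
  have hB := h.valid
  have hl := rate₂_pos hB
  have hq := quietTime_pos hB
  have hsT : s < T := by linarith [hs.2]
  have h1 := h.best₁.V_le s hs.1
  rw [V₁_eq hB σ₂ hs.1, h.drift₂_eq hs.1 hsT, mul_add, mul_div_cancel₀ _ hB.D_pos.ne'] at h1
  have h2 : B.D * (Real.exp (-B.r₁ * s) * ((1 - B.z₂) * (1 - σ₂.F s) *
      ((1 - σ₂.q s) * B.w₁ + σ₂.q s) - B.c₁ * B.surv₂ σ₂ s)) ≤ 0 := by linarith
  have h3 := nonpos_of_mul_nonpos_right (nonpos_of_mul_nonpos_right h2 hB.D_pos) (Real.exp_pos _)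
  have h4 : (1 - B.z₂) * (1 - σ₂.F s) = B.surv₂ σ₂ s - B.z₂ := by rw [surv₂]; ring
  have h5 := h.surv₂_eq hs.1
  rw [max_eq_left (by linarith)] at h5
  have hSp : 0 < B.surv₂ σ₂ s := hB.z₂_mem.1.trans_le (le_surv₂ hB σ₂ s)
  have h6 : B.z₂ = B.surv₂ σ₂ s * Real.exp (-B.rate₂ * (T - s)) := by
    rw [h5, mul_assoc, ← Real.exp_add]; simp
  rw [h4] at h3
  have h7 : B.surv₂ σ₂ s * ((1 - Real.exp (-B.rate₂ * (T - s)))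
      * ((1 - σ₂.q s) * B.w₁ + σ₂.q s) - B.c₁) ≤ 0 := by
    have : B.surv₂ σ₂ s - B.z₂ = B.surv₂ σ₂ s * (1 - Real.exp (-B.rate₂ * (T - s))) := by
      rw [mul_sub, ← h6, mul_one]
    rw [this] at h3; linarith
  have h8 := nonpos_of_mul_nonpos_right h7 hSp
  have h9 : Real.exp (-B.rate₂ * (T - s)) ≤ Real.exp (-B.rate₂ * (T - t)) := by
    rw [Real.exp_le_exp]; nlinarith [hs.2]
  have h10 : Real.exp (-B.rate₂ * (T - t)) < 1 := by
    rw [Real.exp_lt_one_iff]; nlinarith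
  have hw := hB.w₁_lt_one
  have h11 : 0 ≤ (1 - σ₂.q s) * B.w₁ + σ₂.q s := by
    have := σ₂.q_mem s
    exact add_nonneg (mul_nonneg (by linarith [this.2]) hB.w₁_nonneg) this.1
  rw [le_div_iff₀ (by linarith), le_sub_iff_add_le, le_div_iff₀ (by linarith)]
  nlinarith [mul_le_mul_of_nonneg_right h9 h11]

/-- Before the quiet phase player 2's reputation is below `1 - c₁`, so `q_le` keeps `q` away from 1
on `[0, t]`. Player 2 is then indifferent about seeing, and zero net weight of `[0, t]` is the
asserted ratio. -/
lemma mul_G_eq_of_lt {t : ℝ} (ht : 0 ≤ t) (htN : t < T - B.quietTime) :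
    (1 - B.z₁) * σ₁.G t = B.z₁ * B.bluffRatio * (1 - Real.exp (-B.γ₁ * t)) := by
  have hB := h.valid
  have hq := quietTime_pos hB
  have hw := hB.w₁_lt_one
  set m := Real.exp (-B.rate₂ * (T - t)) with hm
  have hmc : m < 1 - B.c₁ := by
    rw [← exp_quietTime hB, hm, Real.exp_lt_exp]; nlinarith [rate₂_pos hB]
  have hc1 := hB.c₁_pos
  have hlt : (B.c₁ / (1 - m) - B.w₁) / (1 - B.w₁) < 1 := by
    rw [div_lt_one (by linarith), sub_lt_sub_iff_right, div_lt_one (by linarith)]; linarith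
  have h1 := h.challengeWeight_eq (measurableSet_Icc (a := 0) (b := t)) subset_rfl
    (h.F₂_lt_one (by linarith)) (sub_pos.2 hlt) (fun s hs => by
      have := h.q_le hs htN; rw [sub_sub_cancel]; exact this)
  rw [challengeWeight, σ₁.isSubCDF_G.real_Icc, integral_Icc_eq_integral_Ioc,
    ← intervalIntegral.integral_of_le ht, integral_mul_exp_neg] at h1
  simp only [mul_zero, Real.exp_zero] at h1
  have h2 : 0 < 1 - B.w₁ - B.k₂ := by linarith [hB.k₂_lt]
  rw [bluffRatio, mul_div_assoc', div_mul_eq_mul_div, eq_div_iff h2.ne']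
  linarith

/-! #### The reputation of player 1 -/

lemma surv₁_of_le {t : ℝ} (ht : T ≤ t) : B.surv₁ σ₁ t = B.z₁ * Real.exp (-B.γ₁ * t) := by
  have h1 := h.F₁_add_G_last
  rw [surv₁, h.F₁_const t ht, h.G_const ht]
  linear_combination (-(1 - B.z₁)) * h1

lemma hasDerivAt_F₁ {t : ℝ} (ht : 0 < t) (htT : t < T) :
    HasDerivAt σ₁.F (B.rate₁ * B.surv₁ σ₁ t / (1 - B.z₁)) t := by
  have hF : ContinuousAt σ₁.F t := σ₁.F.continuousAt_of_leftLim_eq (h.leftLim_F₁ ht)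
  refine (isOpponent₁ h.valid σ₁).hasDerivAt (u := (v - (1 - B.a₁)) / B.D)
    (fun s hs hsT => ?_) (fun s hs => h.leftLim_F₁ hs)
    ht htT ?_
  · exact IsReply.drift_eq (isOpponent₁ h.valid σ₁) h.isReply₂ h.F₂_lt hs hsT
  · have hG := h.continuous_G.continuousAt (x := t)
    have he : ContinuousAt (fun t : ℝ => Real.exp (-B.γ₁ * t)) t := by fun_prop
    exact (he.const_mul _).add (((hF.const_sub 1).sub hG).const_mul _)

/-- The difference of the two sides satisfies `y' = -rate₁ * y` away from the start of the quiet
phase, because the challenge terms cancel, and it vanishes at `T`. -/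
lemma surv₁_eq {t : ℝ} (ht : 0 ≤ t) :
    B.surv₁ σ₁ t = B.z₁ * Real.exp (-B.γ₁ * t) * B.invRep (max (T - t) 0) := by
  have hB := h.valid
  have hz : 1 - B.z₁ ≠ 0 := by linarith [hB.z₁_mem.2]
  rcases le_total T t with htT | htT
  · rw [h.surv₁_of_le htT, max_eq_right (by linarith), invRep_zero hB, mul_one]
  rw [max_eq_left (by linarith), ← sub_eq_zero]
  set y : ℝ → ℝ := fun t => B.surv₁ σ₁ t - B.z₁ * Real.exp (-B.γ₁ * t) * B.invRep (T - t) with hy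
  have hyT : y T = 0 := by
    simp only [hy]; rw [h.surv₁_of_le le_rfl, sub_self, invRep_zero hB]; ring
  have hexp : ∀ s : ℝ, HasDerivAt (fun t : ℝ => Real.exp (-B.γ₁ * t))
      (Real.exp (-B.γ₁ * s) * -B.γ₁) s := fun s => by
    have : HasDerivAt (fun t : ℝ => -B.γ₁ * t) (-B.γ₁) s := by
      simpa using (hasDerivAt_id s).const_mul (-B.γ₁)
    exact this.exp
  have hcont : ContinuousOn y (Icc 0 T) := by
    have h1 := h.continuousOn_F₁.mono (Icc_subset_Ici_self : Icc 0 T ⊆ Ici 0)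
    have h2 := h.continuous_G.continuousOn (s := Icc 0 T)
    have h3 := continuous_invRep (B := B)
    have h4 : ContinuousOn (fun t => B.z₁ * Real.exp (-B.γ₁ * t) * B.invRep (T - t)) (Icc 0 T) := by
      fun_prop
    have h5 : ContinuousOn (fun t => B.z₁ * Real.exp (-B.γ₁ * t)) (Icc 0 T) := by fun_prop
    exact (h5.add (((continuousOn_const.sub h1).sub h2).const_mul (1 - B.z₁))).sub h4
  have hder : ∀ s, 0 < s → s < T → s ≠ T - B.quietTime → HasDerivAt y (-B.rate₁ * y s) s := by
    intro s hs hsT hsN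
    have hF := (h.hasDerivAt_F₁ hs hsT).const_mul (1 - B.z₁)
    rw [mul_div_cancel₀ _ hz] at hF
    rcases lt_or_gt_of_ne hsN with hN | hN
    · have hG : HasDerivAt (fun t => (1 - B.z₁) * σ₁.G t)
          (B.z₁ * B.bluffRatio * (Real.exp (-B.γ₁ * s) * B.γ₁)) s := by
        refine ((((hexp s).const_sub 1).const_mul (B.z₁ * B.bluffRatio)).congr_deriv
          (by ring)).congr_of_eventuallyEq ?_
        filter_upwards [Ioo_mem_nhds hs hN] with x hx using h.mul_G_eq_of_lt hx.1.le hx.2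
      have hR : HasDerivAt (fun t => B.invRep (T - t))
          (-((B.rate₁ - B.γ₁) * B.invRep (T - s) + B.γ₁ * (1 + B.bluffRatio))) s :=
        (hasDerivAt_invRep_of_gt (by linarith : B.quietTime < T - s)).comp_const_sub T s
      have h1 := ((((hexp s).const_mul B.z₁).add_const (1 - B.z₁)).sub (hF.add hG)).sub
        (((hexp s).const_mul B.z₁).mul hR)
      refine (h1.congr_of_eventuallyEq (Eventually.of_forall fun x => ?_)).congr_deriv ?_
      · simp only [hy, surv₁, Pi.sub_apply, Pi.add_apply, Pi.mul_apply]; ring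
      · simp only [hy]; ring
    · have hG : HasDerivAt (fun t => (1 - B.z₁) * σ₁.G t) 0 s := by
        refine (hasDerivAt_const s ((1 - B.z₁) * σ₁.G (max (T - B.quietTime) 0))).congr_of_eventuallyEq
          ?_
        filter_upwards [Ioi_mem_nhds hN, Ioi_mem_nhds hs] with x hx hx0
        rw [h.G_const_of_quiet (max_le (le_of_lt hx) (le_of_lt hx0))]
      have hR : HasDerivAt (fun t => B.invRep (T - t))
          (-((B.rate₁ - B.γ₁) * B.invRep (T - s) + B.γ₁)) s :=
        (hasDerivAt_invRep_of_lt (by linarith : T - s < B.quietTime)).comp_const_sub T s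
      have h1 := ((((hexp s).const_mul B.z₁).add_const (1 - B.z₁)).sub (hF.add hG)).sub
        (((hexp s).const_mul B.z₁).mul hR)
      refine (h1.congr_of_eventuallyEq (Eventually.of_forall fun x => ?_)).congr_deriv ?_
      · simp only [hy, surv₁, Pi.sub_apply, Pi.add_apply, Pi.mul_apply]; ring
      · simp only [hy]; ring
  have := eq_mul_exp_of_hasDerivAt hcont hder ht htT
  rw [hyT, zero_mul] at this
  exact this

/-- The two players do not both have an atom at 0, and challenges have none, so one of the survival
probabilities right after 0 equals 1 while the other is at most 1. -/
lemma isDuration : B.IsDuration T := by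
  refine ⟨h.pos, ?_⟩
  have hB := h.valid
  have h1 := h.surv₁_eq le_rfl
  have h2 := h.surv₂_eq le_rfl
  simp only [mul_zero, Real.exp_zero, mul_one, sub_zero, max_eq_left h.pos.le] at h1 h2
  rw [← h1, ← h2]
  have h3 : B.surv₁ σ₁ 0 = 1 - (1 - B.z₁) * σ₁.F 0 := by
    rw [surv₁, h.G_zero]; simp; ring
  have h4 : B.surv₂ σ₂ 0 = 1 - (1 - B.z₂) * σ₂.F 0 := rfl
  have h5 := (isOpponent₁ hB σ₁).S_le 0 le_rfl
  have h6 := (isOpponent₂ hB σ₂).S_le 0 le_rfl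
  by_cases h7 : leftLim σ₂.F 0 = σ₂.F 0
  · rw [σ₂.isSubCDF.leftLim_zero] at h7
    rw [← h7, mul_zero, sub_zero] at h4
    rw [h4, max_eq_right h5]
  · have h8 := IsReply.leftLim_eq_of_atom (isOpponent₂ hB σ₂) (h.best₁.isReply hB) le_rfl h7
    rw [σ₁.isSubCDF_F.leftLim_zero] at h8
    rw [← h8, mul_zero, sub_zero] at h3
    rw [h3, max_eq_left h6]

/-- Conceding right after 0 is worth `u`, and the drift at 0 is just player 2's immediate
concession, of total probability `1 - surv₂ 0`. -/
lemma payoff_eq : u = 1 - B.a₂ + B.D * (1 - B.z₂ * Real.exp (B.rate₂ * T)) := by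
  have h1 := h.drift₂_eq le_rfl h.pos
  have h2 := h.surv₂_eq le_rfl
  rw [sub_zero, max_eq_left h.pos.le] at h2
  rw [← h2, drift₂, drift, intervalIntegral.integral_same, Icc_self, integral_singleton,
    σ₂.F.real_singleton, σ₂.isSubCDF.leftLim_zero] at *
  rw [eq_div_iff h.valid.D_pos.ne'] at h1
  simp only [mul_zero, Real.exp_zero, smul_eq_mul, mul_one, sub_zero] at h1
  rw [surv₂]; linarith

lemma reputation₂_eq {t : ℝ} (ht : 0 < t) :
    B.reputation₂ σ₂ t = Real.exp (-B.rate₂ * max (T - t) 0) := by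
  have h1 := h.surv₂_eq ht.le
  have h2 : B.z₂ + (1 - B.z₂) * (1 - σ₂.F t) = B.surv₂ σ₂ t := by rw [surv₂]; ring
  rw [reputation₂, h.leftLim_F₂ ht, h2, h1, neg_mul, Real.exp_neg, ← div_div,
    div_self h.valid.z₂_mem.1.ne', one_div]

lemma reputation₁_eq {t : ℝ} (ht : 0 < t) :
    B.reputation₁ σ₁ t = (B.invRep (max (T - t) 0))⁻¹ := by
  have h1 := h.surv₁_eq ht.le
  rw [surv₁] at h1
  rw [reputation₁, h.leftLim_F₁ ht, h.leftLim_G t, h1, ← div_div,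
    div_self (mul_pos h.valid.z₁_mem.1 (Real.exp_pos _)).ne', one_div]

end IsEqUntil

/-- Every equilibrium has the same duration, reputations and payoff. -/
theorem IsEquilibrium.unique (hB : B.Valid) (h : B.IsEquilibrium σ₁ σ₂) (hT : B.IsDuration T) :
    B.u₁ σ₁ σ₂ = 1 - B.a₂ + B.D * (1 - B.z₂ * Real.exp (B.rate₂ * T)) ∧
    ∀ t, 0 < t → B.reputation₁ σ₁ t = (B.invRep (max (T - t) 0))⁻¹ ∧
      B.reputation₂ σ₂ t = Real.exp (-B.rate₂ * max (T - t) 0) := by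
  obtain ⟨T', hT'⟩ := IsEq.exists_isEqUntil ⟨hB, h.isBest₁ hB, h.isBest₂ hB⟩
  obtain rfl := hT.unique hB hT'.isDuration
  exact ⟨hT'.payoff_eq, fun t ht => ⟨hT'.reputation₁_eq ht, hT'.reputation₂_eq ht⟩⟩

end BargainingGame

/-! ### Measures with an atom at `0` and a density on `[0, T]` -/

/-- The measure on `[0, T]` with mass `p` at `0` and density `φ`. -/
def atomDensity (p T : ℝ) (φ : C(ℝ, ℝ)) : Measure ℝ :=
  ENNReal.ofReal p • Measure.dirac 0
    + (volume.restrict (Icc 0 T)).withDensity fun s => ENNReal.ofReal (φ s)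

lemma ContinuousMap.integrableOn_Icc' (φ : C(ℝ, ℝ)) (T : ℝ) : IntegrableOn φ (Icc 0 T) :=
  φ.continuous.integrableOn_Icc

instance isFiniteMeasure_atomDensity (p T : ℝ) (φ : C(ℝ, ℝ)) :
    IsFiniteMeasure (atomDensity p T φ) := by
  have h1 := isFiniteMeasure_withDensity_ofReal (φ.integrableOn_Icc' T).hasFiniteIntegral
  have h2 : IsFiniteMeasure (ENNReal.ofReal p • Measure.dirac (0 : ℝ)) :=
    Measure.smul_finite _ ENNReal.ofReal_ne_top
  unfold atomDensity
  infer_instance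

section AtomDensity

variable {p T : ℝ} {φ : C(ℝ, ℝ)}

lemma atomDensity_of_disjoint {A : Set ℝ} (hA : MeasurableSet A) (h : ∀ t ∈ A, t ∉ Icc 0 T)
    (hT : 0 ≤ T) : atomDensity p T φ A = 0 := by
  have h0 : (0 : ℝ) ∉ A := fun h' => h 0 h' ⟨le_rfl, hT⟩
  rw [atomDensity, Measure.add_apply, Measure.smul_apply, Measure.dirac_apply' _ hA,
    indicator_of_notMem h0, withDensity_apply _ hA, Measure.restrict_restrict hA,
    (disjoint_iff_inter_eq_empty.1 (disjoint_left.2 h))]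
  simp

lemma ae_mem_Icc_atomDensity (hT : 0 ≤ T) : ∀ᵐ t ∂atomDensity p T φ, t ∈ Icc 0 T := by
  rw [ae_iff]
  exact atomDensity_of_disjoint measurableSet_Icc.compl (fun t ht => ht) hT

lemma atomDensity_singleton (t : ℝ) (h : t = 0 → p ≤ 0) : atomDensity p T φ {t} = 0 := by
  rw [atomDensity, Measure.add_apply, Measure.smul_apply,
    Measure.dirac_apply' _ (measurableSet_singleton t),
    withDensity_apply _ (measurableSet_singleton t),
    Measure.restrict_restrict (measurableSet_singleton t),
    setLIntegral_measure_zero _ _ (measure_mono_null inter_subset_left (by simp)), add_zero]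
  by_cases h0 : t = 0
  · rw [ENNReal.ofReal_of_nonpos (h h0)]; simp
  · simp [h0, eq_comm]

lemma setIntegral_atomDensity (hp : 0 ≤ p) (hφ : ∀ s ∈ Icc 0 T, 0 ≤ φ s) {f : ℝ → ℝ}
    {A : Set ℝ} (hA : MeasurableSet A) (hf : IntegrableOn f A (atomDensity p T φ)) :
    ∫ s in A, f s ∂atomDensity p T φ
      = p * A.indicator f 0 + ∫ s in A ∩ Icc 0 T, f s * φ s := by
  have h1 : (atomDensity p T φ).restrict A = (ENNReal.ofReal p • Measure.dirac 0).restrict A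
      + ((volume.restrict (Icc 0 T)).withDensity fun s => ENNReal.ofReal (φ s)).restrict A := by
    rw [atomDensity, Measure.restrict_add]
  have hd : ∫ s in A, f s ∂Measure.dirac (0 : ℝ) = A.indicator f 0 := by
    classical
    rw [setIntegral_dirac]
    by_cases h0 : (0 : ℝ) ∈ A <;> simp [h0]
  rw [IntegrableOn, h1, integrable_add_measure] at hf
  rw [h1, integral_add_measure hf.1 hf.2, Measure.restrict_smul, integral_smul_measure,
    ENNReal.toReal_ofReal hp, smul_eq_mul, hd]
  congr 1
  rw [setIntegral_withDensity_eq_setIntegral_toReal_smul (by fun_prop)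
    (ae_of_all _ fun _ => ENNReal.ofReal_lt_top) _ hA, Measure.restrict_restrict hA]
  refine setIntegral_congr_fun (hA.inter measurableSet_Icc) fun s hs => ?_
  simp only [smul_eq_mul]
  rw [ENNReal.toReal_ofReal (hφ s hs.2)]; ring

lemma distrib_atomDensity_neg (hT : 0 ≤ T) {t : ℝ} (ht : t < 0) :
    (atomDensity p T φ).distrib t = 0 := by
  rw [Measure.distrib_apply, Measure.real, atomDensity_of_disjoint measurableSet_Iic _ hT]
  · simp
  · exact fun s hs hs' => absurd (hs'.1.trans hs) (not_le.2 ht)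

lemma distrib_atomDensity (hp : 0 ≤ p) (hT : 0 ≤ T) (hφ : ∀ s ∈ Icc 0 T, 0 ≤ φ s) {t : ℝ}
    (ht : 0 ≤ t) : (atomDensity p T φ).distrib t = p + ∫ s in (0)..(min t T), φ s := by
  have h1 := setIntegral_atomDensity hp hφ (f := fun _ => 1) (A := Iic t) measurableSet_Iic
    (integrable_const _)
  rw [setIntegral_const] at h1
  rw [Measure.distrib_apply, intervalIntegral.integral_of_le (le_min ht hT),
    ← integral_Icc_eq_integral_Ioc]
  have h2 : Iic t ∩ Icc 0 T = Icc 0 (min t T) := by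
    ext s; simp only [mem_inter_iff, mem_Iic, mem_Icc, le_min_iff]; tauto
  rw [h2, indicator_of_mem (mem_Iic.2 ht)] at h1
  simpa using h1

lemma leftLim_distrib_atomDensity (t : ℝ) (h : t = 0 → p ≤ 0) :
    leftLim (atomDensity p T φ).distrib t = (atomDensity p T φ).distrib t := by
  refine StieltjesFunction.leftLim_eq_of_measure_singleton _ ?_
  rw [Measure.measure_distrib]
  exact atomDensity_singleton t h

/-- Waiting is costless against an opponent who concedes at the hazard rate `l`. -/
lemma drift_atomDensity {p' r l : ℝ} {S : ℝ → ℝ} (hp : 0 ≤ p)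
    (hφ : ∀ s ∈ Icc 0 T, 0 ≤ φ s)
    (ho : IsOpponent (atomDensity p T φ).distrib p' r l S)
    (hS : ∀ s ∈ Icc 0 T, p' * φ s = l * S s) {t : ℝ} (ht : t ∈ Icc 0 T) :
    drift (atomDensity p T φ).distrib p' r l S t = p' * p := by
  have hi := (IsBddMeas.exp ho.r_pos.le).integrableOn ho.sub (measurableSet_Icc (a := 0) (b := t))
    Icc_subset_Ici_self
  rw [drift]
  rw [Measure.measure_distrib] at hi ⊢
  rw [setIntegral_atomDensity hp hφ measurableSet_Icc hi, indicator_of_mem (show (0 : ℝ) ∈ Icc 0 t from ⟨le_rfl, ht.1⟩),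
    inter_eq_left.2 (Icc_subset_Icc_right ht.2), integral_Icc_eq_integral_Ioc,
    ← intervalIntegral.integral_of_le ht.1, mul_add, ← intervalIntegral.integral_const_mul,
    ← intervalIntegral.integral_const_mul]
  have : ∫ s in (0)..t, p' * (Real.exp (-r * s) * φ s)
      = ∫ s in (0)..t, l * (Real.exp (-r * s) * S s) := by
    refine intervalIntegral.integral_congr fun s hs => ?_
    rw [uIcc_of_le ht.1] at hs
    have := hS s ⟨hs.1, hs.2.trans ht.2⟩
    linear_combination Real.exp (-r * s) * this
  rw [this]; simp

lemma drift_atomDensity_le {p' r l : ℝ} {S : ℝ → ℝ} (hp : 0 ≤ p) (hT : 0 ≤ T)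
    (hφ : ∀ s ∈ Icc 0 T, 0 ≤ φ s)
    (ho : IsOpponent (atomDensity p T φ).distrib p' r l S)
    (hS : ∀ s ∈ Icc 0 T, p' * φ s = l * S s) {t : ℝ} (ht : 0 ≤ t) :
    drift (atomDensity p T φ).distrib p' r l S t ≤ p' * p := by
  rcases le_or_gt t T with htT | htT
  · exact (drift_atomDensity hp hφ ho hS ⟨ht, htT⟩).le
  · rw [← drift_atomDensity hp hφ ho hS ⟨hT, le_rfl⟩]
    refine (ho.drift_lt_of_eq hT htT ?_).le
    rw [distrib_atomDensity hp hT hφ hT, distrib_atomDensity hp hT hφ ht, min_self,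
      min_eq_right htT.le]

end AtomDensity

namespace BargainingGame

variable {B : BargainingGame} {T : ℝ}

/-! ### The equilibrium strategies -/

variable (B) in
/-- Player 2's concession density. -/
def density₂ (T : ℝ) : C(ℝ, ℝ) :=
  ⟨fun s => B.rate₂ * (B.z₂ * Real.exp (B.rate₂ * (T - s))) / (1 - B.z₂), by fun_prop⟩

variable (B) in
/-- Player 2's probability of an immediate concession. -/
def atom₂ (T : ℝ) : ℝ := (1 - B.z₂ * Real.exp (B.rate₂ * T)) / (1 - B.z₂)

variable (B) in
/-- Player 1's concession density. -/
def density₁ (T : ℝ) : C(ℝ, ℝ) :=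
  ⟨fun s => B.rate₁ * (B.z₁ * Real.exp (-B.γ₁ * s) * B.invRep (T - s)) / (1 - B.z₁), by
    have := continuous_invRep (B := B)
    fun_prop⟩

variable (B) in
/-- Player 1's probability of an immediate concession. -/
def atom₁ (T : ℝ) : ℝ := (1 - B.z₁ * B.invRep T) / (1 - B.z₁)

variable (B) in
/-- Density of the challenges of an unjustified player 1. -/
def challengeDensity : C(ℝ, ℝ) :=
  ⟨fun s => B.z₁ * B.bluffRatio * (B.γ₁ * Real.exp (-B.γ₁ * s)) / (1 - B.z₁), by fun_prop⟩

variable (B) in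
/-- Player 2's probability of yielding to a challenge. -/
def yieldProb (T t : ℝ) : ℝ :=
  -- This value makes the expected prize of a challenge equal to its cost, so that player 1 is
  -- indifferent between challenging and conceding. It equals 1 at the start of the quiet phase.
  if t < T - B.quietTime then
    (B.c₁ / (1 - Real.exp (-B.rate₂ * (T - t))) - B.w₁) / (1 - B.w₁)
  else 1

lemma measurable_yieldProb : Measurable (B.yieldProb T) := by
  unfold yieldProb
  exact Measurable.ite measurableSet_Iio (by fun_prop) measurable_const

lemma yieldProb_mem (hB : B.Valid) (t : ℝ) : B.yieldProb T t ∈ Icc (0 : ℝ) 1 := by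
  rw [yieldProb]
  split_ifs with ht
  · have hw := hB.w₁_lt_one
    have hc := hB.c₁_pos
    have hm : Real.exp (-B.rate₂ * (T - t)) < 1 - B.c₁ := by
      rw [← exp_quietTime hB, Real.exp_lt_exp]; nlinarith [rate₂_pos hB]
    have hm0 := Real.exp_pos (-B.rate₂ * (T - t))
    constructor
    · refine div_nonneg ?_ (by linarith)
      rw [sub_nonneg, le_div_iff₀ (by linarith)]
      nlinarith [hB.w₁_nonneg, hB.w₁_lt]
    · rw [div_le_one (by linarith), sub_le_sub_iff_right, div_le_one (by linarith)]; linarith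
  · exact ⟨zero_le_one, le_rfl⟩

lemma atom₁_nonneg (hB : B.Valid) (hT : B.IsDuration T) : 0 ≤ B.atom₁ T :=
  div_nonneg (sub_nonneg.2 ((le_max_left _ _).trans hT.2.le)) (by linarith [hB.z₁_mem.2])

lemma atom₂_nonneg (hB : B.Valid) (hT : B.IsDuration T) : 0 ≤ B.atom₂ T :=
  div_nonneg (sub_nonneg.2 ((le_max_right _ _).trans hT.2.le)) (by linarith [hB.z₂_mem.2])

lemma atom_eq_zero (hT : B.IsDuration T) : B.atom₁ T = 0 ∨ B.atom₂ T = 0 := by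
  rcases max_choice (B.z₁ * B.invRep T) (B.z₂ * Real.exp (B.rate₂ * T)) with h | h
  · left; rw [atom₁, ← h, hT.2]; simp
  · right; rw [atom₂, ← h, hT.2]; simp

lemma density₁_nonneg (hB : B.Valid) : ∀ s ∈ Icc 0 T, 0 ≤ B.density₁ T s := fun s hs =>
  div_nonneg (mul_nonneg (rate₁_pos hB).le (mul_nonneg (mul_nonneg hB.z₁_mem.1.le
    (Real.exp_pos _).le) (zero_le_one.trans (one_le_invRep hB (by linarith [hs.2])))))
    (by linarith [hB.z₁_mem.2])

lemma density₂_nonneg (hB : B.Valid) : ∀ s ∈ Icc 0 T, 0 ≤ B.density₂ T s := fun _ _ =>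
  div_nonneg (mul_nonneg (rate₂_pos hB).le (mul_nonneg hB.z₂_mem.1.le (Real.exp_pos _).le))
    (by linarith [hB.z₂_mem.2])

lemma challengeDensity_nonneg (hB : B.Valid) (s : ℝ) : 0 ≤ B.challengeDensity s :=
  div_nonneg (mul_nonneg (mul_nonneg hB.z₁_mem.1.le (bluffRatio_pos hB).le)
    (mul_nonneg hB.γ₁_nonneg (Real.exp_pos _).le)) (by linarith [hB.z₁_mem.2])

variable (B) in
/-- Distribution of player 2's concessions. -/
def eqF₂ (T : ℝ) : StieltjesFunction ℝ := (atomDensity (B.atom₂ T) T (B.density₂ T)).distrib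

variable (B) in
/-- Distribution of player 1's concessions. -/
def eqF₁ (T : ℝ) : StieltjesFunction ℝ := (atomDensity (B.atom₁ T) T (B.density₁ T)).distrib

variable (B) in
/-- Distribution of player 1's challenges. -/
def eqG (T : ℝ) : StieltjesFunction ℝ :=
  (atomDensity 0 (max (T - B.quietTime) 0) B.challengeDensity).distrib

lemma eqF₂_eq (hB : B.Valid) (hT : B.IsDuration T) {t : ℝ} (ht : 0 ≤ t) :
    1 - (1 - B.z₂) * B.eqF₂ T t = B.z₂ * Real.exp (B.rate₂ * max (T - t) 0) := by
  have hz : 1 - B.z₂ ≠ 0 := by linarith [hB.z₂_mem.2]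
  rw [eqF₂, distrib_atomDensity (atom₂_nonneg hB hT) hT.1.le (density₂_nonneg hB) ht]
  have h1 : ∀ x ∈ uIcc 0 (min t T), HasDerivAt
      (fun s => -(B.z₂ * Real.exp (B.rate₂ * (T - s))) / (1 - B.z₂)) (B.density₂ T x) x := by
    intro x _
    have h2 : HasDerivAt (fun s : ℝ => B.rate₂ * (T - s)) (B.rate₂ * -1) x :=
      ((hasDerivAt_id x).const_sub T).const_mul _
    exact ((h2.exp.const_mul B.z₂).neg.div_const _).congr_deriv (by
      simp only [density₂, ContinuousMap.coe_mk]; ring)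
  rw [intervalIntegral.integral_eq_sub_of_hasDerivAt h1
    ((B.density₂ T).continuous.intervalIntegrable _ _)]
  have h3 : T - min t T = max (T - t) 0 := by
    rcases le_total t T with h | h
    · rw [min_eq_left h, max_eq_left (by linarith)]
    · rw [min_eq_right h, max_eq_right (by linarith), sub_self]
  rw [← h3, atom₂, sub_zero]
  field_simp
  ring

lemma mul_eqG_eq (hB : B.Valid) {t : ℝ} (ht : 0 ≤ t) : (1 - B.z₁) * B.eqG T t
    = B.z₁ * B.bluffRatio * (1 - Real.exp (-B.γ₁ * min t (max (T - B.quietTime) 0))) := by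
  have hz : 1 - B.z₁ ≠ 0 := by linarith [hB.z₁_mem.2]
  rw [eqG, distrib_atomDensity le_rfl (le_max_right _ _)
    (fun s _ => challengeDensity_nonneg hB s) ht]
  simp only [challengeDensity, ContinuousMap.coe_mk]
  rw [intervalIntegral.integral_div, intervalIntegral.integral_const_mul, integral_mul_exp_neg]
  field_simp
  simp

/-- Checked by differentiation instead of integrating the concession density: the sum `y` of the
three masses is continuous, has zero derivative off the kink, and equals `1 - z₁` at 0 by the choice
of `atom₁`. -/
lemma eqF₁_add_eqG (hB : B.Valid) (hT : B.IsDuration T) {t : ℝ} (ht : t ∈ Icc 0 T) :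
    (1 - B.z₁) * (1 - B.eqF₁ T t - B.eqG T t)
      = B.z₁ * Real.exp (-B.γ₁ * t) * (B.invRep (T - t) - 1) := by
  have hz : 1 - B.z₁ ≠ 0 := by linarith [hB.z₁_mem.2]
  set N := max (T - B.quietTime) 0 with hN
  have hF : ∀ s ∈ Icc 0 T, (1 - B.z₁) * B.eqF₁ T s = (1 - B.z₁ * B.invRep T)
      + ∫ x in (0)..s, B.rate₁ * (B.z₁ * Real.exp (-B.γ₁ * x) * B.invRep (T - x)) := by
    intro s hs
    rw [eqF₁, distrib_atomDensity (atom₁_nonneg hB hT) hT.1.le (density₁_nonneg hB) hs.1,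
      min_eq_left hs.2]
    simp only [density₁, ContinuousMap.coe_mk]
    rw [intervalIntegral.integral_div, atom₁]
    field_simp
  set y : ℝ → ℝ := fun s => B.z₁ * Real.exp (-B.γ₁ * s) * (B.invRep (T - s) - 1)
    + ((1 - B.z₁ * B.invRep T)
      + ∫ x in (0)..s, B.rate₁ * (B.z₁ * Real.exp (-B.γ₁ * x) * B.invRep (T - x)))
    + B.z₁ * B.bluffRatio * (1 - Real.exp (-B.γ₁ * min s N)) with hy
  have hcR := continuous_invRep (B := B)
  have hcφ : Continuous fun x => B.rate₁ * (B.z₁ * Real.exp (-B.γ₁ * x) * B.invRep (T - x)) := by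
    fun_prop
  have hint : ∀ s, HasDerivAt
      (fun s => ∫ x in (0)..s, B.rate₁ * (B.z₁ * Real.exp (-B.γ₁ * x) * B.invRep (T - x)))
      (B.rate₁ * (B.z₁ * Real.exp (-B.γ₁ * s) * B.invRep (T - s))) s := fun s =>
    intervalIntegral.integral_hasDerivAt_right (hcφ.intervalIntegrable _ _)
      hcφ.aestronglyMeasurable.stronglyMeasurableAtFilter hcφ.continuousAt
  have hcont : ContinuousOn y (Icc 0 T) := by
    have h1 : Continuous fun s => ∫ x in (0)..s,
        B.rate₁ * (B.z₁ * Real.exp (-B.γ₁ * x) * B.invRep (T - x)) :=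
      continuous_iff_continuousAt.2 fun s => (hint s).continuousAt
    have h2 : Continuous fun s => B.z₁ * Real.exp (-B.γ₁ * s) * (B.invRep (T - s) - 1) := by
      fun_prop
    have h3 : Continuous fun s => B.z₁ * B.bluffRatio * (1 - Real.exp (-B.γ₁ * min s N)) := by
      fun_prop
    exact ((h2.add (continuous_const.add h1)).add h3).continuousOn
  have hexp : ∀ s : ℝ, HasDerivAt (fun t : ℝ => Real.exp (-B.γ₁ * t))
      (Real.exp (-B.γ₁ * s) * -B.γ₁) s := fun s => by
    have : HasDerivAt (fun t : ℝ => -B.γ₁ * t) (-B.γ₁) s := by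
      simpa using (hasDerivAt_id s).const_mul (-B.γ₁)
    exact this.exp
  have hder : ∀ s, 0 < s → s < T → s ≠ T - B.quietTime → HasDerivAt y (-0 * y s) s := by
    intro s hs hsT hsN
    rcases lt_or_gt_of_ne hsN with h | h
    · have hG : HasDerivAt (fun s => B.z₁ * B.bluffRatio * (1 - Real.exp (-B.γ₁ * min s N)))
          (B.z₁ * B.bluffRatio * (Real.exp (-B.γ₁ * s) * B.γ₁)) s := by
        refine ((((hexp s).const_sub 1).const_mul (B.z₁ * B.bluffRatio)).congr_deriv
          (by ring)).congr_of_eventuallyEq ?_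
        filter_upwards [Iio_mem_nhds h] with x hx
        rw [min_eq_left ((le_of_lt (mem_Iio.1 hx)).trans (le_max_left _ _))]
      have hR := ((hasDerivAt_invRep_of_gt (B := B)
        (by linarith : B.quietTime < T - s)).comp_const_sub T s).sub_const 1
      exact ((((hexp s).const_mul B.z₁).mul hR).add ((hint s).const_add _)).add hG
        |>.congr_deriv (by ring)
    · have hG : HasDerivAt (fun s => B.z₁ * B.bluffRatio * (1 - Real.exp (-B.γ₁ * min s N)))
          0 s := by
        refine (hasDerivAt_const s (B.z₁ * B.bluffRatio
          * (1 - Real.exp (-B.γ₁ * N)))).congr_of_eventuallyEq ?_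
        filter_upwards [Ioi_mem_nhds h, Ioi_mem_nhds hs] with x hx hx0
        rw [min_eq_right (max_le (le_of_lt hx) (le_of_lt hx0))]
      have hR := ((hasDerivAt_invRep_of_lt (B := B)
        (by linarith : T - s < B.quietTime)).comp_const_sub T s).sub_const 1
      exact ((((hexp s).const_mul B.z₁).mul hR).add ((hint s).const_add _)).add hG
        |>.congr_deriv (by ring)
  have h0 := eq_mul_exp_of_hasDerivAt hcont hder le_rfl hT.1.le
  have h1 := eq_mul_exp_of_hasDerivAt hcont hder ht.1 ht.2
  simp only [zero_mul, Real.exp_zero, mul_one] at h0 h1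
  have h2 : y 0 = 1 - B.z₁ := by
    simp only [hy]
    rw [min_eq_left (le_max_right _ _), intervalIntegral.integral_same]
    simp only [mul_zero, Real.exp_zero, sub_zero]; ring
  have h3 : y t = 1 - B.z₁ := by rw [h1, ← h0, h2]
  simp only [hy] at h3
  rw [← hF t ht, ← mul_eqG_eq hB ht.1] at h3
  linear_combination -h3

end BargainingGame

/-! ### Verification of the equilibrium strategies -/

namespace BargainingGame

variable {B : BargainingGame} {T : ℝ}

lemma distrib_atomDensity_eq_last {p T : ℝ} {φ : C(ℝ, ℝ)} (hp : 0 ≤ p) (hT : 0 ≤ T)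
    (hφ : ∀ s ∈ Icc 0 T, 0 ≤ φ s) {t : ℝ} (ht : T ≤ t) :
    (atomDensity p T φ).distrib t = (atomDensity p T φ).distrib T := by
  rw [distrib_atomDensity hp hT hφ hT, distrib_atomDensity hp hT hφ (hT.trans ht), min_self,
    min_eq_right ht]

lemma eqF₁_of_le (hB : B.Valid) (hT : B.IsDuration T) {t : ℝ} (ht : T ≤ t) :
    B.eqF₁ T t = B.eqF₁ T T :=
  distrib_atomDensity_eq_last (atom₁_nonneg hB hT) hT.1.le (density₁_nonneg hB) ht

lemma quietStart_le (hB : B.Valid) (hT : B.IsDuration T) : max (T - B.quietTime) 0 ≤ T :=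
  max_le (by linarith [quietTime_pos hB]) hT.1.le

lemma eqG_of_le (hB : B.Valid) (hT : B.IsDuration T) {t : ℝ} (ht : T ≤ t) :
    B.eqG T t = B.eqG T T := by
  have h1 := quietStart_le hB hT
  rw [eqG, distrib_atomDensity_eq_last le_rfl (le_max_right _ _)
    (fun s _ => challengeDensity_nonneg hB s) (h1.trans ht),
    distrib_atomDensity_eq_last le_rfl (le_max_right _ _)
    (fun s _ => challengeDensity_nonneg hB s) h1]

lemma eqF₁_add_eqG_last (hB : B.Valid) (hT : B.IsDuration T) {t : ℝ} (ht : T ≤ t) :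
    B.eqF₁ T t + B.eqG T t = 1 := by
  have h1 := eqF₁_add_eqG hB hT ⟨hT.1.le, le_rfl⟩
  rw [sub_self, invRep_zero hB, sub_self, mul_zero] at h1
  rw [eqF₁_of_le hB hT ht, eqG_of_le hB hT ht]
  have := (mul_eq_zero.1 h1).resolve_left (by linarith [hB.z₁_mem.2])
  linarith

variable (B) in
/-- Player 1's equilibrium strategy. -/
def eqStrategy₁ (hB : B.Valid) (hT : B.IsDuration T) : Strategy₁ where
  F := B.eqF₁ T
  G := B.eqG T
  F_neg _ := distrib_atomDensity_neg hT.1.le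
  G_neg _ := distrib_atomDensity_neg (le_max_right _ _)
  add_le_one t := by
    rcases le_or_gt T t with h | h
    · exact (eqF₁_add_eqG_last hB hT h).le
    rcases lt_or_ge t 0 with h0 | h0
    · rw [eqF₁, eqG, distrib_atomDensity_neg hT.1.le h0,
        distrib_atomDensity_neg (le_max_right _ _) h0]; norm_num
    · have h1 := eqF₁_add_eqG hB hT ⟨h0, h.le⟩
      have h2 : 0 ≤ B.z₁ * Real.exp (-B.γ₁ * t) * (B.invRep (T - t) - 1) :=
        mul_nonneg (mul_pos hB.z₁_mem.1 (Real.exp_pos _)).le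
          (sub_nonneg.2 (one_le_invRep hB (by linarith)))
      rw [← h1] at h2
      have := nonneg_of_mul_nonneg_right h2 (by linarith [hB.z₁_mem.2])
      linarith

variable (B) in
/-- Player 2's equilibrium strategy. -/
def eqStrategy₂ (hB : B.Valid) (hT : B.IsDuration T) : Strategy₂ where
  F := B.eqF₂ T
  F_neg _ := distrib_atomDensity_neg hT.1.le
  F_le_one t := by
    rcases lt_or_ge t 0 with h0 | h0
    · rw [eqF₂, distrib_atomDensity_neg hT.1.le h0]; norm_num
    · have h1 := eqF₂_eq hB hT h0
      have h2 : B.z₂ ≤ B.z₂ * Real.exp (B.rate₂ * max (T - t) 0) :=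
        le_mul_of_one_le_right hB.z₂_mem.1.le
          (Real.one_le_exp (mul_nonneg (rate₂_pos hB).le (le_max_right _ _)))
      nlinarith [hB.z₂_mem.2]
  q := B.yieldProb T
  q_measurable := measurable_yieldProb
  q_mem := yieldProb_mem hB

section Existence

variable (hB : B.Valid) (hT : B.IsDuration T)
include hB hT

lemma surv₂_eqStrategy {t : ℝ} (ht : 0 ≤ t) : B.surv₂ (B.eqStrategy₂ hB hT) t
    = B.z₂ * Real.exp (B.rate₂ * max (T - t) 0) := eqF₂_eq hB hT ht

lemma surv₁_eqStrategy {t : ℝ} (ht : t ∈ Icc 0 T) : B.surv₁ (B.eqStrategy₁ hB hT) t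
    = B.z₁ * Real.exp (-B.γ₁ * t) * B.invRep (T - t) := by
  have h1 := eqF₁_add_eqG hB hT ht
  change B.z₁ * Real.exp (-B.γ₁ * t) + (1 - B.z₁) * (1 - B.eqF₁ T t - B.eqG T t) = _
  rw [h1]; ring

lemma density₂_mul (s : ℝ) (hs : s ∈ Icc 0 T) :
    (1 - B.z₂) * B.density₂ T s = B.rate₂ * B.surv₂ (B.eqStrategy₂ hB hT) s := by
  have hz : 1 - B.z₂ ≠ 0 := by linarith [hB.z₂_mem.2]
  rw [surv₂_eqStrategy hB hT hs.1, max_eq_left (by linarith [hs.2]), density₂,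
    ContinuousMap.coe_mk, mul_div_cancel₀ _ hz]

lemma density₁_mul (s : ℝ) (hs : s ∈ Icc 0 T) :
    (1 - B.z₁) * B.density₁ T s = B.rate₁ * B.surv₁ (B.eqStrategy₁ hB hT) s := by
  have hz : 1 - B.z₁ ≠ 0 := by linarith [hB.z₁_mem.2]
  rw [surv₁_eqStrategy hB hT hs, density₁, ContinuousMap.coe_mk, mul_div_cancel₀ _ hz]

lemma drift₂_eqStrategy {t : ℝ} (ht : t ∈ Icc 0 T) :
    B.drift₂ (B.eqStrategy₂ hB hT) t = (1 - B.z₂) * B.atom₂ T :=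
  drift_atomDensity (atom₂_nonneg hB hT) (density₂_nonneg hB) (isOpponent₂ hB (B.eqStrategy₂ hB hT))
    (density₂_mul hB hT) ht

lemma drift₂_eqStrategy_le {t : ℝ} (ht : 0 ≤ t) :
    B.drift₂ (B.eqStrategy₂ hB hT) t ≤ (1 - B.z₂) * B.atom₂ T :=
  drift_atomDensity_le (atom₂_nonneg hB hT) hT.1.le (density₂_nonneg hB) (isOpponent₂ hB (B.eqStrategy₂ hB hT))
    (density₂_mul hB hT) ht

lemma drift₁_eqStrategy {t : ℝ} (ht : t ∈ Icc 0 T) :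
    B.drift₁ (B.eqStrategy₁ hB hT) t = (1 - B.z₁) * B.atom₁ T :=
  drift_atomDensity (atom₁_nonneg hB hT) (density₁_nonneg hB) (isOpponent₁ hB (B.eqStrategy₁ hB hT))
    (density₁_mul hB hT) ht

lemma drift₁_eqStrategy_le {t : ℝ} (ht : 0 ≤ t) :
    B.drift₁ (B.eqStrategy₁ hB hT) t ≤ (1 - B.z₁) * B.atom₁ T :=
  drift_atomDensity_le (atom₁_nonneg hB hT) hT.1.le (density₁_nonneg hB) (isOpponent₁ hB (B.eqStrategy₁ hB hT))
    (density₁_mul hB hT) ht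

lemma mass_eqStrategy₁ : (B.eqStrategy₁ hB hT).F.measure.real (Ici 0)
    + (B.eqStrategy₁ hB hT).G.measure.real (Ici 0) = 1 := by
  rw [real_Ici_of_const (T := T) (B.eqStrategy₁ hB hT).isSubCDF_F fun t ht => eqF₁_of_le hB hT ht,
    real_Ici_of_const (T := T) (B.eqStrategy₁ hB hT).isSubCDF_G fun t ht => eqG_of_le hB hT ht]
  exact eqF₁_add_eqG_last hB hT le_rfl

lemma eqF₂_of_le {t : ℝ} (ht : T ≤ t) : B.eqF₂ T t = 1 := by
  have h1 := eqF₂_eq hB hT (hT.1.le.trans ht)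
  rw [max_eq_right (by linarith)] at h1
  simp only [mul_zero, Real.exp_zero, mul_one] at h1
  have h2 : (1 - B.z₂) * (1 - B.eqF₂ T t) = 0 := by linarith
  have := (mul_eq_zero.1 h2).resolve_left (by linarith [hB.z₂_mem.2])
  linarith

lemma mass_eqStrategy₂ : (B.eqStrategy₂ hB hT).F.measure.real (Ici 0) = 1 := by
  rw [real_Ici_of_const (T := T) (B.eqStrategy₂ hB hT).isSubCDF fun t ht => ?_]
  · exact eqF₂_of_le hB hT le_rfl
  · exact (eqF₂_of_le hB hT ht).trans (eqF₂_of_le hB hT le_rfl).symm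

/-- Player 1's gain from challenging instead of conceding, in terms of reputations. -/
lemma challenge_gain_le {t : ℝ} (ht : 0 ≤ t) :
    (1 - B.z₂) * (1 - B.eqF₂ T t) * ((1 - B.yieldProb T t) * B.w₁ + B.yieldProb T t)
      - B.c₁ * B.surv₂ (B.eqStrategy₂ hB hT) t ≤ 0 ∧
    (t < T - B.quietTime →
      (1 - B.z₂) * (1 - B.eqF₂ T t) * ((1 - B.yieldProb T t) * B.w₁ + B.yieldProb T t)
      - B.c₁ * B.surv₂ (B.eqStrategy₂ hB hT) t = 0) := by
  have h1 : (1 - B.z₂) * (1 - B.eqF₂ T t) = B.surv₂ (B.eqStrategy₂ hB hT) t - B.z₂ := by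
    rw [surv₂]; change _ = 1 - (1 - B.z₂) * B.eqF₂ T t - B.z₂; ring
  have hw := hB.w₁_lt_one
  have hq := quietTime_pos hB
  have hl := rate₂_pos hB
  rw [h1]
  have heq : t < T - B.quietTime →
      (B.surv₂ (B.eqStrategy₂ hB hT) t - B.z₂) * ((1 - B.yieldProb T t) * B.w₁ + B.yieldProb T t)
      - B.c₁ * B.surv₂ (B.eqStrategy₂ hB hT) t = 0 := by
    intro htN
    have h2 := surv₂_eqStrategy hB hT ht
    rw [max_eq_left (by linarith)] at h2
    have h3 : B.z₂ = B.surv₂ (B.eqStrategy₂ hB hT) t * Real.exp (-B.rate₂ * (T - t)) := by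
      rw [h2, mul_assoc, ← Real.exp_add]; simp
    have h4 : Real.exp (-B.rate₂ * (T - t)) < 1 := by
      rw [Real.exp_lt_one_iff]; nlinarith
    have h5 : (1 - B.yieldProb T t) * B.w₁ + B.yieldProb T t
        = B.c₁ / (1 - Real.exp (-B.rate₂ * (T - t))) := by
      have h7 : 1 - B.w₁ ≠ 0 := by linarith
      rw [yieldProb, if_pos htN]
      have h8 : ∀ x : ℝ, (1 - (x - B.w₁) / (1 - B.w₁)) * B.w₁ + (x - B.w₁) / (1 - B.w₁) = x := by
        intro x; field_simp; ring
      exact h8 _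
    have h6 : 1 - Real.exp (-B.rate₂ * (T - t)) ≠ 0 := by linarith
    have h9 : B.surv₂ (B.eqStrategy₂ hB hT) t - B.z₂
        = B.surv₂ (B.eqStrategy₂ hB hT) t * (1 - Real.exp (-B.rate₂ * (T - t))) := by
      rw [mul_sub, mul_one, ← h3]
    rw [h5, h9, mul_assoc, mul_div_cancel₀ _ h6]
    ring
  refine ⟨?_, heq⟩
  rcases lt_or_ge t (T - B.quietTime) with htN | htN
  · exact (heq htN).le
  · have h2 : (1 - B.c₁) * B.surv₂ (B.eqStrategy₂ hB hT) t ≤ B.z₂ := by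
      rw [surv₂_eqStrategy hB hT ht, ← exp_quietTime hB, mul_left_comm, ← Real.exp_add]
      refine mul_le_of_le_one_right hB.z₂_mem.1.le ?_
      rw [Real.exp_le_one_iff]
      have h2 : max (T - t) 0 ≤ B.quietTime := max_le (by linarith) hq.le
      nlinarith
    rw [yieldProb, if_neg (not_lt.2 htN)]
    linarith

lemma isBest₁_eqStrategy : B.IsBest₁ (B.eqStrategy₁ hB hT) (B.eqStrategy₂ hB hT)
    (1 - B.a₂ + B.D * ((1 - B.z₂) * B.atom₂ T)) where
  U_le t ht := by
    rw [U₁_eq hB _ ht]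
    have h1 := ((isOpponent₂ hB (B.eqStrategy₂ hB hT)).gain_le_drift t).trans
      (drift₂_eqStrategy_le hB hT ht)
    linarith [mul_le_mul_of_nonneg_left h1 hB.D_pos.le]
  V_le t ht := by
    rw [V₁_eq hB _ ht]
    have h1 := drift₂_eqStrategy_le hB hT ht
    have h2 := mul_nonpos_of_nonneg_of_nonpos (Real.exp_pos (-B.r₁ * t)).le
      (challenge_gain_le hB hT ht).1
    have h3 := mul_le_mul_of_nonneg_left (add_le_add h1 h2) hB.D_pos.le
    rw [add_zero] at h3
    exact add_le_add_right h3 _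
  W_le := by
    refine le_of_tendsto (tendsto_W₁ hB _) (Eventually.of_forall fun n => ?_)
    linarith [mul_le_mul_of_nonneg_left (drift₂_eqStrategy_le hB hT n.cast_nonneg) hB.D_pos.le]
  U_eq := by
    -- The loss from a tie could matter only at 0, and there one of the two atoms vanishes: either
    -- player 1 does not concede at 0 or player 2 does not.
    have h1 : ∀ᵐ t ∂(B.eqF₁ T).measure, t ∈ Icc 0 T ∧ (t = 0 → B.atom₂ T = 0) := by
      rw [eqF₁, Measure.measure_distrib]
      have h2 := ae_mem_Icc_atomDensity (p := B.atom₁ T) (φ := B.density₁ T) hT.1.le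
      rcases atom_eq_zero hT with h0 | h0
      · have h3 : ∀ᵐ t ∂atomDensity (B.atom₁ T) T (B.density₁ T), t ≠ 0 := by
          rw [ae_iff]
          simpa using atomDensity_singleton (p := B.atom₁ T) (T := T) (φ := B.density₁ T) 0
            (fun _ => h0.le)
        filter_upwards [h2, h3] with t ht ht0 using ⟨ht, fun h => absurd h ht0⟩
      · filter_upwards [h2] with t ht using ⟨ht, fun _ => h0⟩
    change ∀ᵐ t ∂(B.eqF₁ T).measure, _
    filter_upwards [h1] with t ht
    rw [U₁_eq hB _ ht.1.1, gain_eq_drift]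
    · congr 2; exact drift₂_eqStrategy hB hT ht.1
    · exact leftLim_distrib_atomDensity t fun h => (ht.2 h).le
  V_eq := by
    have h1 : ∀ᵐ t ∂(B.eqG T).measure, t ∈ Icc 0 (max (T - B.quietTime) 0) ∧ t ≠ 0 ∧
        t ≠ max (T - B.quietTime) 0 := by
      rw [eqG, Measure.measure_distrib]
      have h2 := ae_mem_Icc_atomDensity (p := 0) (φ := B.challengeDensity)
        (le_max_right (T - B.quietTime) 0)
      have h3 : ∀ x : ℝ, ∀ᵐ t ∂atomDensity 0 (max (T - B.quietTime) 0) B.challengeDensity,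
          t ≠ x := fun x => by
        rw [ae_iff]
        simpa using atomDensity_singleton (p := 0) (T := max (T - B.quietTime) 0)
          (φ := B.challengeDensity) x (fun _ => le_rfl)
      filter_upwards [h2, h3 0, h3 (max (T - B.quietTime) 0)] with t ht h h' using ⟨ht, h, h'⟩
    change ∀ᵐ t ∂(B.eqG T).measure, _
    filter_upwards [h1] with t ht
    obtain ⟨ht, ht0, htN⟩ := ht
    have h2 : t < max (T - B.quietTime) 0 := lt_of_le_of_ne ht.2 htN
    have h3 : t < T - B.quietTime := (lt_max_iff.1 h2).resolve_right (not_lt.2 ht.1)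
    rw [V₁_eq hB _ ht.1, drift₂_eqStrategy hB hT ⟨ht.1, ht.2.trans (quietStart_le hB hT)⟩]
    have h4 : (1 - B.z₂) * (1 - (B.eqStrategy₂ hB hT).F t)
        * ((1 - (B.eqStrategy₂ hB hT).q t) * B.w₁ + (B.eqStrategy₂ hB hT).q t)
        - B.c₁ * B.surv₂ (B.eqStrategy₂ hB hT) t = 0 := (challenge_gain_le hB hT ht.1).2 h3
    rw [h4]; ring
  W_eq h := absurd (mass_eqStrategy₁ hB hT) h.ne

/-- Bluffs are in the indifference ratio, so in the bluffing phase the gain cancels for every `p`.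
Afterwards only justified challenges remain, and seeing them is a pure loss. -/
lemma seeGain_eqStrategy {I : Set ℝ} (hI : MeasurableSet I) (h0 : I ⊆ Ici 0) {p : ℝ → ℝ}
    (hp : IsBddMeas p) : B.seeGain (B.eqStrategy₁ hB hT) I p
      = -(B.k₂ * B.z₁ * ∫ s in I \ Icc 0 (max (T - B.quietTime) 0),
        p s * Real.exp (-B.r₂ * s) * (B.γ₁ * Real.exp (-B.γ₁ * s))) := by
  have hz : 1 - B.z₁ ≠ 0 := by linarith [hB.z₁_mem.2]
  have hk : 1 - B.w₁ - B.k₂ ≠ 0 := by linarith [hB.k₂_lt]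
  have h1 := integrableOn_exp_G hB (B.eqStrategy₁ hB hT) hp hI h0
  have h2 := integral_inter_add_sdiff (measurableSet_Icc (a := 0)
    (b := max (T - B.quietTime) 0)) (integrableOn_justified hB hp hI h0)
  rw [seeGain, ← h2]
  change IntegrableOn _ I (B.eqG T).measure at h1
  change (1 - B.z₁) * (1 - B.w₁ - B.k₂) * (∫ s in I, _ ∂(B.eqG T).measure) - _ = _
  rw [eqG, Measure.measure_distrib] at h1 ⊢
  rw [setIntegral_atomDensity le_rfl (fun s _ => challengeDensity_nonneg hB s) hI h1, zero_mul,
    zero_add]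
  have h3 : (1 - B.z₁) * (1 - B.w₁ - B.k₂) * ∫ s in I ∩ Icc 0 (max (T - B.quietTime) 0),
      p s * Real.exp (-B.r₂ * s) * B.challengeDensity s
      = B.k₂ * B.z₁ * ∫ s in I ∩ Icc 0 (max (T - B.quietTime) 0),
        p s * Real.exp (-B.r₂ * s) * (B.γ₁ * Real.exp (-B.γ₁ * s)) := by
    rw [← integral_const_mul, ← integral_const_mul]
    congr 1; ext s
    simp only [challengeDensity, ContinuousMap.coe_mk, bluffRatio]
    field_simp
  rw [h3]; ring

lemma seeGain_eqStrategy_le {I : Set ℝ} (hI : MeasurableSet I) (h0 : I ⊆ Ici 0) {q : ℝ → ℝ}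
    (hq : Measurable q) (hq' : ∀ t, q t ∈ Icc (0 : ℝ) 1) :
    B.seeGain (B.eqStrategy₁ hB hT) I (fun s => 1 - q s) ≤ 0 := by
  rw [seeGain_eqStrategy hB hT hI h0
    ((IsBddMeas.const 1).sub (isBddMeas_of_mem hq hq')), neg_nonpos]
  refine mul_nonneg (mul_pos hB.k₂_pos hB.z₁_mem.1).le (integral_nonneg fun s => ?_)
  exact mul_nonneg (mul_nonneg (by linarith [(hq' s).2]) (Real.exp_pos _).le)
    (mul_nonneg hB.γ₁_nonneg (Real.exp_pos _).le)

lemma seeGain_eqStrategy_yieldProb {I : Set ℝ} (hI : MeasurableSet I) (h0 : I ⊆ Ici 0) :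
    B.seeGain (B.eqStrategy₁ hB hT) I (fun s => 1 - B.yieldProb T s) = 0 := by
  rw [seeGain_eqStrategy hB hT hI h0
    ((IsBddMeas.const 1).sub (isBddMeas_of_mem measurable_yieldProb (yieldProb_mem hB))),
    neg_eq_zero]
  refine mul_eq_zero_of_right _ (setIntegral_eq_zero_of_forall_eq_zero fun s hs => ?_)
  have h1 : ¬ s < T - B.quietTime := fun h =>
    hs.2 ⟨h0 hs.1, h.le.trans (le_max_left _ _)⟩
  rw [yieldProb, if_neg h1]; ring

lemma isBest₂_eqStrategy : B.IsBest₂ (B.eqStrategy₁ hB hT) (B.eqStrategy₂ hB hT)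
    (1 - B.a₁ + B.D * ((1 - B.z₁) * B.atom₁ T)) where
  U_le q hq hq' t ht := by
    rw [U₂_eq hB _ (isBddMeas_of_mem hq hq') ht]
    have h1 := ((isOpponent₁ hB (B.eqStrategy₁ hB hT)).gain_le_drift t).trans
      (drift₁_eqStrategy_le hB hT ht)
    have h2 := seeGain_eqStrategy_le hB hT (measurableSet_Ico (a := 0) (b := t))
      Ico_subset_Ici_self hq hq'
    linarith [mul_le_mul_of_nonneg_left (add_le_add h1 h2) hB.D_pos.le]
  W_le q hq hq' := by
    refine le_of_tendsto (tendsto_received₂ hB _ (isBddMeas_of_mem hq hq'))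
      (Eventually.of_forall fun n => ?_)
    have h2 := seeGain_eqStrategy_le hB hT measurableSet_Ici subset_rfl hq hq'
    linarith [mul_le_mul_of_nonneg_left
      (add_le_add (drift₁_eqStrategy_le hB hT n.cast_nonneg) h2) hB.D_pos.le]
  U_eq := by
    have h1 : ∀ᵐ t ∂(B.eqF₂ T).measure, t ∈ Icc 0 T ∧ (t = 0 → B.atom₁ T = 0) := by
      rw [eqF₂, Measure.measure_distrib]
      have h2 := ae_mem_Icc_atomDensity (p := B.atom₂ T) (φ := B.density₂ T) hT.1.le
      rcases atom_eq_zero hT with h0 | h0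
      · filter_upwards [h2] with t ht using ⟨ht, fun _ => h0⟩
      · have h3 : ∀ᵐ t ∂atomDensity (B.atom₂ T) T (B.density₂ T), t ≠ 0 := by
          rw [ae_iff]
          simpa using atomDensity_singleton (p := B.atom₂ T) (T := T) (φ := B.density₂ T) 0
            (fun _ => h0.le)
        filter_upwards [h2, h3] with t ht ht0 using ⟨ht, fun h => absurd h ht0⟩
    change ∀ᵐ t ∂(B.eqF₂ T).measure, _
    filter_upwards [h1] with t ht
    have h2 := seeGain_eqStrategy_yieldProb hB hT (measurableSet_Ico (a := 0) (b := t))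
      Ico_subset_Ici_self
    rw [U₂_eq hB _ (B.eqStrategy₂ hB hT).isBddMeas_q ht.1.1, gain_eq_drift]
    · change _ + B.D * (B.drift₁ _ t + B.seeGain _ _ (fun s => 1 - B.yieldProb T s)) = _
      rw [h2, drift₁_eqStrategy hB hT ht.1, add_zero]
    · exact leftLim_distrib_atomDensity t fun h => (ht.2 h).le
  W_eq h := absurd (mass_eqStrategy₂ hB hT) h.ne

end Existence

/-- An equilibrium exists. -/
theorem exists_isEquilibrium (hB : B.Valid) : ∃ σ₁ σ₂, B.IsEquilibrium σ₁ σ₂ :=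
  let ⟨_, hT⟩ := exists_isDuration hB
  ⟨_, _, isEquilibrium_of_isBest hB (isBest₁_eqStrategy hB hT) (isBest₂_eqStrategy hB hT)⟩

end BargainingGame

namespace BargainingGame

variable {B : BargainingGame}

/-! ### The coevolution curve -/

lemma Valid.withPriors (hB : B.Valid) {x₁ x₂ : ℝ} (h₁ : x₁ ∈ Ioo (0 : ℝ) 1)
    (h₂ : x₂ ∈ Ioo (0 : ℝ) 1) : (B.withPriors x₁ x₂).Valid :=
  { hB with z₁_mem := h₁, z₂_mem := h₂ }

lemma Valid.withoutChallenge (hB : B.Valid) : B.withoutChallenge.Valid :=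
  { hB with γ₁_nonneg := le_rfl }

/-- Reputations in any equilibrium, for any priors. -/
lemma exists_reputations_eq (hB : B.Valid) {x₁ x₂ : ℝ} (h₁ : x₁ ∈ Ioo (0 : ℝ) 1)
    (h₂ : x₂ ∈ Ioo (0 : ℝ) 1) {σ₁ : Strategy₁} {σ₂ : Strategy₂}
    (h : (B.withPriors x₁ x₂).IsEquilibrium σ₁ σ₂) : ∃ T, ∀ t, 0 < t →
      (B.withPriors x₁ x₂).reputation₁ σ₁ t = (B.invRep (max (T - t) 0))⁻¹ ∧
      (B.withPriors x₁ x₂).reputation₂ σ₂ t = Real.exp (-B.rate₂ * max (T - t) 0) := by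
  have hV := hB.withPriors h₁ h₂
  obtain ⟨T, hT⟩ := exists_isDuration hV
  exact ⟨T, (h.unique hV hT).2⟩

/-- There are equilibria of any positive duration without immediate concessions. -/
lemma exists_equilibrium_of_duration (hB : B.Valid) {T : ℝ} (hT : 0 < T) :
    ∃ x₁ ∈ Ioo (0 : ℝ) 1, ∃ x₂ ∈ Ioo (0 : ℝ) 1, ∃ σ₁ σ₂,
      (B.withPriors x₁ x₂).IsEquilibrium σ₁ σ₂ ∧ ∀ t, 0 < t →
      (B.withPriors x₁ x₂).reputation₁ σ₁ t = (B.invRep (max (T - t) 0))⁻¹ ∧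
      (B.withPriors x₁ x₂).reputation₂ σ₂ t = Real.exp (-B.rate₂ * max (T - t) 0) := by
  have h1 : 1 < B.invRep T := by rw [← invRep_zero hB]; exact strictMono_invRep hB hT
  have hx₁ : (B.invRep T)⁻¹ ∈ Ioo (0 : ℝ) 1 :=
    ⟨inv_pos.2 (by linarith), inv_lt_one_of_one_lt₀ h1⟩
  have hx₂ : Real.exp (-B.rate₂ * T) ∈ Ioo (0 : ℝ) 1 := by
    refine ⟨Real.exp_pos _, ?_⟩
    rw [Real.exp_lt_one_iff]; nlinarith [rate₂_pos hB]
  have hV := hB.withPriors hx₁ hx₂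
  have hd : (B.withPriors (B.invRep T)⁻¹ (Real.exp (-B.rate₂ * T))).IsDuration T := by
    refine ⟨hT, ?_⟩
    change max ((B.invRep T)⁻¹ * B.invRep T) (Real.exp (-B.rate₂ * T) * Real.exp (B.rate₂ * T)) = 1
    rw [inv_mul_cancel₀ (by linarith), ← Real.exp_add]; simp
  obtain ⟨σ₁, σ₂, h⟩ := exists_isEquilibrium hV
  exact ⟨_, hx₁, _, hx₂, σ₁, σ₂, h, (h.unique hV hd).2⟩

/-- The time to go parametrises the curve, because reputations depend on priors and time only
through it. -/
lemma mem_coevolutionCurve (hB : B.Valid) {x y : ℝ} : (x, y) ∈ B.coevolutionCurve ↔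
    ∃ s, 0 ≤ s ∧ x = (B.invRep s)⁻¹ ∧ y = Real.exp (-B.rate₂ * s) := by
  constructor
  · rintro ⟨x₁, h₁, x₂, h₂, σ₁, σ₂, h, t, ht, hp⟩
    obtain ⟨T, hT⟩ := exists_reputations_eq hB h₁ h₂ h
    rw [(hT t ht).1, (hT t ht).2, Prod.mk.injEq] at hp
    exact ⟨_, le_max_right _ _, hp⟩
  · rintro ⟨s, hs, rfl, rfl⟩
    -- A game of duration `s + 1` has `s` to go at time 1, which is a positive time even for the
    -- endpoint `s = 0`.
    obtain ⟨x₁, h₁, x₂, h₂, σ₁, σ₂, h, hr⟩ :=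
      exists_equilibrium_of_duration hB (by linarith : 0 < s + 1)
    refine ⟨x₁, h₁, x₂, h₂, σ₁, σ₂, h, 1, one_pos, ?_⟩
    rw [(hr 1 one_pos).1, (hr 1 one_pos).2, add_sub_cancel_right, max_eq_left hs]

lemma invRep_inv_injective (hB : B.Valid) : Injective fun s => (B.invRep s)⁻¹ :=
  inv_injective.comp (strictMono_invRep hB).injective

lemma injOn_coevolutionCurve (hB : B.Valid) : B.coevolutionCurve.InjOn Prod.fst := by
  rintro ⟨x, y⟩ h ⟨x', y'⟩ h' (rfl : x = x')
  obtain ⟨s, _, hs, rfl⟩ := (mem_coevolutionCurve hB).1 h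
  obtain ⟨s', _, hs', rfl⟩ := (mem_coevolutionCurve hB).1 h'
  rw [invRep_inv_injective hB (hs.symm.trans hs')]

lemma μTilde₂_invRep (hB : B.Valid) {s : ℝ} (hs : 0 ≤ s) :
    B.μTilde₂ (B.invRep s)⁻¹ = Real.exp (-B.rate₂ * s) := by
  have h : {y | ((B.invRep s)⁻¹, y) ∈ B.coevolutionCurve} = {Real.exp (-B.rate₂ * s)} := by
    ext y
    simp only [mem_ofPred_eq, mem_singleton_iff, mem_coevolutionCurve hB]
    constructor
    · rintro ⟨s', _, h1, rfl⟩
      rw [invRep_inv_injective hB h1]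
    · rintro rfl
      exact ⟨s, hs, rfl, rfl⟩
  rw [μTilde₂, h, csSup_singleton]

lemma μTilde₂_of_forall_ne (hB : B.Valid) {x : ℝ} (h : ∀ s, 0 ≤ s → x ≠ (B.invRep s)⁻¹) :
    B.μTilde₂ x = 0 := by
  have h' : {y | (x, y) ∈ B.coevolutionCurve} = ∅ := by
    refine eq_empty_of_forall_notMem fun y hy => ?_
    obtain ⟨s, hs, hx, _⟩ := (mem_coevolutionCurve hB).1 hy
    exact h s hs hx
  rw [μTilde₂, h', Real.sSup_empty]

lemma reputationsAt_μStar₂ (hB : B.Valid) :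
    B.reputationsAt B.μStar₂ = {(B.invRep B.quietTime)⁻¹} := by
  ext x
  simp only [reputationsAt, mem_ofPred_eq, mem_singleton_iff, mem_coevolutionCurve hB]
  constructor
  · rintro ⟨s, hs, rfl, h⟩
    rw [μStar₂, ← exp_quietTime hB, Real.exp_eq_exp] at h
    rw [mul_left_cancel₀ (neg_ne_zero.2 (rate₂_pos hB).ne') h]
  · rintro rfl
    exact ⟨_, (quietTime_pos hB).le, rfl, (exp_quietTime hB).symm⟩

lemma νStar_eq (hB : B.Valid) : B.νStar = (1 + B.bluffRatio)⁻¹ := by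
  have h1 : 1 - B.w₁ ≠ 0 := by linarith [hB.w₁_lt_one]
  have h2 : 1 - B.w₁ - B.k₂ ≠ 0 := by linarith [hB.k₂_lt]
  have h3 : 1 + B.bluffRatio = (1 - B.w₁) / (1 - B.w₁ - B.k₂) := by
    rw [bluffRatio]; field_simp; ring
  rw [h3, inv_div, νStar]
  field_simp

/-- The time at which player 1's reputation is `ν₁*`. -/
lemma exists_invRep_eq (hB : B.Valid) : ∃ s, 0 < s ∧ B.invRep s = 1 + B.bluffRatio := by
  have hr := rate₁_pos hB
  have hq := quietTime_pos hB
  have hb := bluffRatio_pos hB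
  have hlarge : ∃ S, 0 ≤ S ∧ 1 + B.bluffRatio ≤ B.invRep S := by
    by_contra hcon
    push Not at hcon
    -- As long as `invRep` is below `1 + bluffRatio`, its slope beyond `quietTime` is at least
    -- `rate₁`; after `(1 + bluffRatio) / rate₁` more units of time it has passed that level.
    set S := B.quietTime + (1 + B.bluffRatio) / B.rate₁ with hS
    have hS0 : B.quietTime ≤ S := by
      have : 0 < (1 + B.bluffRatio) / B.rate₁ := div_pos (by linarith) hr
      linarith
    have h1 := (convex_Ici B.quietTime).mul_sub_le_image_sub_of_le_deriv (f := B.invRep)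
      (C := B.rate₁) continuous_invRep.continuousOn (fun s hs => by
        rw [interior_Ici] at hs
        exact (hasDerivAt_invRep_of_gt hs).differentiableAt.differentiableWithinAt) (fun s hs => by
        rw [interior_Ici] at hs
        rw [(hasDerivAt_invRep_of_gt hs).deriv]
        have h2 := one_le_invRep hB (hq.le.trans (le_of_lt hs))
        have h3 := hcon s (hq.le.trans (le_of_lt hs))
        nlinarith [mul_nonneg hB.γ₁_nonneg (sub_nonneg.2 h3.le)]) B.quietTime self_mem_Ici S hS0 hS0
    rw [hS, add_sub_cancel_left, mul_div_cancel₀ _ hr.ne', ← hS] at h1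
    have h2 := one_le_invRep hB hq.le
    linarith [hcon S (hq.le.trans hS0)]
  obtain ⟨S, hS, hS1⟩ := hlarge
  obtain ⟨s, hs, hs1⟩ := intermediate_value_Icc hS continuous_invRep.continuousOn
    ⟨by rw [invRep_zero hB]; linarith, hS1⟩
  refine ⟨s, lt_of_le_of_ne hs.1 ?_, hs1⟩
  rintro rfl
  rw [invRep_zero hB] at hs1
  linarith

/-- Reputation `νStar` means exactly `s` to go by injectivity of `invRep`, and reputation 1 is
reached precisely when no time is left. -/
lemma timesToOne_νStar (hB : B.Valid) {s : ℝ} (hs : 0 < s) (hs1 : B.invRep s = 1 + B.bluffRatio) :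
    B.timesToOne B.νStar = {s} := by
  have hν : B.νStar = (B.invRep s)⁻¹ := by rw [hs1, νStar_eq hB]
  have hset : ∀ {x₁ x₂ T t : ℝ} {σ₁ : Strategy₁}, 0 < t →
      (∀ t, 0 < t → (B.withPriors x₁ x₂).reputation₁ σ₁ t = (B.invRep (max (T - t) 0))⁻¹) →
      T - t = s →
      {d | 0 ≤ d ∧ (B.withPriors x₁ x₂).reputation₁ σ₁ (t + d) = 1} = Ici s := by
    intro x₁ x₂ T t σ₁ ht hT hTs
    ext d
    simp only [mem_ofPred_eq, mem_Ici]
    have hone : ∀ d, 0 ≤ d →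
        ((B.withPriors x₁ x₂).reputation₁ σ₁ (t + d) = 1 ↔ s ≤ d) := by
      intro d hd
      rw [hT _ (by linarith), inv_eq_one, ← invRep_zero hB, (strictMono_invRep hB).injective.eq_iff,
        max_eq_right_iff]
      constructor <;> intro h <;> linarith
    constructor
    · rintro ⟨h1, h2⟩; exact (hone d h1).1 h2
    · intro h1
      exact ⟨hs.le.trans h1, (hone d (hs.le.trans h1)).2 h1⟩
  ext d
  simp only [timesToOne, mem_ofPred_eq, mem_singleton_iff]
  constructor
  · rintro ⟨x₁, h₁, x₂, h₂, σ₁, σ₂, h, t, ht, hx, hd⟩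
    obtain ⟨T, hT⟩ := exists_reputations_eq hB h₁ h₂ h
    rw [(hT t ht).1, hν] at hx
    have h1 := invRep_inv_injective hB hx
    have h2 : T - t = s := by
      rcases max_choice (T - t) 0 with h3 | h3 <;> rw [h3] at h1
      · exact h1
      · linarith
    rw [hset ht (fun t ht => (hT t ht).1) h2] at hd
    exact hd.unique isLeast_Ici
  · rintro rfl
    obtain ⟨x₁, h₁, x₂, h₂, σ₁, σ₂, h, hr⟩ :=
      exists_equilibrium_of_duration hB (by linarith : 0 < d + 1)
    refine ⟨x₁, h₁, x₂, h₂, σ₁, σ₂, h, 1, one_pos, ?_, ?_⟩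
    · rw [(hr 1 one_pos).1, add_sub_cancel_right, max_eq_left hs.le, hν]
    · rw [hset one_pos (fun t ht => (hr t ht).1) (by ring)]
      exact isLeast_Ici

lemma equilibriumPayoffs₁_eq (hB : B.Valid) {T : ℝ} (hT : B.IsDuration T) :
    B.equilibriumPayoffs₁ = {1 - B.a₂ + B.D * (1 - B.z₂ * Real.exp (B.rate₂ * T))} := by
  ext u
  simp only [equilibriumPayoffs₁, mem_ofPred_eq, mem_singleton_iff]
  constructor
  · rintro ⟨σ₁, σ₂, h, rfl⟩
    exact (h.unique hB hT).1
  · rintro rfl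
    obtain ⟨σ₁, σ₂, h⟩ := exists_isEquilibrium hB
    exact ⟨σ₁, σ₂, h, (h.unique hB hT).1.symm⟩

/-! ### Comparison with the game without challenges -/

lemma invRep_withoutChallenge (s : ℝ) :
    B.withoutChallenge.invRep s = Real.exp (B.rate₁ * s) := by
  have h1 : B.withoutChallenge.invRep s = 1 + B.rate₁ * expGrowth (B.rate₁ - 0) s
    + 0 * B.bluffRatio * expGrowth (B.rate₁ - 0) (max (s - B.quietTime) 0) := rfl
  rw [h1, sub_zero, exp_eq_expGrowth]; ring

variable (B) in
/-- Ratio of the reputations of player 1, with time `s` to go, without and with challenges. -/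
def repRatio (s : ℝ) : ℝ := Real.exp (-B.rate₁ * s) * B.invRep s

lemma repRatio_zero (hB : B.Valid) : B.repRatio 0 = 1 := by
  rw [repRatio, invRep_zero hB]; simp

lemma continuous_repRatio : Continuous B.repRatio := by
  have := continuous_invRep (B := B)
  unfold repRatio
  fun_prop

lemma hasDerivAt_exp_rate (s : ℝ) :
    HasDerivAt (fun s => Real.exp (-B.rate₁ * s)) (Real.exp (-B.rate₁ * s) * -B.rate₁) s := by
  have : HasDerivAt (fun t : ℝ => -B.rate₁ * t) (-B.rate₁) s := by
    simpa using (hasDerivAt_id s).const_mul (-B.rate₁)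
  exact this.exp

/-- The factor `exp (-rate₁ s)` cancels the growth due to concessions. Only the effect of challenges
remains, and its sign is that of a constant minus `invRep`. -/
lemma deriv_repRatio_of_lt {s : ℝ} (hs : s < B.quietTime) :
    deriv B.repRatio s = B.γ₁ * Real.exp (-B.rate₁ * s) * (1 - B.invRep s) :=
  (((hasDerivAt_exp_rate s).mul (hasDerivAt_invRep_of_lt hs)).congr_deriv (by ring)).deriv

lemma deriv_repRatio_of_gt {s : ℝ} (hs : B.quietTime < s) :
    deriv B.repRatio s = B.γ₁ * Real.exp (-B.rate₁ * s) * (1 + B.bluffRatio - B.invRep s) :=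
  (((hasDerivAt_exp_rate s).mul (hasDerivAt_invRep_of_gt hs)).congr_deriv (by ring)).deriv

lemma one_lt_repRatio_iff {s : ℝ} : 1 < B.repRatio s ↔ Real.exp (B.rate₁ * s) < B.invRep s := by
  rw [repRatio, neg_mul, Real.exp_neg, inv_mul_eq_div, one_lt_div (Real.exp_pos _)]

lemma repRatio_eq_one_iff {s : ℝ} : B.repRatio s = 1 ↔ B.invRep s = Real.exp (B.rate₁ * s) := by
  rw [repRatio, neg_mul, Real.exp_neg, inv_mul_eq_div, div_eq_one_iff_eq (Real.exp_pos _).ne']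

/-! ### Shape of the ratio of reputations when challenges arrive -/

section PosRate

variable (hB : B.Valid) (hγ : 0 < B.γ₁)
include hB hγ

lemma strictAntiOn_repRatio_quiet : StrictAntiOn B.repRatio (Icc 0 B.quietTime) := by
  refine strictAntiOn_of_deriv_neg (convex_Icc _ _) continuous_repRatio.continuousOn fun s hs => ?_
  rw [interior_Icc] at hs
  rw [deriv_repRatio_of_lt hs.2]
  have h1 : 1 < B.invRep s := by rw [← invRep_zero hB]; exact strictMono_invRep hB hs.1
  exact mul_neg_of_pos_of_neg (mul_pos hγ (Real.exp_pos _)) (by linarith)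

lemma strictMonoOn_repRatio {s₀ : ℝ} (h₀ : B.invRep s₀ = 1 + B.bluffRatio) :
    StrictMonoOn B.repRatio (Icc B.quietTime s₀) := by
  refine strictMonoOn_of_deriv_pos (convex_Icc _ _) continuous_repRatio.continuousOn fun s hs => ?_
  rw [interior_Icc] at hs
  rw [deriv_repRatio_of_gt hs.1, ← h₀]
  exact mul_pos (mul_pos hγ (Real.exp_pos _)) (sub_pos.2 (strictMono_invRep hB hs.2))

lemma strictAntiOn_repRatio {s₀ : ℝ} (h₀ : B.invRep s₀ = 1 + B.bluffRatio) :
    StrictAntiOn B.repRatio (Ici (max B.quietTime s₀)) := by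
  refine strictAntiOn_of_deriv_neg (convex_Ici _) continuous_repRatio.continuousOn fun s hs => ?_
  rw [interior_Ici] at hs
  have hs := max_lt_iff.1 (mem_Ioi.1 hs)
  rw [deriv_repRatio_of_gt hs.1, ← h₀]
  exact mul_neg_of_pos_of_neg (mul_pos hγ (Real.exp_pos _))
    (sub_neg.2 (strictMono_invRep hB hs.2))

/-- `invRep` grows at most like `s * exp (max (rate₁ - γ₁) 0 * s)`, which falls short of `exp (rate₁
s)` by the exponential rate `m = min γ₁ rate₁`. -/
lemma tendsto_repRatio : Tendsto B.repRatio atTop (𝓝 0) := by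
  have hr := rate₁_pos hB
  have hb := bluffRatio_pos hB
  set m := min B.γ₁ B.rate₁ with hm
  have hm0 : 0 < m := lt_min hγ hr
  set A := B.rate₁ + B.γ₁ * B.bluffRatio with hA
  have hA0 : 0 < A := add_pos hr (mul_pos hγ hb)
  have h1 : Tendsto (fun s => Real.exp (-B.rate₁ * s)) atTop (𝓝 0) :=
    Real.tendsto_exp_atBot.comp (tendsto_id.const_mul_atTop_of_neg (by linarith))
  have h2 : Tendsto (fun s => s * Real.exp (-m * s)) atTop (𝓝 0) := by
    have h3 := (Real.tendsto_pow_mul_exp_neg_atTop_nhds_zero 1).comp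
      (tendsto_id.const_mul_atTop hm0)
    have h4 := h3.const_mul m⁻¹
    rw [mul_zero] at h4
    refine h4.congr fun s => ?_
    simp only [comp_apply, id, pow_one, neg_mul]
    rw [← mul_assoc, ← mul_assoc, inv_mul_cancel₀ hm0.ne', one_mul]
  have h3 : Tendsto (fun s => Real.exp (-B.rate₁ * s) + A * (s * Real.exp (-m * s))) atTop (𝓝 0) := by
    simpa using h1.add (h2.const_mul A)
  refine squeeze_zero' ?_ ?_ h3
  · filter_upwards [eventually_ge_atTop 0] with s hs
    exact mul_nonneg (Real.exp_pos _).le (zero_le_one.trans (one_le_invRep hB hs))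
  · filter_upwards [eventually_ge_atTop 0] with s hs
    set c := B.rate₁ - B.γ₁ with hc
    have h4 : expGrowth c (max (s - B.quietTime) 0) ≤ expGrowth c s :=
      (strictMono_expGrowth c).monotone (max_le (by linarith [quietTime_pos hB]) hs)
    have h5 : B.invRep s ≤ 1 + A * expGrowth c s := by
      rw [invRep, ← hc, hA]
      linarith [mul_le_mul_of_nonneg_left h4 (mul_pos hγ hb).le]
    have h6 : expGrowth c s ≤ s * Real.exp (max c 0 * s) := by
      have h7 := intervalIntegral.integral_mono_on (μ := volume) hs
        (f := fun v => Real.exp (c * v)) (g := fun _ => Real.exp (max c 0 * s))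
        (Continuous.intervalIntegrable (by fun_prop) _ _) (by simp) (fun v hv => by
          rw [Real.exp_le_exp]
          exact (mul_le_mul_of_nonneg_right (le_max_left c 0) hv.1).trans
            (mul_le_mul_of_nonneg_left hv.2 (le_max_right c 0)))
      simpa [expGrowth] using h7
    have h8 : Real.exp (-B.rate₁ * s) * Real.exp (max c 0 * s) = Real.exp (-m * s) := by
      have h9 : max c 0 = B.rate₁ - m := by
        rcases le_total B.γ₁ B.rate₁ with h | h
        · rw [hm, min_eq_left h, max_eq_left (by linarith)]
        · rw [hm, min_eq_right h, max_eq_right (by linarith), sub_self]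
      rw [← Real.exp_add, h9]; ring_nf
    calc B.repRatio s ≤ Real.exp (-B.rate₁ * s) * (1 + A * (s * Real.exp (max c 0 * s))) :=
          mul_le_mul_of_nonneg_left (h5.trans (by
            linarith [mul_le_mul_of_nonneg_left h6 hA0.le])) (Real.exp_pos _).le
      _ = Real.exp (-B.rate₁ * s)
          + A * (s * (Real.exp (-B.rate₁ * s) * Real.exp (max c 0 * s))) := by ring
      _ = _ := by rw [h8]

/-- The ratio starts at 1 and can rise only between `quietTime` and `s₀`. If this interval is empty
or the peak at `s₀` is at most 1, the ratio never exceeds 1. -/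
lemma repRatio_le_one {s₀ : ℝ} (h₀ : B.invRep s₀ = 1 + B.bluffRatio)
    (h : ¬(B.quietTime < s₀ ∧ 1 < B.repRatio s₀)) {s : ℝ} (hs : 0 ≤ s) : B.repRatio s ≤ 1 := by
  have hq := quietTime_pos hB
  have hanti := (strictAntiOn_repRatio_quiet hB hγ).antitoneOn
  have h1 : ∀ s ∈ Icc 0 B.quietTime, B.repRatio s ≤ 1 := fun s hs => by
    rw [← repRatio_zero hB]; exact hanti ⟨le_rfl, hq.le⟩ hs hs.1
  have hlast := (strictAntiOn_repRatio hB hγ h₀).antitoneOn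
  rcases le_or_gt s B.quietTime with h2 | h2
  · exact h1 s ⟨hs, h2⟩
  rcases le_or_gt s₀ B.quietTime with h3 | h3
  · rw [max_eq_left h3] at hlast
    exact (hlast self_mem_Ici h2.le h2.le).trans (h1 _ ⟨hq.le, le_rfl⟩)
  · have h4 : B.repRatio s₀ ≤ 1 := not_lt.1 fun h' => h ⟨h3, h'⟩
    rw [max_eq_right h3.le] at hlast
    rcases le_total s s₀ with h5 | h5
    · exact ((strictMonoOn_repRatio hB hγ h₀).monotoneOn ⟨h2.le, h5⟩ ⟨h3.le, le_rfl⟩ h5).trans h4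
    · exact (hlast self_mem_Ici h5 h5).trans h4

/-- The ratio is below 1 on the quiet phase, above 1 at `s₀`, and tends to 0. Monotonicity on each
piece gives one upward crossing `a` before `s₀` and one downward crossing `b` after it. -/
lemma exists_repRatio_eq_one {s₀ : ℝ} (h₀ : B.invRep s₀ = 1 + B.bluffRatio)
    (hq₀ : B.quietTime < s₀) (h : 1 < B.repRatio s₀) :
    ∃ a b, 0 < a ∧ a < b ∧ B.repRatio a = 1 ∧ B.repRatio b = 1 ∧
      (∀ s, 0 < s → B.repRatio s = 1 → s = a ∨ s = b) ∧
      (∀ s, 0 < s → (1 < B.repRatio s ↔ a < s ∧ s < b)) := by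
  have hq := quietTime_pos hB
  have hanti := strictAntiOn_repRatio_quiet hB hγ
  have hmono := strictMonoOn_repRatio hB hγ h₀
  have hlast := strictAntiOn_repRatio hB hγ h₀
  rw [max_eq_right hq₀.le] at hlast
  have hlow : ∀ s, 0 < s → s ≤ B.quietTime → B.repRatio s < 1 := fun s hs hsq => by
    rw [← repRatio_zero hB]; exact hanti ⟨le_rfl, hq.le⟩ ⟨hs.le, hsq⟩ hs
  obtain ⟨a, ha, ha1⟩ := intermediate_value_Ioo hq₀.le continuous_repRatio.continuousOn
    ⟨hlow _ hq le_rfl, h⟩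
  obtain ⟨S, hS1, hSs⟩ := (((tendsto_repRatio hB hγ).eventually (gt_mem_nhds one_pos)).and
    (eventually_gt_atTop s₀)).exists
  obtain ⟨b, hb, hb1⟩ := intermediate_value_Ioo' hSs.le continuous_repRatio.continuousOn
    ⟨hS1, h⟩
  have hcmp : ∀ s, 0 < s → (s < a → B.repRatio s < 1) ∧ (a < s → s < b → 1 < B.repRatio s) ∧
      (b < s → B.repRatio s < 1) := by
    intro s hs
    refine ⟨fun hsa => ?_, fun has hsb => ?_, fun hbs => ?_⟩
    · rcases le_or_gt s B.quietTime with h1 | h1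
      · exact hlow s hs h1
      · rw [← ha1]; exact hmono ⟨h1.le, hsa.le.trans ha.2.le⟩ ⟨ha.1.le, ha.2.le⟩ hsa
    · rcases le_total s s₀ with h1 | h1
      · rw [← ha1]; exact hmono ⟨ha.1.le, ha.2.le⟩ ⟨ha.1.le.trans has.le, h1⟩ has
      · rw [← hb1]; exact hlast h1 hb.1.le hsb
    · rw [← hb1]; exact hlast hb.1.le (hb.1.le.trans hbs.le) hbs
  refine ⟨a, b, hq.trans ha.1, ha.2.trans hb.1, ha1, hb1, fun s hs hs1 => ?_, fun s hs => ?_⟩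
  · obtain ⟨h1, h2, h3⟩ := hcmp s hs
    rcases lt_trichotomy s a with h4 | h4 | h4
    · exact absurd hs1 (h1 h4).ne
    · exact Or.inl h4
    rcases lt_trichotomy s b with h5 | h5 | h5
    · exact absurd hs1 (h2 h4 h5).ne'
    · exact Or.inr h5
    · exact absurd hs1 (h3 h5).ne
  · obtain ⟨h1, h2, h3⟩ := hcmp s hs
    refine ⟨fun h4 => ⟨?_, ?_⟩, fun h4 => h2 h4.1 h4.2⟩
    · by_contra h5
      rcases (not_lt.1 h5).eq_or_lt with h6 | h6
      · rw [h6, ha1] at h4; exact lt_irrefl _ h4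
      · exact lt_asymm h4 (h1 h6)
    · by_contra h5
      rcases (not_lt.1 h5).eq_or_lt with h6 | h6
      · rw [← h6, hb1] at h4; exact lt_irrefl _ h4
      · exact lt_asymm h4 (h3 h6)

end PosRate

lemma repRatio_eq_one_of_zero_rate (hγ : B.γ₁ = 0) (s : ℝ) : B.repRatio s = 1 := by
  rw [repRatio_eq_one_iff, invRep, hγ, sub_zero, exp_eq_expGrowth]; ring

/-- Player 1 benefits from the challenge opportunity iff it builds a reputation faster. -/
lemma duration_lt_iff (hB : B.Valid) {T T₀ : ℝ} (hT : B.IsDuration T)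
    (hT₀ : B.withoutChallenge.IsDuration T₀) : T < T₀ ↔
      ∃ s, 0 < s ∧ B.z₁ = (B.invRep s)⁻¹ ∧ B.z₂ < Real.exp (-B.rate₂ * s) ∧ 1 < B.repRatio s := by
  have hmono := strictMono_durationFun hB.withoutChallenge
  have h0 : ∀ s, max (B.withoutChallenge.z₁ * B.withoutChallenge.invRep s)
      (B.withoutChallenge.z₂ * Real.exp (B.withoutChallenge.rate₂ * s))
      = max (B.z₁ * Real.exp (B.rate₁ * s)) (B.z₂ * Real.exp (B.rate₂ * s)) := fun s => by
    rw [invRep_withoutChallenge]; rfl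
  -- The left side of the duration equation without challenges is increasing and equals 1 at `T₀`.
  -- Only player 1's term differs between the games, so for `T < T₀` it must be the binding one with
  -- challenges.
  have hlt : T < T₀ ↔ max (B.z₁ * Real.exp (B.rate₁ * T)) (B.z₂ * Real.exp (B.rate₂ * T)) < 1 := by
    rw [← hmono.lt_iff_lt, hT₀.2, h0]
  have hz₁ := hB.z₁_mem.1
  have hz₂ := hB.z₂_mem.1
  have hexp : ∀ s, B.z₂ < Real.exp (-B.rate₂ * s) ↔ B.z₂ * Real.exp (B.rate₂ * s) < 1 := fun s => by
    rw [neg_mul, Real.exp_neg, ← one_div, lt_div_iff₀ (Real.exp_pos _)]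
  rw [hlt, max_lt_iff]
  constructor
  · rintro ⟨h1, h2⟩
    have h3 : B.z₁ * B.invRep T = 1 := by
      rcases max_choice (B.z₁ * B.invRep T) (B.z₂ * Real.exp (B.rate₂ * T)) with h | h
      · rw [← h, hT.2]
      · rw [hT.2] at h; linarith
    refine ⟨T, hT.1, eq_inv_of_mul_eq_one_left h3, (hexp T).2 h2, one_lt_repRatio_iff.2 ?_⟩
    exact lt_of_mul_lt_mul_left (h1.trans_eq h3.symm) hz₁.le
  · rintro ⟨s, hs, h1, h2, h3⟩
    have h4 : B.invRep s ≠ 0 := (zero_lt_one.trans_le (one_le_invRep hB hs.le)).ne'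
    have h5 : B.z₁ * B.invRep s = 1 := by rw [h1, inv_mul_cancel₀ h4]
    have h6 := (hexp s).1 h2
    have h7 : T = s := hT.unique hB ⟨hs, by rw [h5, max_eq_left h6.le]⟩
    rw [h7]
    refine ⟨?_, h6⟩
    rw [← h5]
    exact mul_lt_mul_of_pos_left (one_lt_repRatio_iff.1 h3) hz₁

/-- On both curves player 2's reputation is the same function of the time to go, so equal ordinates
mean equal times to go, that is, `invRep s = exp (rate₁ s)`. -/
lemma solutions_eq (hB : B.Valid) : {x ∈ Ioo (0 : ℝ) 1 | B.μTilde₂ x = B.withoutChallenge.μTilde₂ x}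
    = {x | ∃ s, 0 < s ∧ B.repRatio s = 1 ∧ x = (B.invRep s)⁻¹} := by
  have hB0 := hB.withoutChallenge
  have hr := rate₁_pos hB
  ext x
  constructor
  · rintro ⟨⟨hx0, hx1⟩, hx⟩
    set s₀ := -Real.log x / B.rate₁ with hs₀
    have hs₀p : 0 < s₀ := div_pos (neg_pos.2 (Real.log_neg hx0 hx1)) hr
    have hxs₀ : x = (B.withoutChallenge.invRep s₀)⁻¹ := by
      rw [invRep_withoutChallenge, hs₀, mul_div_cancel₀ _ hr.ne', Real.exp_neg, inv_inv,
        Real.exp_log hx0]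
    have h1 : B.withoutChallenge.μTilde₂ x = Real.exp (-B.rate₂ * s₀) := by
      rw [hxs₀]; exact μTilde₂_invRep hB0 hs₀p.le
    rw [h1] at hx
    -- The curve with challenges may stop short of `x`. The default value 0 there creates no
    -- spurious solution, as the other curve has a positive ordinate over all of `(0, 1)`.
    by_cases hc : ∀ s, 0 ≤ s → x ≠ (B.invRep s)⁻¹
    · rw [μTilde₂_of_forall_ne hB hc] at hx
      exact absurd hx (Real.exp_pos _).ne
    push Not at hc
    obtain ⟨s, hs, hxs⟩ := hc
    rw [hxs, μTilde₂_invRep hB hs, Real.exp_eq_exp] at hx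
    have h2 : s = s₀ := mul_left_cancel₀ (neg_ne_zero.2 (rate₂_pos hB).ne') hx
    rw [h2] at hxs
    refine ⟨s₀, hs₀p, repRatio_eq_one_iff.2 ?_, hxs⟩
    rw [← invRep_withoutChallenge]
    exact inv_injective (hxs.symm.trans hxs₀)
  · rintro ⟨s, hs, h1, rfl⟩
    have h2 : 1 < B.invRep s := by rw [← invRep_zero hB]; exact strictMono_invRep hB hs
    refine ⟨⟨inv_pos.2 (by linarith), inv_lt_one_of_one_lt₀ h2⟩, ?_⟩
    rw [μTilde₂_invRep hB hs.le, repRatio_eq_one_iff.1 h1, ← invRep_withoutChallenge]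
    exact (μTilde₂_invRep hB0 hs.le).symm

end BargainingGame

/-! ### Comparison of payoffs and conclusion -/

namespace BargainingGame

variable {B : BargainingGame}

lemma payoff_lt_iff (hB : B.Valid) {T T₀ : ℝ} :
    1 - B.a₂ + B.D * (1 - B.z₂ * Real.exp (B.rate₂ * T₀))
      < 1 - B.a₂ + B.D * (1 - B.z₂ * Real.exp (B.rate₂ * T)) ↔ T < T₀ := by
  rw [add_lt_add_iff_left, mul_lt_mul_iff_right₀ hB.D_pos, sub_lt_sub_iff_left,
    mul_lt_mul_iff_right₀ hB.z₂_mem.1, Real.exp_lt_exp, mul_lt_mul_iff_right₀ (rate₂_pos hB)]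

lemma inv_invRep_lt_iff (hB : B.Valid) {s t : ℝ} (hs : 0 ≤ s) (ht : 0 ≤ t) :
    (B.invRep s)⁻¹ < (B.invRep t)⁻¹ ↔ t < s := by
  rw [inv_lt_inv₀ (zero_lt_one.trans_le (one_le_invRep hB hs))
    (zero_lt_one.trans_le (one_le_invRep hB ht)), (strictMono_invRep hB).lt_iff_lt]

end BargainingGame

end
theorem mainTheorem6 (B : BargainingGame) (hB : B.Valid) :
    -- the curves with and without the challenge opportunity are graphs over player 1's reputation
    B.coevolutionCurve.InjOn Prod.fst ∧ B.withoutChallenge.coevolutionCurve.InjOn Prod.fst ∧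
    -- `u`, `u₀`: unique equilibrium payoffs of an unjustified player 1 with and without the
    -- challenge opportunity; `t`, `t₀`: times to build a reputation from `ν₁*` to `1`
    ∃ u u₀ μN t t₀ : ℝ,
      B.equilibriumPayoffs₁ = {u} ∧ B.withoutChallenge.equilibriumPayoffs₁ = {u₀} ∧
      B.reputationsAt B.μStar₂ = {μN} ∧
      B.timesToOne B.νStar = {t} ∧ B.withoutChallenge.timesToOne B.νStar = {t₀} ∧
      ((B.νStar < μN ∧ t < t₀) →
        ∃ μlo μhi : ℝ, μlo < μhi ∧
          {x ∈ Set.Ioo (0 : ℝ) 1 | B.μTilde₂ x = B.withoutChallenge.μTilde₂ x} = {μlo, μhi} ∧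
          (u₀ < u ↔
            (μlo < B.z₁ ∧ B.z₁ < μhi) ∧
            (B.μTilde₂ μlo < B.μTilde₂ B.z₁ ∧ B.μTilde₂ B.z₁ < B.μTilde₂ μhi) ∧
            B.z₂ < B.μTilde₂ B.z₁)) ∧
      (¬ (B.νStar < μN ∧ t < t₀) → u ≤ u₀) := by
  have hB0 := hB.withoutChallenge
  have hr := BargainingGame.rate₁_pos hB
  have hr2 := BargainingGame.rate₂_pos hB
  obtain ⟨T, hT⟩ := BargainingGame.exists_isDuration hB
  obtain ⟨T₀, hT₀⟩ := BargainingGame.exists_isDuration hB0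
  obtain ⟨t, ht, ht1⟩ := BargainingGame.exists_invRep_eq hB
  obtain ⟨t₀, ht₀, ht₀1⟩ := BargainingGame.exists_invRep_eq hB0
  -- the condition in terms of times to go
  have hA : (B.νStar < (B.invRep B.quietTime)⁻¹ ∧ t < t₀) ↔
      (B.quietTime < t ∧ 1 < B.repRatio t) := by
    have h1 : B.νStar = (B.invRep t)⁻¹ := by rw [ht1, BargainingGame.νStar_eq hB]
    rw [h1, BargainingGame.inv_invRep_lt_iff hB ht.le (BargainingGame.quietTime_pos hB).le,
      BargainingGame.one_lt_repRatio_iff]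
    have h2 : B.invRep t = Real.exp (B.rate₁ * t₀) := by
      rw [ht1, ← BargainingGame.invRep_withoutChallenge, ht₀1]; rfl
    rw [h2, Real.exp_lt_exp, mul_lt_mul_iff_right₀ hr]
  refine ⟨BargainingGame.injOn_coevolutionCurve hB, BargainingGame.injOn_coevolutionCurve hB0,
    _, _, _, t, t₀, BargainingGame.equilibriumPayoffs₁_eq hB hT,
    BargainingGame.equilibriumPayoffs₁_eq hB0 hT₀, BargainingGame.reputationsAt_μStar₂ hB,
    BargainingGame.timesToOne_νStar hB ht ht1, BargainingGame.timesToOne_νStar hB0 ht₀ ht₀1, ?_, ?_⟩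
  · rw [hA]
    rintro ⟨hq, h1⟩
    have hγ : 0 < B.γ₁ := by
      refine lt_of_le_of_ne hB.γ₁_nonneg fun h => ?_
      rw [BargainingGame.repRatio_eq_one_of_zero_rate h.symm] at h1
      exact lt_irrefl _ h1
    obtain ⟨a, b, ha, hab, ha1, hb1, honly, hgt⟩ :=
      BargainingGame.exists_repRatio_eq_one hB hγ ht1 hq h1
    have hb := ha.trans hab
    -- Reputation decreases with the time to go, so the later crossing `b` gives the smaller root.
    refine ⟨(B.invRep b)⁻¹, (B.invRep a)⁻¹,
      (BargainingGame.inv_invRep_lt_iff hB hb.le ha.le).2 hab, ?_, ?_⟩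
    · rw [BargainingGame.solutions_eq hB]
      ext x
      simp only [mem_ofPred_eq, mem_insert_iff, mem_singleton_iff]
      constructor
      · rintro ⟨s, hs, hs1, rfl⟩
        rcases honly s hs hs1 with rfl | rfl
        · exact Or.inr rfl
        · exact Or.inl rfl
      · rintro (rfl | rfl)
        · exact ⟨b, hb, hb1, rfl⟩
        · exact ⟨a, ha, ha1, rfl⟩
    · refine (BargainingGame.payoff_lt_iff hB).trans
        ((BargainingGame.duration_lt_iff hB hT hT₀).trans ?_)
      rw [BargainingGame.μTilde₂_invRep hB ha.le, BargainingGame.μTilde₂_invRep hB hb.le]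
      constructor
      · rintro ⟨s, hs, hz, hz2, hs1⟩
        obtain ⟨has, hsb⟩ := (hgt s hs).1 hs1
        rw [hz, BargainingGame.μTilde₂_invRep hB hs.le, BargainingGame.inv_invRep_lt_iff hB hb.le hs.le,
          BargainingGame.inv_invRep_lt_iff hB hs.le ha.le, Real.exp_lt_exp, Real.exp_lt_exp]
        refine ⟨⟨hsb, has⟩, ⟨?_, ?_⟩, hz2⟩ <;> nlinarith
      · rintro ⟨⟨h2, h3⟩, -, h4⟩
        have hpos : ∀ s, 0 ≤ s → 0 < B.invRep s := fun s hs =>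
          zero_lt_one.trans_le (BargainingGame.one_le_invRep hB hs)
        -- Continuity of `invRep` provides a time to go at which player 1's reputation is `z₁`; it
        -- lies strictly between the crossings.
        obtain ⟨s, hs, hs1⟩ := intermediate_value_Ioo hab.le
          (BargainingGame.continuous_invRep (B := B)).continuousOn
          (show B.z₁⁻¹ ∈ Ioo (B.invRep a) (B.invRep b) from
            ⟨(lt_inv_comm₀ hB.z₁_mem.1 (hpos a ha.le)).1 h3,
              (inv_lt_comm₀ (hpos b hb.le) hB.z₁_mem.1).1 h2⟩)
        have hs0 : 0 < s := ha.trans hs.1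
        have hz : B.z₁ = (B.invRep s)⁻¹ := by rw [hs1, inv_inv]
        refine ⟨s, hs0, hz, ?_, (hgt s hs0).2 hs⟩
        rwa [hz, BargainingGame.μTilde₂_invRep hB hs0.le] at h4
  · rw [hA]
    intro hnA
    refine not_lt.1 fun hlt => ?_
    obtain ⟨s, hs, -, -, hs1⟩ := (BargainingGame.duration_lt_iff hB hT hT₀).1
      ((BargainingGame.payoff_lt_iff hB).1 hlt)
    rcases hB.γ₁_nonneg.eq_or_lt with hγ | hγ
    · rw [BargainingGame.repRatio_eq_one_of_zero_rate hγ.symm] at hs1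
      exact lt_irrefl _ hs1
    · exact absurd hs1 (not_lt.2 (BargainingGame.repRatio_le_one hB hγ ht1 hnA hs.le))
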